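/- **Theorem (moments via characters).** Let $n,k\ge 1$. Let $A_1,\dots,A_n$ be i.i.d. random variables with the uniform distribution $U(0,1)$ and let $(B_1,\dots,B_k)$ be a random vector, independent of $(A_1,\dots,A_n)$, uniformly distributed on $\{(b_1,\dots,b_k): 0\le b_1\le\dots\le b_k\le 1\}$. Let $\Lambda_n$ be the shape of the tableau produced by Robinson–Schensted(–Knuth) row insertion from $(A_1,\dots,A_n)$ and let $\Gamma_{n+k}\supset\Lambda_n$ be the shape produced from the concatenated sequence $(A_1,\dots,A_n,B_1,\dots,B_k)$ (so $(\Lambda_n,\Gamma_{n+k})$ is a Pieri growth pair). Let $u_{n+1},\dots,u_{n+k}$ be the contents (column index minus row index) of the $k$ boxes of $\Gamma_{n+k}\setminus\Lambda_n$, listed in an arbitrary order. Then for every symmetric polynomial $P$ in $k$ variables with complex coefficients, $P(u_{n+1},\dots,u_{n+k})$ is integrable and $$\mathbb{E}\,P(u_{n+1},\dots,u_{n+k})=\left(\chi^{\mathrm{reg}}_{S_n}\otimes\chi^{\mathrm{triv}}_{S_k}\right)\left(P(X_{n+1},\dots,X_{n+k})\big\downarrow^{S_{n+k}}_{S_n\times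 S_k}\right).$$ Here $X_i=(1,i)+\dots+(i-1,i)\in\mathbb{C}[S_{n+k}]$ are the (pairwise commuting) Jucys–Murphy elements; $S_n\times S_k$ is the subgroup of $S_{n+k}$ of the permutations preserving $\{1,\dots,n\}$ and $\{n+1,\dots,n+k\}$; $F\big\downarrow^{S_{n+k}}_{S_n\times S_k}\in\mathbb{C}[S_n\times S_k]$ is the restriction of $F\in\mathbb{C}[S_{n+k}]$, seen as a function on $S_{n+k}$, to this subgroup; $\chi^{\mathrm{reg}}_{S_n}$ and $\chi^{\mathrm{triv}}_{S_k}$ are the normalized characters $g\mapsto \operatorname{Tr}\rho(g)/\dim V$ of the regular representation of $S_n$ and of the one-dimensional trivial representation of $S_k$; $(\chi\otimes\psi)(g,h)=\chi(g)\psi(h)$; and a character is extended linearly to the group algebra by $\chi(f)=\sum_g f(g)\chi(g)$. -/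

import Mathlib

/-! ### Robinson–Schensted insertion and the associated shape -/

namespace PieriGrowth

section RSK

variable {α : Type*} [LinearOrder α]

/-- Row insertion of `x`: `x` replaces the first entry that is larger than `x`, and that entry is
returned as the bumped one; if there is no such entry, `x` is put at the end of the row. -/
def rowInsert (x : α) : List α → List α × Option α
  | [] => ([x], none)
  | y :: r => if x < y then (x :: r, some y) else (y :: (rowInsert x r).1, (rowInsert x r).2)

/-- Insertion of `x` into a tableau (given by the list of its rows): `x` is inserted into the
first row, the entry bumped from a row is inserted into the next one. -/
def tableauInsert : List (List α) → α → List (List α)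
  | [], x => [[x]]
  | r :: T, x =>
    match (rowInsert x r).2 with
    | none => (rowInsert x r).1 :: T
    | some y => (rowInsert x r).1 :: tableauInsert T y

/-- The insertion tableau of a finite sequence. -/
def insertionTableau (l : List α) : List (List α) :=
  l.foldl tableauInsert []

/-- The row `s` may stand directly after the row `r` in a tableau: `s` is not longer than `r`, and
the entries increase strictly along the columns. -/
def Dominates : List α → List α → Prop
  | _, [] => True
  | [], _ :: _ => False
  | a :: r, b :: s => a < b ∧ Dominates r s

theorem Dominates.length_le : ∀ {r s : List α}, Dominates r s → s.length ≤ r.length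
  | _, [], _ => by simp
  | [], _ :: _, h => h.elim
  | _ :: _, _ :: _, h => by simpa using h.2.length_le

theorem rowInsert_bumped_gt (x : α) :
    ∀ (r : List α) {y : α}, (rowInsert x r).2 = some y → x < y
  | [], y, h => by simp [rowInsert] at h
  | a :: r, y, h => by
    by_cases hx : x < a
    · simp only [rowInsert, hx, if_true, Option.some.injEq] at h
      exact h ▸ hx
    · simp only [rowInsert, hx, if_false] at h
      exact rowInsert_bumped_gt x r h

theorem Dominates.rowInsert_left (x : α) :
    ∀ {r s : List α}, Dominates r s → Dominates (rowInsert x r).1 s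
  | _, [], _ => by simp [Dominates]
  | [], _ :: _, h => h.elim
  | a :: r, b :: s, h => by
    by_cases hx : x < a
    · simp only [rowInsert, hx, if_true]
      exact ⟨hx.trans h.1, h.2⟩
    · simp only [rowInsert, hx, if_false]
      exact ⟨h.1, h.2.rowInsert_left x⟩

theorem Dominates.rowInsert_both (x : α) : ∀ {r s : List α} {y : α}, Dominates r s →
    (rowInsert x r).2 = some y → Dominates (rowInsert x r).1 (rowInsert y s).1
  | [], _, y, _, h => by simp [rowInsert] at h
  | a :: r, [], y, _, hy => by
    have hxy := rowInsert_bumped_gt x _ hy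
    by_cases hx : x < a
    · simp [rowInsert, hx, Dominates, hxy]
    · simp only [rowInsert, hx, if_false, Dominates, and_true]
      exact (not_lt.mp hx).trans_lt hxy
  | a :: r, b :: s, y, h, hy => by
    have hxy := rowInsert_bumped_gt x _ hy
    by_cases hx : x < a
    · simp only [rowInsert, hx, if_true, Option.some.injEq] at hy ⊢
      subst hy
      simp only [h.1, if_true]
      exact ⟨hx, h.2⟩
    · simp only [rowInsert, hx, if_false] at hy ⊢
      by_cases hb : y < b
      · simp only [hb, if_true]
        exact ⟨(not_lt.mp hx).trans_lt hxy, h.2.rowInsert_left x⟩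
      · simp only [hb, if_false]
        exact ⟨h.1, h.2.rowInsert_both x hy⟩

theorem isChain_tableauInsert : ∀ (T : List (List α)) (x : α), T.IsChain Dominates →
    (tableauInsert T x).IsChain Dominates
  | [], x, _ => by simp [tableauInsert]
  | r :: T, x, h => by
    unfold tableauInsert
    split
    · cases T with
      | nil => simp
      | cons s T =>
        rw [List.isChain_cons_cons] at h ⊢
        exact ⟨h.1.rowInsert_left x, h.2⟩
    · rename_i y hy
      have ih := isChain_tableauInsert T y h.tail
      cases T with
      | nil =>
        simp only [tableauInsert, List.isChain_cons_cons, List.isChain_singleton, and_true]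
        exact Dominates.rowInsert_both x (s := []) (by cases r <;> trivial) hy
      | cons s T =>
        rw [List.isChain_cons_cons] at h
        have hrs := h.1.rowInsert_both x hy
        unfold tableauInsert at ih ⊢
        split at ih <;> (rw [List.isChain_cons_cons]; exact ⟨hrs, ih⟩)

theorem isChain_insertionTableau (l : List α) : (insertionTableau l).IsChain Dominates := by
  induction l using List.reverseRecOn with
  | nil => simp [insertionTableau]
  | append_singleton l x ih =>
    rw [insertionTableau, List.foldl_append]
    exact isChain_tableauInsert _ x ih

theorem sortedGE_rowLengths (l : List α) :
    ((insertionTableau l).map List.length).SortedGE := by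
  rw [List.sortedGE_iff_isChain, List.isChain_map]
  exact (isChain_insertionTableau l).imp fun _ _ h => h.length_le

/-- The shape associated to a finite sequence: the Young diagram whose rows have the lengths of the
rows of the insertion tableau. As for all of Mathlib's Young diagrams, the box `(i, j)` is in row
`i` and column `j`, counted from `0`. -/
def rskShape (l : List α) : YoungDiagram :=
  YoungDiagram.ofRowLens ((insertionTableau l).map List.length) (sortedGE_rowLengths l)

end RSK

/-- The set of boxes of the skew diagram `Γ ∖ Λ`. -/
def skewBoxes (Λ Γ : YoungDiagram) : Finset (ℕ × ℕ) := Γ.cells \ Λ.cells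

/-- The `u`-coordinate (content) of a box: its column minus its row. -/
def uCoord (c : ℕ × ℕ) : ℤ := (c.2 : ℤ) - (c.1 : ℤ)

section Sanity

variable {α : Type*} [LinearOrder α]

theorem rowInsert_length (x : α) : ∀ r : List α,
    (rowInsert x r).1.length = r.length + (if (rowInsert x r).2 = none then 1 else 0)
  | [] => by simp [rowInsert]
  | a :: r => by
    by_cases hx : x < a
    · simp [rowInsert, hx]
    · simp only [rowInsert, hx, if_false, List.length_cons, rowInsert_length x r]
      omega

theorem tableauInsert_sum : ∀ (T : List (List α)) (x : α),
    ((tableauInsert T x).map List.length).sum = (T.map List.length).sum + 1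
  | [], x => by simp [tableauInsert]
  | r :: T, x => by
    have h := rowInsert_length x r
    unfold tableauInsert
    split <;> rename_i hy
    · simp [h, hy]; omega
    · simp [h, hy, tableauInsert_sum T]; omega

theorem cellsOfRowLens_mono : ∀ (T : List (List α)) (x : α),
    YoungDiagram.cellsOfRowLens (T.map List.length) ⊆
      YoungDiagram.cellsOfRowLens ((tableauInsert T x).map List.length)
  | [], x => by simp [YoungDiagram.cellsOfRowLens]
  | r :: T, x => by
    have h : r.length ≤ (rowInsert x r).1.length := by simp [rowInsert_length x r]
    unfold tableauInsert
    split
    · refine Finset.union_subset_union ?_ subset_rfl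
      gcongr
    · refine Finset.union_subset_union ?_ (Finset.map_subset_map.2 (cellsOfRowLens_mono T _))
      gcongr

theorem card_cellsOfRowLens : ∀ w : List ℕ, (YoungDiagram.cellsOfRowLens w).card = w.sum
  | [] => by simp [YoungDiagram.cellsOfRowLens]
  | a :: w => by
    rw [YoungDiagram.cellsOfRowLens, Finset.card_union_of_disjoint]
    · simp [card_cellsOfRowLens w]
    · rw [Finset.disjoint_left]
      rintro ⟨i, j⟩ h1 h2
      simp at h1 h2
      omega

theorem card_rskShape (l : List α) : (rskShape l).card = l.length := by
  change (YoungDiagram.cellsOfRowLens _).card = _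
  rw [card_cellsOfRowLens]
  induction l using List.reverseRecOn with
  | nil => simp [insertionTableau]
  | append_singleton l x ih =>
    rw [insertionTableau, List.foldl_append] at *
    simpa [tableauInsert_sum] using ih

theorem rskShape_le_append (l l' : List α) : rskShape l ≤ rskShape (l ++ l') := by
  induction l' using List.reverseRecOn with
  | nil => simp
  | append_singleton l' x ih =>
    refine ih.trans ?_
    rw [← List.append_assoc, ← YoungDiagram.cells_subset_iff]
    change YoungDiagram.cellsOfRowLens _ ⊆ YoungDiagram.cellsOfRowLens _
    rw [insertionTableau, insertionTableau, List.foldl_append (l := l ++ l')]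
    exact cellsOfRowLens_mono _ x

/-- The shape grows by exactly as many boxes as there are new letters. -/
theorem card_skewBoxes (l l' : List α) :
    (skewBoxes (rskShape l) (rskShape (l ++ l'))).card = l'.length := by
  have h1 := card_rskShape l
  have h2 := card_rskShape (l ++ l')
  rw [YoungDiagram.card] at h1 h2
  rw [skewBoxes, Finset.card_sdiff_of_subset
    (YoungDiagram.cells_subset_iff.2 (rskShape_le_append l l')), h1, h2]
  simp

end Sanity

/-! ### Jucys–Murphy elements -/

open Equiv in
/-- The Jucys–Murphy element `X_i = ∑_{j < i} (j, i)` in the group algebra. -/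
noncomputable def jucysMurphy {N : ℕ} (i : Fin N) : MonoidAlgebra ℂ (Perm (Fin N)) :=
  ∑ j ∈ Finset.Iio i, MonoidAlgebra.of ℂ (Perm (Fin N)) (swap j i)

theorem commute_jucysMurphy_of_lt {N : ℕ} {i j : Fin N} (h : i < j) :
    Commute (jucysMurphy i) (jucysMurphy j) := by
  refine Commute.sum_left _ _ _ fun a ha => ?_
  have ha : a < i := by simpa using ha
  have key : ∀ b : Fin N, Equiv.swap a i b < j ↔ b < j := fun b => by
    rcases eq_or_ne b a with rfl | h1
    · simp [h, ha.trans h]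
    rcases eq_or_ne b i with rfl | h2
    · simp [h, ha.trans h]
    · rw [Equiv.swap_apply_of_ne_of_ne h1 h2]
  have hj : Equiv.swap a i j = j := Equiv.swap_apply_of_ne_of_ne (ha.trans h).ne' h.ne'
  rw [Commute, SemiconjBy, jucysMurphy, Finset.mul_sum, Finset.sum_mul]
  refine Finset.sum_equiv (Equiv.swap a i) (by simp [key]) fun b _ => ?_
  rw [← map_mul, ← map_mul, Equiv.mul_swap_eq_swap_mul, hj]

/-- The Jucys–Murphy elements commute. -/
theorem commute_jucysMurphy {N : ℕ} (i j : Fin N) :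
    Commute (jucysMurphy i) (jucysMurphy j) := by
  rcases lt_trichotomy i j with h | rfl | h
  · exact commute_jucysMurphy_of_lt h
  · exact Commute.refl _
  · exact (commute_jucysMurphy_of_lt h).symm

/-- The value `P(a₁, …, a_k)` of a polynomial at pairwise commuting elements of an algebra. -/
noncomputable def evalCommuting {k : ℕ} {R : Type*} [Ring R] [Algebra ℂ R] (a : Fin k → R)
    (ha : ∀ i j, Commute (a i) (a j)) (P : MvPolynomial (Fin k) ℂ) : R :=
  ∑ m ∈ P.support, P.coeff m •
    Finset.univ.noncommProd (fun i => a i ^ m i) (fun i _ j _ _ => (ha i j).pow_pow _ _)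

/-- `P(X_{n+1}, …, X_{n+k})` in the group algebra of `S_{n+k}`. -/
noncomputable def evalJucysMurphy (n : ℕ) {k : ℕ} (P : MvPolynomial (Fin k) ℂ) :
    MonoidAlgebra ℂ (Equiv.Perm (Fin (n + k))) :=
  evalCommuting (fun i : Fin k => jucysMurphy (Fin.natAdd n i))
    (fun _ _ => commute_jucysMurphy _ _) P

/-! ### Restriction to `S_n × S_k` and normalized characters -/

/-- The embedding `S_n × S_k → S_{n+k}`: the first factor permutes the first `n` points, the second
factor permutes the last `k` points. -/
def youngEmbedding (n k : ℕ) (g : Equiv.Perm (Fin n) × Equiv.Perm (Fin k)) :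
    Equiv.Perm (Fin (n + k)) :=
  finSumFinEquiv.permCongr (Equiv.Perm.sumCongrHom (Fin n) (Fin k) g)

/-- The restriction of `F`, seen as a function on `S_{n+k}`, to the subgroup `S_n × S_k`. -/
noncomputable def restrictYoung {n k : ℕ} (F : MonoidAlgebra ℂ (Equiv.Perm (Fin (n + k)))) :
    MonoidAlgebra ℂ (Equiv.Perm (Fin n) × Equiv.Perm (Fin k)) :=
  MonoidAlgebra.ofCoeff (Finsupp.equivFunOnFinite.symm fun g => F.coeff (youngEmbedding n k g))

/-- The normalized character `Tr ρ(g) / dim V` of a representation. -/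
noncomputable def normalizedCharacter {G V : Type*} [Monoid G] [AddCommGroup V] [Module ℂ V]
    (ρ : Representation ℂ G V) (g : G) : ℂ :=
  ρ.character g / (Module.finrank ℂ V : ℂ)

/-- The normalized character of the regular representation. -/
noncomputable def chiReg (G : Type*) [Group G] : G → ℂ :=
  normalizedCharacter (Representation.leftRegular ℂ G)

/-- The normalized character of the (one-dimensional) trivial representation. -/
noncomputable def chiTriv (G : Type*) [Group G] : G → ℂ :=
  normalizedCharacter (Representation.trivial ℂ G ℂ)

/-- The tensor product `(χ ⊗ ψ)(g, h) = χ(g) ψ(h)`. -/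
def tensorChar {G H : Type*} (χ : G → ℂ) (ψ : H → ℂ) : G × H → ℂ :=
  fun g => χ g.1 * ψ g.2

/-- The linear extension `χ(f) = ∑_g f(g) χ(g)` to the group algebra. -/
noncomputable def charApply {G : Type*} [Fintype G] (χ : G → ℂ) (f : MonoidAlgebra ℂ G) : ℂ :=
  ∑ g, f.coeff g * χ g

/-! ### The set of ordered vectors in the cube -/

/-- The set `{(b₁, …, b_k) : 0 ≤ b₁ ≤ … ≤ b_k ≤ 1}`. -/
def orderedCube (k : ℕ) : Set (Fin k → ℝ) :=
  {b | (∀ i, b i ∈ Set.Icc (0 : ℝ) 1) ∧ Monotone b}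

end PieriGrowth

open PieriGrowth MeasureTheory ProbabilityTheory

/-! Write N = n + k. Almost surely the sample values are distinct, and their relative order is then
uniform on the permutations σ of N points that increase on the last k points
(`integral_eq_average`). Insertion depends only on this order (`rskShape_map`), so the expectation
is the average, over these σ, of P at the contents of the last k boxes of the recording path of σ.

The algebraic side lives on the space of functions on all paths of length N in the Young graph, that
is, on all standard tableaux with N boxes. Young's seminormal form makes S_N act there, each
Jucys–Murphy element acting as multiplication by a content (`sum_seminormal_swap`). Weight the trace
by the dimension of the final shape. The result is the trace of the regular representation: N! at
the identity and 0 elsewhere (`dimTrace_seminormal`). This is proved without semisimplicity. The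
weighted trace is a class function; it is annihilated by the Jucys–Murphy elements because the
transition measure of a shape is centred; and such a class function vanishes off the identity
(`classFunction_eq_zero`). Hence the weighted trace of (projection onto S_k-invariants) · F is N!/k!
times the sum of the coefficients of F on S_k, which is N!/k! times the character in the theorem.

The two sides meet through the key of a path: its first n steps together with its final shape. For
symmetric P, the operator P(X_{n+1}, …, X_{n+k}) is multiplication by a function of the key. Its
weighted trace against the projection is therefore the sum over keys of dimension × rank of the
projection on the key block × value. It remains to see that exactly dimension × rank admissible σ
have a given key (`keyCount_eq`). The inequality ≤ is elementary: Robinson–Schensted is injective,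
an increasing tail adds a horizontal strip whose filling is forced by the key, and for a horizontal
strip the indicator of the block is invariant, so the rank is at least 1. Both sides have the same
sum N!/k! over all keys, so every inequality is an equality. Neither surjectivity of
Robinson–Schensted nor the Pieri rule is needed beforehand. -/

namespace PieriGrowth

/-! ### The Coxeter presentation of the symmetric group -/

section Coxeter

variable {P : Type*} [Monoid P] {a : ℕ → P} {N : ℕ}

/-- The Coxeter relations of type `A` for the first generators `a 0, …, a (N - 2)`. -/
structure CoxeterRel (N : ℕ) (a : ℕ → P) : Prop where
  sq : ∀ i, i + 1 < N → a i * a i = 1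
  braid : ∀ i, i + 2 < N → a i * (a (i + 1) * a i) = a (i + 1) * (a i * a (i + 1))
  comm : ∀ i j, i + 1 < j → j + 1 < N → a i * a j = a j * a i

theorem CoxeterRel.mono {N' : ℕ} (h : CoxeterRel N' a) (hN : N ≤ N') : CoxeterRel N a :=
  ⟨fun i hi => h.sq i (by omega), fun i hi => h.braid i (by omega),
    fun i j hi hj => h.comm i j hi (by omega)⟩

/-- The coset representative `a (N - d) * ⋯ * a (N - 1)`. -/
def cosetRep (a : ℕ → P) (N : ℕ) : ℕ → P
  | 0 => 1
  | d + 1 => a (N - d - 1) * cosetRep a N d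

/-- All factors of the representative have index at least `i + 2`, so they commute with `a i`. -/
theorem CoxeterRel.mul_cosetRep_of_lt (h : CoxeterRel (N + 1) a) (i : ℕ) :
    ∀ d, i + 1 + d < N → a i * cosetRep a N d = cosetRep a N d * a i
  | 0, _ => by simp [cosetRep]
  | d + 1, hd => by
    rw [cosetRep, ← mul_assoc, h.comm i (N - d - 1) (by omega) (by omega), mul_assoc,
      h.mul_cosetRep_of_lt i d (by omega), mul_assoc]

/-- `a i` commutes with the factors up to index i - 2, the braid relation turns a_i a_{i-1} a_i into
a_{i-1} a_i a_{i-1}, and the last a_{i-1} commutes with the remaining factors. -/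
theorem CoxeterRel.mul_cosetRep_of_gt (h : CoxeterRel (N + 1) a) (i : ℕ) (hi : i < N) :
    ∀ d, d ≤ N → N < i + d → a i * cosetRep a N d = cosetRep a N d * a (i - 1)
  | 0, _, hd => by omega
  | 1, _, hd => by omega
  | d + 2, hd, hid => by
    -- Either the representative starts with a_{i-1} a_i and the braid relation applies, or its
    -- first factor commutes with a_i.
    by_cases hc : N = i + d + 1
    · obtain ⟨i, rfl⟩ : ∃ j, i = j + 1 := ⟨i - 1, by omega⟩
      have e1 : N - (d + 1) - 1 = i := by omega
      have e2 : N - d - 1 = i + 1 := by omega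
      rw [cosetRep, cosetRep, e1, e2]
      have h1 := h.mul_cosetRep_of_lt i d (by omega)
      rw [Nat.add_sub_cancel, mul_assoc, mul_assoc, ← h1, ← mul_assoc (a i) (a (i + 1)),
        ← mul_assoc (a (i + 1)), ← h.braid i (by omega)]
      simp only [mul_assoc]
    · rw [cosetRep, ← mul_assoc, ← h.comm (N - (d + 1) - 1) i (by omega) (by omega), mul_assoc,
        h.mul_cosetRep_of_gt i hi (d + 1) (by omega) (by omega), mul_assoc]

/-- Normal form with respect to the parabolic on one generator less. Left multiplication by `a i`
passes through the representative (i < N - d - 1), lengthens it (i = N - d - 1), shortens it (i = N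
- d), or passes through as `a (i - 1)` (i > N - d). -/
theorem CoxeterRel.exists_cosetRep (h : CoxeterRel (N + 1) a) {x : P}
    (hx : x ∈ Submonoid.closure (a '' Set.Iio N)) :
    ∃ d ≤ N, ∃ y ∈ Submonoid.closure (a '' Set.Iio (N - 1)), x = cosetRep a N d * y := by
  induction hx using Submonoid.closure_induction_left with
  | one => exact ⟨0, by simp, 1, Submonoid.one_mem _, by simp [cosetRep]⟩
  | mul_left x hx y hy ih =>
    obtain ⟨i, hi, rfl⟩ := hx
    obtain ⟨d, hd, z, hz, rfl⟩ := ih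
    have hi : i < N := hi
    have mem : ∀ j, j < N - 1 → a j ∈ Submonoid.closure (a '' Set.Iio (N - 1)) := fun j hj =>
      Submonoid.subset_closure ⟨j, hj, rfl⟩
    rcases lt_trichotomy (i + d) N with hlt | heq | hgt
    · by_cases hc : i + d + 1 = N
      · refine ⟨d + 1, by omega, z, hz, ?_⟩
        rw [cosetRep, show N - d - 1 = i by omega, mul_assoc]
      · refine ⟨d, hd, a i * z, mul_mem (mem i (by omega)) hz, ?_⟩
        rw [← mul_assoc, h.mul_cosetRep_of_lt i d (by omega), mul_assoc]
    · obtain ⟨d, rfl⟩ : ∃ e, d = e + 1 := ⟨d - 1, by omega⟩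
      refine ⟨d, by omega, z, hz, ?_⟩
      rw [cosetRep, show N - d - 1 = i by omega, ← mul_assoc, ← mul_assoc, h.sq i (by omega),
        one_mul]
    · refine ⟨d, hd, a (i - 1) * z, mul_mem (mem _ (by omega)) hz, ?_⟩
      rw [← mul_assoc, h.mul_cosetRep_of_gt i hi d hd hgt, mul_assoc]

open Equiv

theorem coxeterRel_swap (N : ℕ) : CoxeterRel N fun i => swap i (i + 1) := by
  refine ⟨fun i _ => swap_mul_self _ _, fun i _ => ?_, fun i j hij _ => ?_⟩
  · ext x
    simp only [Perm.mul_apply, swap_apply_def]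
    split_ifs <;> omega
  · ext x
    simp only [Perm.mul_apply, swap_apply_def]
    split_ifs <;> omega

/-! ### The homomorphism as the graph generated by the pairs (adjacent transposition, image). -/

variable {M : Type*} [Monoid M] {t : ℕ → M}

/-- Adjacent transpositions paired with elements of a monoid. -/
def swapPair (t : ℕ → M) (i : ℕ) : Perm ℕ × M := (swap i (i + 1), t i)

theorem coxeterRel_swapPair (h : CoxeterRel N t) : CoxeterRel N (swapPair t) :=
  ⟨fun i hi => Prod.ext ((coxeterRel_swap N).sq i hi) (h.sq i hi),
    fun i hi => Prod.ext ((coxeterRel_swap N).braid i hi) (h.braid i hi),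
    fun i j hi hj => Prod.ext ((coxeterRel_swap N).comm i j hi hj) (h.comm i j hi hj)⟩

/-- The image of the point `N` tells which coset representative occurs in a normal form. -/
theorem cosetRep_swapPair_apply (t : ℕ → M) (N : ℕ) :
    ∀ d, d ≤ N → (cosetRep (swapPair t) N d).1 N = N - d
  | 0, _ => by simp [cosetRep]
  | d + 1, hd => by
    rw [cosetRep, Prod.fst_mul, Perm.mul_apply, cosetRep_swapPair_apply t N d (by omega), swapPair,
      show N - d = N - d - 1 + 1 by omega, Nat.add_sub_cancel, swap_apply_right]
    omega

theorem swapPair_closure_apply {N : ℕ} {x : Perm ℕ × M}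
    (hx : x ∈ Submonoid.closure (swapPair t '' Set.Iio (N - 1))) {m : ℕ} (hm : N ≤ m) :
    x.1 m = m := by
  induction hx using Submonoid.closure_induction_left with
  | one => rfl
  | mul_left x hx y hy ih =>
    obtain ⟨i, hi, rfl⟩ := hx
    have hi : i < N - 1 := hi
    rw [Prod.fst_mul, Perm.mul_apply, ih]
    exact swap_apply_of_ne_of_ne (by omega) (by omega)

/-- The generated submonoid is the graph of a function. In normal form, the image of the point N
under the permutation determines the representative; cancelling it leaves elements of the smaller
parabolic, and induction applies. -/
theorem swapPair_closure_unique : ∀ {N : ℕ}, CoxeterRel N t → ∀ {x y : Perm ℕ × M},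
    x ∈ Submonoid.closure (swapPair t '' Set.Iio (N - 1)) →
    y ∈ Submonoid.closure (swapPair t '' Set.Iio (N - 1)) → x.1 = y.1 → x.2 = y.2
  | 0, _, x, y, hx, hy, _ => by
    have e : Set.Iio (0 - 1) = (∅ : Set ℕ) := by ext; simp
    rw [e, Set.image_empty, Submonoid.closure_empty, Submonoid.mem_bot] at hx hy
    rw [hx, hy]
  | N + 1, h, x, y, hx, hy, hxy => by
    have h' := coxeterRel_swapPair h
    rw [Nat.add_sub_cancel] at hx hy
    obtain ⟨d, hd, z, hz, rfl⟩ := h'.exists_cosetRep hx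
    obtain ⟨e, he, w, hw, rfl⟩ := h'.exists_cosetRep hy
    have hde : d = e := by
      have := congrArg (fun f => f N) hxy
      simp only [Prod.fst_mul, Perm.mul_apply, swapPair_closure_apply hz le_rfl,
        swapPair_closure_apply hw le_rfl, cosetRep_swapPair_apply t N _ hd,
        cosetRep_swapPair_apply t N _ he] at this
      omega
    subst hde
    rw [Prod.snd_mul, Prod.snd_mul,
      swapPair_closure_unique (h.mono (by omega)) hz hw (mul_left_cancel hxy)]

/-- A permutation of `Fin N` seen as a permutation of `ℕ`. -/
def finToNat (N : ℕ) : Perm (Fin N) →* Perm ℕ :=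
  Perm.extendDomainHom (Fin.equivSubtype (n := N))

theorem extendDomain_swap {α β : Type*} [DecidableEq α] [DecidableEq β] {p : β → Prop}
    [DecidablePred p] (f : α ≃ Subtype p) (a b : α) :
    (swap a b).extendDomain f = swap (f a : β) (f b) := by
  ext x
  by_cases hx : p x
  · obtain ⟨y, hy⟩ : ∃ y, (f y : β) = x := ⟨f.symm ⟨x, hx⟩, by simp⟩
    rw [← hy, Perm.extendDomain_apply_image, swap_apply_def, swap_apply_def]
    simp only [Subtype.coe_inj, f.injective.eq_iff]
    split_ifs <;> rfl
  · rw [Perm.extendDomain_apply_not_subtype _ _ hx, swap_apply_of_ne_of_ne]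
    · rintro rfl; exact hx (f a).2
    · rintro rfl; exact hx (f b).2

theorem finToNat_swap {N : ℕ} (i j : Fin N) : finToNat N (swap i j) = swap (i : ℕ) j :=
  extendDomain_swap Fin.equivSubtype i j

theorem perm_fin_induction {N : ℕ} {p : Perm (Fin N) → Prop} (one : p 1)
    (mul : ∀ i (hi : i + 1 < N) σ, p σ → p (swap ⟨i, by omega⟩ ⟨i + 1, hi⟩ * σ)) (σ) : p σ := by
  rcases N with _ | N
  · rwa [Subsingleton.elim σ 1]
  · have hσ : σ ∈ Submonoid.closure
        (Set.range fun i : Fin N ↦ swap i.castSucc i.succ) := by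
      rw [Perm.mclosure_swap_castSucc_succ]; trivial
    induction hσ using Submonoid.closure_induction_left with
    | one => exact one
    | mul_left x hx y hy ih =>
      obtain ⟨i, rfl⟩ := hx
      exact mul i (by omega) y ih

/-- The symmetric group is presented by the Coxeter relations. -/
theorem CoxeterRel.exists_hom (h : CoxeterRel N t) : ∃ ρ : Perm (Fin N) →* M,
    ∀ i (hi : i + 1 < N), ρ (swap ⟨i, by omega⟩ ⟨i + 1, hi⟩) = t i := by
  have mem : ∀ i, i + 1 < N → swapPair t i ∈ Submonoid.closure (swapPair t '' Set.Iio (N - 1)) :=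
    fun i hi => Submonoid.subset_closure ⟨i, by simp; omega, rfl⟩
  have ex : ∀ σ : Perm (Fin N), ∃ m,
      (finToNat N σ, m) ∈ Submonoid.closure (swapPair t '' Set.Iio (N - 1)) := fun σ => by
    induction σ using perm_fin_induction with
    | one => exact ⟨1, by rw [map_one]; exact Submonoid.one_mem _⟩
    | mul i hi σ ih =>
      obtain ⟨m, hm⟩ := ih
      refine ⟨t i * m, ?_⟩
      rw [map_mul, finToNat_swap]
      simpa only [swapPair, Prod.mk_mul_mk] using mul_mem (mem i hi) hm
  -- As the closure is a submonoid and the graph of a function, the chosen second components are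
  -- automatically multiplicative.
  choose ρ hρ using ex
  have uniq : ∀ σ m, (finToNat N σ, m) ∈ Submonoid.closure (swapPair t '' Set.Iio (N - 1)) →
      ρ σ = m := fun σ m hm => swapPair_closure_unique h (hρ σ) hm rfl
  have map_one' : ρ 1 = 1 := uniq 1 1 (by rw [map_one]; exact Submonoid.one_mem _)
  have map_mul' : ∀ σ τ, ρ (σ * τ) = ρ σ * ρ τ := fun σ τ => by
    refine uniq (σ * τ) (ρ σ * ρ τ) ?_
    rw [map_mul]
    simpa only [Prod.mk_mul_mk] using mul_mem (hρ σ) (hρ τ)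
  refine ⟨{ toFun := ρ, map_one' := map_one', map_mul' := map_mul' }, fun i hi => ?_⟩
  refine uniq _ (t i) ?_
  rw [finToNat_swap]
  exact mem i hi

end Coxeter

end PieriGrowth

namespace PieriGrowth

/-! ### Paths in the Young graph -/

section Paths

open Finset

/-- Add a box to row `x` of a shape given by its row lengths. -/
def addBox (l : ℕ → ℕ) (x : ℕ) : ℕ → ℕ := Function.update l x (l x + 1)

/-- Remove a box from row `x` of a shape given by its row lengths. -/
def remBox (l : ℕ → ℕ) (x : ℕ) : ℕ → ℕ := Function.update l x (l x - 1)

/-- A box may be added to row `x`. -/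
abbrev CanAdd (l : ℕ → ℕ) (x : ℕ) : Prop := x = 0 ∨ l x < l (x - 1)

/-- A box may be removed from row `x`. -/
abbrev CanRem (l : ℕ → ℕ) (x : ℕ) : Prop := l (x + 1) < l x

theorem addBox_apply (l : ℕ → ℕ) (x y : ℕ) :
    addBox l x y = if y = x then l x + 1 else l y := Function.update_apply ..

theorem remBox_apply (l : ℕ → ℕ) (x y : ℕ) :
    remBox l x y = if y = x then l x - 1 else l y := Function.update_apply ..

theorem antitone_iff_succ_le {l : ℕ → ℕ} : Antitone l ↔ ∀ j, l (j + 1) ≤ l j :=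
  ⟨fun h j => h (Nat.le_succ j), antitone_nat_of_succ_le⟩

theorem antitone_addBox {l : ℕ → ℕ} (hl : Antitone l) {x : ℕ} :
    Antitone (addBox l x) ↔ CanAdd l x := by
  rw [antitone_iff_succ_le] at hl ⊢
  constructor
  · intro h
    rcases x with _ | x
    · exact Or.inl rfl
    · have := h x
      rw [addBox_apply, addBox_apply] at this
      right
      simp at this ⊢
      omega
  · intro h j
    have := hl j
    rw [addBox_apply, addBox_apply]
    split_ifs with h1 h2 h2
    · omega
    · rcases h with h | h
      · omega
      · rw [← h1, Nat.add_sub_cancel] at h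
        rw [← h1]; omega
    · rw [← h2]; omega
    · exact this

theorem antitone_remBox {l : ℕ → ℕ} (hl : Antitone l) {x : ℕ} (hx : CanRem l x) :
    Antitone (remBox l x) := by
  rw [antitone_iff_succ_le] at hl ⊢
  intro j
  have := hl j
  rw [remBox_apply, remBox_apply]
  split_ifs with h1 h2 h2
  · omega
  · rw [← h1]; omega
  · rw [← h2] at hx ⊢; unfold CanRem at hx; omega
  · exact this

theorem remBox_addBox (l : ℕ → ℕ) (x : ℕ) : remBox (addBox l x) x = l := by
  ext y; simp only [remBox_apply, addBox_apply]; split_ifs <;> simp_all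

theorem addBox_remBox {l : ℕ → ℕ} {x : ℕ} (h : 0 < l x) : addBox (remBox l x) x = l := by
  ext y; simp only [remBox_apply, addBox_apply]; split_ifs
  · subst_vars; omega
  · rfl

theorem remBox_addBox_comm {l : ℕ → ℕ} {x y : ℕ} (h : x ≠ y) :
    remBox (addBox l x) y = addBox (remBox l y) x := by
  ext z
  simp only [remBox_apply, addBox_apply, h, h.symm, if_false]
  split_ifs <;> first | rfl | omega

theorem canRem_addBox_self {l : ℕ → ℕ} (hl : Antitone l) (x : ℕ) : CanRem (addBox l x) x := by
  have := hl (Nat.le_succ x)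
  simp only [CanRem, addBox_apply]
  simp
  omega

theorem canAdd_remBox_self {l : ℕ → ℕ} (hl : Antitone l) {x : ℕ} (hx : CanRem l x) :
    CanAdd (remBox l x) x := by
  rw [← antitone_addBox (antitone_remBox hl hx), addBox_remBox (by omega)]
  exact hl

/-- Adding and removing boxes in different rows commute. This is the off-diagonal part of the
relation DU - UD = 1 of the Young lattice. -/
theorem canAdd_canRem_comm {l : ℕ → ℕ} {x y : ℕ} (h : x ≠ y) :
    (CanAdd l x ∧ CanRem (addBox l x) y) ↔ (CanRem l y ∧ CanAdd (remBox l y) x) := by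
  simp only [CanAdd, CanRem, addBox_apply, remBox_apply]
  by_cases h1 : y + 1 = x
  · subst h1
    simp
    omega
  · by_cases h2 : x = 0
    · subst h2
      simp [h.symm]
    · have h3 : ¬ x - 1 = y := by omega
      simp [h.symm, h, h1, h3, h2]
      tauto

/-- The shape after `m` steps of the path whose `i`-th step adds a box to row `w i`. -/
def shapeAt (m : ℕ) (w : ℕ → ℕ) (j : ℕ) : ℕ := Nat.count (fun i => w i = j) m

theorem shapeAt_zero (w : ℕ → ℕ) : shapeAt 0 w = 0 := by ext; simp [shapeAt]

theorem shapeAt_succ (m : ℕ) (w : ℕ → ℕ) : shapeAt (m + 1) w = addBox (shapeAt m w) (w m) := by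
  ext j
  rw [addBox_apply, shapeAt, Nat.count_succ]
  by_cases h : w m = j
  · simp [h, shapeAt]
  · simp [h, shapeAt, Ne.symm h]

theorem shapeAt_congr {m : ℕ} {w v : ℕ → ℕ} (h : ∀ i < m, w i = v i) :
    shapeAt m w = shapeAt m v := by
  induction m with
  | zero => simp [shapeAt_zero]
  | succ m ih => rw [shapeAt_succ, shapeAt_succ, ih fun i hi => h i (by omega), h m (by omega)]

theorem shapeAt_mono {m m' : ℕ} (h : m ≤ m') (w : ℕ → ℕ) (j : ℕ) :
    shapeAt m w j ≤ shapeAt m' w j := Nat.count_monotone _ h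

open Classical in
/-- The set of paths of length `N` starting at the empty shape, extended by zero. -/
noncomputable def paths : ℕ → Finset (ℕ → ℕ)
  | 0 => {0}
  | N + 1 => (paths N).biUnion fun w =>
      ((range (N + 1)).filter (CanAdd (shapeAt N w))).image (Function.update w N)

/-- If row x admits a box then rows 0, …, x - 1 are nonempty, which takes x of the m boxes. Hence
the range of rows allowed in `paths` excludes nothing. -/
theorem le_of_canAdd_shapeAt {m x : ℕ} {w : ℕ → ℕ} (hw : Antitone (shapeAt m w))
    (hx : CanAdd (shapeAt m w) x) : x ≤ m := by
  by_contra! hlt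
  have h1 : ∀ j ∈ range x, 1 ≤ shapeAt m w j := fun j hj => by
    have := hw (show j ≤ x - 1 by simp at hj; omega)
    rcases hx with hx | hx <;> omega
  have h2 := Finset.card_nsmul_le_sum _ _ _ h1
  have h3 : ∑ j ∈ range x, shapeAt m w j ≤ m := by
    simp only [shapeAt, Nat.count_eq_card_filter_range]
    rw [← Finset.card_biUnion]
    · refine (Finset.card_le_card (Finset.biUnion_subset.2 fun j _ => filter_subset _ _)).trans ?_
      simp
    · intro i _ j _ hij
      rw [Function.onFun, Finset.disjoint_left]
      simp only [mem_filter]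
      omega
  rw [card_range, smul_eq_mul, mul_one] at h2
  exact absurd (h2.trans h3) (by omega)

theorem mem_paths {N : ℕ} {w : ℕ → ℕ} :
    w ∈ paths N ↔ (∀ m ≤ N, Antitone (shapeAt m w)) ∧ ∀ i, N ≤ i → w i = 0 := by
  induction N generalizing w with
  | zero =>
    simp only [paths, mem_singleton, Nat.le_zero, forall_eq, shapeAt_zero, zero_le, true_imp_iff]
    exact ⟨fun h => ⟨antitone_const, fun i => by simp [h]⟩, fun h => funext h.2⟩
  | succ N ih =>
    simp only [paths, mem_biUnion, mem_image, mem_filter, mem_range, ih]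
    constructor
    · rintro ⟨v, ⟨hv, hv0⟩, x, ⟨hx, hadd⟩, rfl⟩
      have e : ∀ m ≤ N, shapeAt m (Function.update v N x) = shapeAt m v := fun m hm =>
        shapeAt_congr fun i hi => Function.update_of_ne (by omega) _ _
      refine ⟨fun m hm => ?_, fun i hi => ?_⟩
      · rcases Nat.lt_or_ge N m with h | h
        · obtain rfl : m = N + 1 := by omega
          rw [shapeAt_succ, e N le_rfl, Function.update_self, antitone_addBox (hv N le_rfl)]
          exact hadd
        · rw [e m h]; exact hv m h
      · rw [Function.update_of_ne (by omega), hv0 i (by omega)]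
    · rintro ⟨hw, hw0⟩
      have e : ∀ m ≤ N, shapeAt m (Function.update w N 0) = shapeAt m w := fun m hm =>
        shapeAt_congr fun i hi => Function.update_of_ne (by omega) _ _
      have hadd : CanAdd (shapeAt N w) (w N) := by
        rw [← antitone_addBox (hw N (by omega)), ← shapeAt_succ]; exact hw _ le_rfl
      refine ⟨Function.update w N 0, ⟨fun m hm => ?_, fun i hi => ?_⟩, w N, ⟨?_, ?_⟩, ?_⟩
      · rw [e m hm]; exact hw m (by omega)
      · rw [Function.update_apply]; split_ifs with h
        · rfl
        · exact hw0 i (by omega)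
      · exact Nat.lt_succ_of_le (le_of_canAdd_shapeAt (hw N (by omega)) hadd)
      · rw [e N le_rfl]; exact hadd
      · simp

theorem antitone_shapeAt {N m : ℕ} {w : ℕ → ℕ} (hw : w ∈ paths N) (hm : m ≤ N) :
    Antitone (shapeAt m w) := (mem_paths.1 hw).1 m hm

theorem canAdd_shapeAt {N m : ℕ} {w : ℕ → ℕ} (hw : w ∈ paths N) (hm : m < N) :
    CanAdd (shapeAt m w) (w m) := by
  rw [← antitone_addBox (antitone_shapeAt hw hm.le), ← shapeAt_succ]
  exact antitone_shapeAt hw hm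

theorem path_apply_le {N m : ℕ} {w : ℕ → ℕ} (hw : w ∈ paths N) (hm : m < N) : w m ≤ m :=
  le_of_canAdd_shapeAt (antitone_shapeAt hw hm.le) (canAdd_shapeAt hw hm)

theorem shapeAt_eq_zero {N m : ℕ} {w : ℕ → ℕ} (hw : w ∈ paths N) (hm : m ≤ N) {j : ℕ}
    (hj : m ≤ j) : shapeAt m w j = 0 := by
  induction m generalizing j with
  | zero => simp [shapeAt]
  | succ m ih =>
    have := path_apply_le hw hm
    rw [shapeAt_succ, addBox_apply, if_neg (by omega), ih (by omega) (by omega)]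

open Classical in
theorem sum_paths_succ {E : Type*} [AddCommMonoid E] (N : ℕ) (G : (ℕ → ℕ) → E) :
    ∑ w ∈ paths (N + 1), G w = ∑ w ∈ paths N, ∑ x ∈ range (N + 1),
      if CanAdd (shapeAt N w) x then G (Function.update w N x) else 0 := by
  rw [paths, Finset.sum_biUnion]
  · refine Finset.sum_congr rfl fun w _ => ?_
    rw [Finset.sum_image (fun x _ y _ h => Function.update_injective _ _ h), Finset.sum_filter]
  · intro v hv w hw hne
    rw [Function.onFun, Finset.disjoint_left]
    intro u hu hu'
    simp only [mem_image] at hu hu'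
    obtain ⟨x, -, rfl⟩ := hu
    obtain ⟨y, -, h⟩ := hu'
    refine hne (funext fun i => ?_)
    by_cases hi : i = N
    · rw [hi, (mem_paths.1 hv).2 N le_rfl, (mem_paths.1 hw).2 N le_rfl]
    · simpa [hi] using (congrFun h i).symm

open Classical in
/-- The number of paths of length `N` from the empty shape to the shape `l`. -/
noncomputable def numPaths (N : ℕ) (l : ℕ → ℕ) : ℕ := ((paths N).filter fun w => shapeAt N w = l).card

-- Branching rule: delete the last step. The bound `M` is arbitrary beyond `m`, as a last step in a
-- row above `m` is impossible.
open Classical in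
theorem numPaths_succ {m M : ℕ} (hM : m < M) {l : ℕ → ℕ} (hl : Antitone l) :
    numPaths (m + 1) l = ∑ y ∈ range M, if CanRem l y then numPaths m (remBox l y) else 0 := by
  have h1 : ∀ N l, numPaths N l = ∑ w ∈ paths N, if shapeAt N w = l then 1 else 0 := fun N l => by
    rw [numPaths, Finset.card_filter]
  simp only [h1]
  rw [sum_paths_succ]
  have h2 : ∀ y, (if CanRem l y then ∑ w ∈ paths m, if shapeAt m w = remBox l y then 1 else 0 else 0)
      = ∑ w ∈ paths m, if CanRem l y ∧ shapeAt m w = remBox l y then 1 else 0 := fun y => by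
    by_cases h : CanRem l y
    · rw [if_pos h]
      exact Finset.sum_congr rfl fun w _ => if_congr (by simp only [h, true_and]) rfl rfl
    · rw [if_neg h]
      refine (Finset.sum_eq_zero fun w _ => if_neg fun h' => h h'.1).symm
  simp only [h2]
  rw [Finset.sum_comm (s := range M)]
  refine Finset.sum_congr rfl fun w hw => ?_
  have hws := antitone_shapeAt hw le_rfl
  have key : ∀ x, (CanAdd (shapeAt m w) x ∧ addBox (shapeAt m w) x = l) ↔
      (CanRem l x ∧ shapeAt m w = remBox l x) := fun x => by
    constructor
    · rintro ⟨h, rfl⟩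
      exact ⟨canRem_addBox_self hws x, (remBox_addBox _ _).symm⟩
    · rintro ⟨h, h'⟩
      rw [h', addBox_remBox (by omega)]
      exact ⟨canAdd_remBox_self hl h, rfl⟩
  have h3 : ∀ x, (if CanAdd (shapeAt m w) x then
      (if shapeAt (m + 1) (Function.update w m x) = l then 1 else 0) else 0) =
      if CanRem l x ∧ shapeAt m w = remBox l x then 1 else 0 := fun x => by
    rw [shapeAt_succ, Function.update_self, shapeAt_congr (m := m) (w := Function.update w m x) (v := w)
      fun i hi => Function.update_of_ne (by omega) _ _]
    simp only [← key]
    split_ifs <;> simp_all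
  simp only [h3]
  refine Finset.sum_subset (by simpa using hM) fun x _ hx => if_neg fun h => hx ?_
  have := le_of_canAdd_shapeAt hws ((key x).2 h).1
  simp; omega

/-- Row y + 1 admits a box exactly when row y can lose one. Pairing these corners leaves only the
addable corner in row 0. -/
theorem sum_canAdd_sub_sum_canRem (h : ℕ → ℕ → ℤ) (B : ℕ) (l : ℕ → ℕ) (hB : l B = 0) :
    (∑ x ∈ range (B + 1), if CanAdd l x then h (l x) x else 0)
      - (∑ y ∈ range (B + 1), if CanRem l y then h (l y - 1) y else 0) =
    h (l 0) 0 + ∑ y ∈ range B, if CanRem l y then h (l (y + 1)) (y + 1) - h (l y - 1) y else 0 := by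
  rw [Finset.sum_range_succ', Finset.sum_range_succ _ B, if_neg (show ¬ CanRem l B by omega),
    add_zero, if_pos (Or.inl rfl), add_sub_right_comm, add_comm, ← Finset.sum_sub_distrib]
  congr 1
  refine Finset.sum_congr rfl fun y _ => ?_
  by_cases hc : CanRem l y
  · rw [if_pos hc, if_pos (Or.inr (by simpa using hc)), if_pos hc]
  · rw [if_neg hc, if_neg (by simpa [CanAdd] using hc), if_neg hc, sub_zero]

/-- The sum over the shapes above `l` of a weight of the added box times the dimension. -/
noncomputable def upSum (h : ℕ → ℕ → ℤ) (B m : ℕ) (l : ℕ → ℕ) : ℤ :=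
  ∑ x ∈ range (B + 1), if CanAdd l x then h (l x) x * numPaths m (addBox l x) else 0

/-- A weighted form of DU - UD = 1. Branching turns the left side into a sum over "add x, then
remove y"; for x ≠ y the moves are interchanged, and the diagonal terms of the two orders differ by
the alternating corner sum of `sum_canAdd_sub_sum_canRem`. -/
theorem upSum_add_two (h : ℕ → ℕ → ℤ) (m B : ℕ) (hm : m + 1 ≤ B) {l : ℕ → ℕ} (hl : Antitone l)
    (hB : l B = 0) :
    upSum h B (m + 2) l = numPaths (m + 1) l * (h (l 0) 0 +
      ∑ y ∈ range B, if CanRem l y then h (l (y + 1)) (y + 1) - h (l y - 1) y else 0) +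
    ∑ y ∈ range (B + 1), if CanRem l y then upSum h B (m + 1) (remBox l y) else 0 := by
  rw [← sum_canAdd_sub_sum_canRem h B l hB]
  unfold upSum
  -- `h1` (up, then down) and `h2` (down, then up) isolate the terms x = y, which return to `l`; the
  -- remaining double sums are identical.
  have h1 : ∀ x ∈ range (B + 1),
      (if CanAdd l x then h (l x) x * numPaths (m + 2) (addBox l x) else 0) =
      (if CanAdd l x then h (l x) x else 0) * numPaths (m + 1) l + ∑ y ∈ range (B + 1),
        if x ≠ y ∧ CanAdd l x ∧ CanRem (addBox l x) y then
          h (l x) x * (numPaths (m + 1) (remBox (addBox l x) y) : ℤ) else 0 := fun x hx => by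
    by_cases hc : CanAdd l x
    · rw [if_pos hc, if_pos hc, numPaths_succ (M := B + 1) (by omega) ((antitone_addBox hl).2 hc),
        ← Finset.add_sum_erase _ _ hx, if_pos (canRem_addBox_self hl x), remBox_addBox]
      push_cast
      rw [mul_add, ← Finset.add_sum_erase _ _ hx, if_neg (by simp), zero_add, Finset.mul_sum]
      congr 1
      refine Finset.sum_congr rfl fun y hy => ?_
      have : x ≠ y := (Finset.ne_of_mem_erase hy).symm
      simp only [this, hc, ne_eq, not_false_eq_true, true_and, mul_ite, mul_zero]
    · rw [if_neg hc, if_neg hc, zero_mul, zero_add]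
      exact (Finset.sum_eq_zero fun y _ => if_neg fun h' => hc h'.2.1).symm
  have h2 : ∀ y ∈ range (B + 1), (if CanRem l y then
      ∑ x ∈ range (B + 1), (if CanAdd (remBox l y) x then
      h (remBox l y x) x * (numPaths (m + 1) (addBox (remBox l y) x) : ℤ) else 0) else 0) =
      (if CanRem l y then h (l y - 1) y else 0) * numPaths (m + 1) l + ∑ x ∈ range (B + 1),
        if x ≠ y ∧ CanAdd l x ∧ CanRem (addBox l x) y then
          h (l x) x * (numPaths (m + 1) (remBox (addBox l x) y) : ℤ) else 0 := fun y hy => by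
    by_cases hc : CanRem l y
    · rw [if_pos hc, if_pos hc, ← Finset.add_sum_erase _ _ hy,
        ← Finset.add_sum_erase (range (B + 1)) (fun x => if x ≠ y ∧ _ then _ else (0 : ℤ)) hy,
        if_pos (canAdd_remBox_self hl hc), addBox_remBox (by omega)]
      simp only [ne_eq, not_true_eq_false, false_and, if_false, zero_add]
      congr 1
      · simp [remBox_apply]
      refine Finset.sum_congr rfl fun x hx => ?_
      have hxy : x ≠ y := Finset.ne_of_mem_erase hx
      simp only [hxy, not_false_eq_true, true_and, canAdd_canRem_comm hxy, hc,
        remBox_addBox_comm hxy]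
      simp only [remBox_apply l y x, hxy, if_false]
    · rw [if_neg hc, if_neg hc, zero_mul, zero_add]
      refine (Finset.sum_eq_zero fun x _ => if_neg fun h' => hc ?_).symm
      exact ((canAdd_canRem_comm h'.1).1 h'.2).1
  rw [Finset.sum_congr rfl h1, Finset.sum_congr rfl h2, Finset.sum_add_distrib,
    Finset.sum_add_distrib, Finset.sum_comm (s := range (B + 1)) (t := range (B + 1)),
    ← Finset.sum_mul, ← Finset.sum_mul]
  ring

open Classical in
theorem upSum_one (h : ℕ → ℕ → ℤ) (B : ℕ) (l : ℕ → ℕ) :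
    upSum h B 1 l = h 0 0 * numPaths 0 l := by
  unfold upSum
  have p1 : ∀ l, numPaths 1 l = if addBox 0 0 = l then 1 else 0 := fun l => by
    have e : paths 1 = {0} := by
      ext w
      rw [mem_paths]
      simp only [mem_singleton]
      constructor
      · rintro ⟨h, h'⟩
        funext i
        rcases i with _ | i
        · have hw : w ∈ paths 1 := mem_paths.2 ⟨h, h'⟩
          simpa using path_apply_le hw zero_lt_one
        · exact h' _ (by omega)
      · rintro rfl
        refine ⟨fun m hm => ?_, fun _ _ => rfl⟩
        rw [antitone_iff_succ_le]
        intro j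
        simp [shapeAt]
    rw [numPaths, Finset.card_filter, e, Finset.sum_singleton, shapeAt_succ, shapeAt_zero]
    rfl
  have p0 : ∀ l, numPaths 0 l = if 0 = l then 1 else 0 := fun l => by
    rw [numPaths, Finset.card_filter, paths, Finset.sum_singleton, shapeAt_zero]
  have key : ∀ x, addBox 0 0 = addBox l x ↔ x = 0 ∧ 0 = l := fun x => by
    constructor
    · intro hx
      have := congrFun hx x
      simp only [addBox_apply] at this
      have hx0 : x = 0 := by
        by_contra h0
        simp [h0] at this
      subst hx0
      refine ⟨rfl, ?_⟩
      rw [← remBox_addBox 0 0, hx, remBox_addBox]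
    · rintro ⟨rfl, rfl⟩; rfl
  simp only [p1, p0, key]
  rw [Finset.sum_range_succ', Finset.sum_eq_zero fun x _ => by simp, if_pos (Or.inl rfl)]
  by_cases hl : 0 = l
  · simp [← hl]
  · simp [hl]

/-- The dimension of a shape is the average of the dimensions of the shapes above it. -/
theorem sum_numPaths_addBox (m B : ℕ) (hm : m ≤ B) {l : ℕ → ℕ} (hl : Antitone l) (hB : l B = 0) :
    (∑ x ∈ range (B + 1), if CanAdd l x then numPaths (m + 1) (addBox l x) else 0) =
      (m + 1) * numPaths m l := by
  suffices h : upSum (fun _ _ => 1) B (m + 1) l = (m + 1) * numPaths m l by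
    simp only [upSum, one_mul] at h
    exact_mod_cast h
  induction m generalizing l with
  | zero => rw [zero_add, upSum_one]; simp
  | succ m ih =>
    rw [upSum_add_two _ m B hm hl hB,
      numPaths_succ (M := B + 1) (by omega) hl]
    -- For constant weight the corner sum is 1: there is one more addable corner than removable
    -- ones.
    simp only [sub_self, ite_self, Finset.sum_const_zero, add_zero, mul_one]
    have : ∀ y ∈ range (B + 1), (if CanRem l y then
        upSum (fun _ _ => 1) B (m + 1) (remBox l y) else 0) =
        (m + 1) * (if CanRem l y then numPaths m (remBox l y) else 0 : ℕ) := fun y _ => by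
      by_cases hc : CanRem l y
      · rw [if_pos hc, if_pos hc]
        exact ih (by omega) (antitone_remBox hl hc) (by rw [remBox_apply]; split_ifs <;> grind)
      · simp [hc]
    rw [Finset.sum_congr rfl this, ← Finset.mul_sum]
    push_cast
    ring

/-- The transition measure of a shape is centred. -/
theorem sum_content_mul_numPaths_addBox (m B : ℕ) (hm : m ≤ B) {l : ℕ → ℕ} (hl : Antitone l)
    (hB : l B = 0) :
    (∑ x ∈ range (B + 1), if CanAdd l x then
      ((l x : ℤ) - x) * numPaths (m + 1) (addBox l x) else 0) = 0 := by
  change upSum (fun a x => (a : ℤ) - x) B (m + 1) l = 0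
  induction m generalizing l with
  | zero => rw [zero_add, upSum_one]; simp
  | succ m ih =>
    rw [upSum_add_two _ m B hm hl hB]
    -- The difference of the contents of paired corners is l (y + 1) - l y, also when there is no
    -- corner, since both are then zero. The sum telescopes to -l 0 and cancels the content l 0 of
    -- the corner in row 0.
    have h1 : ∀ y ∈ range B, (if CanRem l y then
        ((l (y + 1) : ℤ) - (y + 1 : ℕ)) - (((l y - 1 : ℕ) : ℤ) - y) else 0)
        = (l (y + 1) : ℤ) - l y := fun y _ => by
      have := hl (Nat.le_succ y)
      split_ifs with hc <;> simp only [CanRem, Nat.succ_eq_add_one] at * <;> omega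
    rw [Finset.sum_congr rfl h1, Finset.sum_range_sub (fun y => (l y : ℤ)), hB]
    refine (add_eq_right.2 (by simp)).trans (Finset.sum_eq_zero fun y _ => ?_)
    by_cases hc : CanRem l y
    · rw [if_pos hc]
      exact ih (by omega) (antitone_remBox hl hc) (by rw [remBox_apply]; split_ifs <;> grind)
    · rw [if_neg hc]

end Paths

end PieriGrowth

namespace PieriGrowth

/-! ### Young's seminormal form on functions of paths -/

section Seminormal

open Equiv

/-- The content of the box added at step `i` of a path. -/
def content (i : ℕ) (w : ℕ → ℕ) : ℤ := (shapeAt i w (w i) : ℤ) - w i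

/-- Interchange the steps `i` and `i + 1` of a path. -/
def swapStep (i : ℕ) (w : ℕ → ℕ) : ℕ → ℕ := w ∘ swap i (i + 1)

theorem swapStep_self (i : ℕ) (w : ℕ → ℕ) : swapStep i w i = w (i + 1) := by simp [swapStep]

theorem swapStep_succ (i : ℕ) (w : ℕ → ℕ) : swapStep i w (i + 1) = w i := by simp [swapStep]

theorem swapStep_of_ne {i j : ℕ} (h : j ≠ i) (h' : j ≠ i + 1) (w : ℕ → ℕ) :
    swapStep i w j = w j := by
  rw [swapStep, Function.comp_apply, swap_apply_of_ne_of_ne h h']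

theorem swapStep_swapStep (i : ℕ) (w : ℕ → ℕ) : swapStep i (swapStep i w) = w := by
  ext; simp [swapStep]

theorem swapStep_comm {i j : ℕ} (h : i + 1 < j) (w : ℕ → ℕ) :
    swapStep i (swapStep j w) = swapStep j (swapStep i w) := by
  have := (coxeterRel_swap (j + 2)).comm i j h (by omega)
  simp only [swapStep, Function.comp_assoc, ← Perm.coe_mul]
  rw [this]

theorem swapStep_braid (i : ℕ) (w : ℕ → ℕ) :
    swapStep i (swapStep (i + 1) (swapStep i w)) =
      swapStep (i + 1) (swapStep i (swapStep (i + 1) w)) := by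
  have := (coxeterRel_swap (i + 3)).braid i (by omega)
  simp only [swapStep, Function.comp_assoc, ← Perm.coe_mul, mul_assoc]
  rw [this]

theorem addBox_comm (l : ℕ → ℕ) (x y : ℕ) : addBox (addBox l x) y = addBox (addBox l y) x := by
  ext z
  simp only [addBox_apply]
  by_cases h : x = y
  · subst h; rfl
  · split_ifs <;> simp_all

theorem shapeAt_swapStep_of_le {i m : ℕ} (h : m ≤ i) (w : ℕ → ℕ) :
    shapeAt m (swapStep i w) = shapeAt m w :=
  shapeAt_congr fun j hj => swapStep_of_ne (by omega) (by omega) w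

theorem shapeAt_swapStep_of_gt {i m : ℕ} (h : i + 1 < m) (w : ℕ → ℕ) :
    shapeAt m (swapStep i w) = shapeAt m w := by
  induction m with
  | zero => omega
  | succ m ih =>
    by_cases hm : m = i + 1
    · subst hm
      rw [shapeAt_succ, shapeAt_succ, shapeAt_succ (i + 1), shapeAt_succ, swapStep_self,
        swapStep_succ, shapeAt_swapStep_of_le le_rfl, addBox_comm]
    · rw [shapeAt_succ, shapeAt_succ, ih (by omega), swapStep_of_ne (by omega) (by omega)]

theorem shapeAt_swapStep_succ (i : ℕ) (w : ℕ → ℕ) :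
    shapeAt (i + 1) (swapStep i w) = addBox (shapeAt i w) (w (i + 1)) := by
  rw [shapeAt_succ, swapStep_self, shapeAt_swapStep_of_le le_rfl]

theorem content_swapStep_of_ne {i j : ℕ} (h : j ≠ i) (h' : j ≠ i + 1) (w : ℕ → ℕ) :
    content j (swapStep i w) = content j w := by
  rw [content, content, swapStep_of_ne h h']
  rcases Nat.lt_or_ge j i with hj | hj
  · rw [shapeAt_swapStep_of_le hj.le]
  · rw [shapeAt_swapStep_of_gt (by omega)]

theorem content_swapStep_self {i : ℕ} {w : ℕ → ℕ} (h : w i ≠ w (i + 1)) :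
    content i (swapStep i w) = content (i + 1) w := by
  rw [content, content, swapStep_self, shapeAt_swapStep_of_le le_rfl, shapeAt_succ, addBox_apply,
    if_neg h.symm]

theorem content_swapStep_succ {i : ℕ} {w : ℕ → ℕ} (h : w i ≠ w (i + 1)) :
    content (i + 1) (swapStep i w) = content i w := by
  rw [content, content, swapStep_succ, shapeAt_swapStep_succ, addBox_apply, if_neg h]

theorem content_succ_of_eq {i : ℕ} {w : ℕ → ℕ} (h : w i = w (i + 1)) :
    content (i + 1) w = content i w + 1 := by
  rw [content, content, shapeAt_succ, addBox_apply, ← h, if_pos rfl]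
  push_cast
  ring

/-- Consecutive boxes never lie on one diagonal, so the denominators of the seminormal form are
nonzero. -/
theorem content_ne_succ {N i : ℕ} {w : ℕ → ℕ} (hw : w ∈ paths N) (hi : i + 1 < N) :
    content i w ≠ content (i + 1) w := by
  by_cases h : w i = w (i + 1)
  · rw [content_succ_of_eq h]; omega
  · have h0 := antitone_shapeAt hw (m := i) (by omega)
    rw [content, content, shapeAt_succ, addBox_apply, if_neg (Ne.symm h)]
    rcases Nat.lt_or_ge (w i) (w (i + 1)) with hlt | hge
    · have := h0 hlt.le
      omega
    · have := h0 hge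
      omega

/-- Between two boxes on the same diagonal at least two other boxes must be added, and here there is
only one step in between. This provides the third denominator of the braid relation. -/
theorem content_ne_add_two {N i : ℕ} {w : ℕ → ℕ} (hw : w ∈ paths N) (hi : i + 2 < N) :
    content i w ≠ content (i + 2) w := by
  have h0 := antitone_shapeAt hw (m := i) (by omega)
  have h1 := antitone_shapeAt hw (m := i + 2) (by omega)
  have h2 := antitone_shapeAt hw (m := i + 3) (by omega)
  rw [content, content]
  rw [shapeAt_succ (i + 2)] at h2
  have e : ∀ j, shapeAt (i + 2) w j = shapeAt i w j + (if j = w i then 1 else 0) +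
      (if j = w (i + 1) then 1 else 0) := fun j => by
    rw [shapeAt_succ, shapeAt_succ]
    simp only [addBox_apply]
    split_ifs <;> simp_all
  rcases lt_trichotomy (w i) (w (i + 2)) with h | h | h
  · have a := h0 h.le
    have b := h1 h.le
    have c := h2 h.le
    simp only [addBox_apply, if_neg h.ne, if_true] at c
    have e1 := e (w i)
    have e2 := e (w (i + 2))
    simp only [h.ne', if_true, if_false] at e1 e2
    split_ifs at e1 e2 <;> omega
  · have e1 := e (w (i + 2))
    simp only [h, if_true] at e1 ⊢
    split_ifs at e1 <;> omega
  · have a := h0 h.le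
    have e2 := e (w (i + 2))
    have : shapeAt i w (w (i + 2)) ≤ shapeAt (i + 2) w (w (i + 2)) := shapeAt_mono (by omega) _ _
    omega

/-- The diagonal coefficient of the seminormal form. -/
noncomputable def diagCoeff (a b : ℤ) : ℂ := 1 / ((b : ℂ) - a)

/-- The off-diagonal coefficient of the seminormal form. -/
noncomputable def offCoeff (a b : ℤ) : ℂ := if b = a + 1 ∨ a = b + 1 then 0 else 1 - diagCoeff a b

theorem diagCoeff_swap (a b : ℤ) : diagCoeff b a = - diagCoeff a b := by
  rw [diagCoeff, diagCoeff, ← neg_sub, div_neg]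

/-- The partial fraction identity behind the braid relation. -/
theorem diagCoeff_mul {a b c : ℤ} (hab : a ≠ b) (hbc : b ≠ c) (hac : a ≠ c) :
    diagCoeff a b * diagCoeff b c = diagCoeff a c * (diagCoeff a b + diagCoeff b c) := by
  have h1 : (b : ℂ) - a ≠ 0 := sub_ne_zero.2 (by exact_mod_cast hab.symm)
  have h2 : (c : ℂ) - b ≠ 0 := sub_ne_zero.2 (by exact_mod_cast hbc.symm)
  have h3 : (c : ℂ) - a ≠ 0 := sub_ne_zero.2 (by exact_mod_cast hac.symm)
  simp only [diagCoeff]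
  field_simp
  ring

/-- This makes the 2 × 2 blocks involutive: (1 - r)(1 + r) = 1 - r². For contents differing by one,
r = ±1 and both sides vanish. -/
theorem offCoeff_mul (a b : ℤ) : offCoeff a b * offCoeff b a = 1 - diagCoeff a b ^ 2 := by
  by_cases h : b = a + 1 ∨ a = b + 1
  · rw [offCoeff, if_pos h]
    rcases h with rfl | rfl <;> simp [diagCoeff]
  · rw [offCoeff, offCoeff, if_neg h, if_neg (by tauto), diagCoeff_swap a b]
    ring

/-- Only the shape after i + 1 steps changes, and it fails to be a diagram only if the second box is
the right or lower neighbour of the first; then the contents differ by one and the coefficient is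
zero. -/
theorem swapStep_mem_paths {N i : ℕ} {w : ℕ → ℕ} (hw : w ∈ paths N) (hi : i + 1 < N)
    (hq : offCoeff (content i w) (content (i + 1) w) ≠ 0) : swapStep i w ∈ paths N := by
  have hne : w i ≠ w (i + 1) := fun h => hq (by simp [offCoeff, content_succ_of_eq h])
  have hq' : ¬ (content (i + 1) w = content i w + 1 ∨ content i w = content (i + 1) w + 1) :=
    fun h => hq (by simp [offCoeff, h])
  refine mem_paths.2 ⟨fun m hm => ?_, fun j hj => ?_⟩
  · by_cases hc : m = i + 1
    · subst hc
      have h0 := antitone_shapeAt hw (m := i) (by omega)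
      rw [shapeAt_swapStep_succ, antitone_addBox h0]
      have h1 := canAdd_shapeAt hw (m := i + 1) (by omega)
      rcases h1 with h1 | h1
      · exact Or.inl h1
      · rw [shapeAt_succ, addBox_apply, addBox_apply, if_neg hne.symm] at h1
        right
        split_ifs at h1 with h2
        · rw [content, content, shapeAt_succ, addBox_apply, if_neg hne.symm] at hq'
          rw [h2]
          omega
        · exact h1
    · rcases Nat.lt_or_ge i m with h | h
      · rw [shapeAt_swapStep_of_gt (by omega)]; exact antitone_shapeAt hw hm
      · rw [shapeAt_swapStep_of_le h]; exact antitone_shapeAt hw hm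
  · rw [swapStep_of_ne (by omega) (by omega)]; exact (mem_paths.1 hw).2 j hj

/-- The action of the transposition `(i, i + 1)` on functions of paths. -/
noncomputable def seminormalOp (i : ℕ) (φ : (ℕ → ℕ) → ℂ) (w : ℕ → ℕ) : ℂ :=
  diagCoeff (content i w) (content (i + 1) w) * φ w +
    offCoeff (content i w) (content (i + 1) w) * φ (swapStep i w)

theorem ne_of_offCoeff_ne_zero {i : ℕ} {w : ℕ → ℕ}
    (hq : offCoeff (content i w) (content (i + 1) w) ≠ 0) : w i ≠ w (i + 1) :=
  fun h => hq (by simp [offCoeff, content_succ_of_eq h])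

/-- The factor stays on both sides because the interchange exchanges the two contents only when the
rows differ, which a nonzero coefficient ensures. -/
theorem offCoeff_mul_seminormalOp_swapStep (i : ℕ) (φ : (ℕ → ℕ) → ℂ) (w : ℕ → ℕ) :
    offCoeff (content i w) (content (i + 1) w) * seminormalOp i φ (swapStep i w) =
    offCoeff (content i w) (content (i + 1) w) *
      (diagCoeff (content (i + 1) w) (content i w) * φ (swapStep i w) +
        offCoeff (content (i + 1) w) (content i w) * φ w) := by
  by_cases hq : offCoeff (content i w) (content (i + 1) w) = 0
  · rw [hq, zero_mul, zero_mul]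
  · have h := ne_of_offCoeff_ne_zero hq
    rw [seminormalOp, content_swapStep_self h, content_swapStep_succ h, swapStep_swapStep]

theorem seminormalOp_sq (i : ℕ) (φ : (ℕ → ℕ) → ℂ) (w : ℕ → ℕ) :
    seminormalOp i (seminormalOp i φ) w = φ w := by
  rw [seminormalOp, offCoeff_mul_seminormalOp_swapStep, seminormalOp,
    diagCoeff_swap (content i w) (content (i + 1) w)]
  linear_combination (offCoeff_mul (content i w) (content (i + 1) w)) * φ w

/-- The recursion X_{i+1} = s_i X_i s_i + s_i, read on contents. -/
theorem content_mul_eq {i : ℕ} (φ : (ℕ → ℕ) → ℂ) {w : ℕ → ℕ}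
    (hw : content i w ≠ content (i + 1) w) :
    content (i + 1) w * φ w =
      seminormalOp i (fun v => content i v * seminormalOp i φ v) w + seminormalOp i φ w := by
  have h1 : diagCoeff (content i w) (content (i + 1) w) *
      ((content (i + 1) w : ℂ) - content i w) = 1 := by
    have : ((content (i + 1) w : ℂ) - content i w) ≠ 0 :=
      sub_ne_zero.2 (by exact_mod_cast hw.symm)
    rw [diagCoeff]
    field_simp
  have h2 : offCoeff (content i w) (content (i + 1) w) *
      (content i (swapStep i w) * seminormalOp i φ (swapStep i w)) =
      content (i + 1) w * (offCoeff (content i w) (content (i + 1) w) *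
        seminormalOp i φ (swapStep i w)) := by
    by_cases hq : offCoeff (content i w) (content (i + 1) w) = 0
    · rw [hq, zero_mul, zero_mul, mul_zero]
    · rw [content_swapStep_self (ne_of_offCoeff_ne_zero hq)]; ring
  rw [seminormalOp, h2, offCoeff_mul_seminormalOp_swapStep, seminormalOp,
    diagCoeff_swap (content i w) (content (i + 1) w)]
  have h3 := offCoeff_mul (content i w) (content (i + 1) w)
  set r := diagCoeff (content i w) (content (i + 1) w)
  set q := offCoeff (content i w) (content (i + 1) w)
  set q' := offCoeff (content (i + 1) w) (content i w)
  linear_combination (-content (i + 1) w * φ w) * h3 + (r * φ w + q * φ (swapStep i w)) * h1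

theorem seminormalOp_comm {i j : ℕ} (h : i + 1 < j) (φ : (ℕ → ℕ) → ℂ) (w : ℕ → ℕ) :
    seminormalOp i (seminormalOp j φ) w = seminormalOp j (seminormalOp i φ) w := by
  simp only [seminormalOp]
  rw [content_swapStep_of_ne (show j ≠ i by omega) (by omega),
    content_swapStep_of_ne (show j + 1 ≠ i by omega) (by omega),
    content_swapStep_of_ne (show i ≠ j by omega) (by omega),
    content_swapStep_of_ne (show i + 1 ≠ j by omega) (by omega), swapStep_comm h]
  ring

/-- Both sides expand over the rearrangements of three consecutive steps. The coefficients agree by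
`diagCoeff_mul` for the three contents and by `offCoeff_mul` for the two pairs of consecutive ones.
-/
theorem seminormalOp_braid {i : ℕ} (φ : (ℕ → ℕ) → ℂ) {w : ℕ → ℕ}
    (h1 : content i w ≠ content (i + 1) w) (h2 : content (i + 1) w ≠ content (i + 2) w)
    (h3 : content i w ≠ content (i + 2) w) :
    seminormalOp i (seminormalOp (i + 1) (seminormalOp i φ)) w =
      seminormalOp (i + 1) (seminormalOp i (seminormalOp (i + 1) φ)) w := by
  have f0 : ∀ v, content (i + 2) (swapStep i v) = content (i + 2) v := fun v =>
    content_swapStep_of_ne (by omega) (by omega) v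
  have f1 : ∀ v, content i (swapStep (i + 1) v) = content i v := fun v =>
    content_swapStep_of_ne (by omega) (by omega) v
  have g : ∀ {v}, offCoeff (content (i + 1) v) (content (i + 2) v) ≠ 0 →
      content (i + 1) (swapStep (i + 1) v) = content (i + 2) v ∧
      content (i + 2) (swapStep (i + 1) v) = content (i + 1) v := fun {v} hq =>
    ⟨content_swapStep_self (ne_of_offCoeff_ne_zero hq),
      content_swapStep_succ (ne_of_offCoeff_ne_zero hq)⟩
  have g' : ∀ {v}, offCoeff (content i v) (content (i + 1) v) ≠ 0 →
      content i (swapStep i v) = content (i + 1) v ∧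
      content (i + 1) (swapStep i v) = content i v := fun {v} hq =>
    ⟨content_swapStep_self (ne_of_offCoeff_ne_zero hq),
      content_swapStep_succ (ne_of_offCoeff_ne_zero hq)⟩
  have expand : ∀ ψ v, seminormalOp (i + 1) ψ v =
      diagCoeff (content (i + 1) v) (content (i + 2) v) * ψ v +
      offCoeff (content (i + 1) v) (content (i + 2) v) * ψ (swapStep (i + 1) v) := fun _ _ => rfl
  have expand' : ∀ ψ v, seminormalOp i ψ v =
      diagCoeff (content i v) (content (i + 1) v) * ψ v +
      offCoeff (content i v) (content (i + 1) v) * ψ (swapStep i v) := fun _ _ => rfl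
  -- Each of `E1`–`E4` carries an off-diagonal factor: if it is zero there is nothing to prove,
  -- otherwise the interchange does exchange the two contents.
  have E2 : ∀ v ψ, offCoeff (content (i + 1) v) (content (i + 2) v) *
      seminormalOp i ψ (swapStep (i + 1) v) =
      offCoeff (content (i + 1) v) (content (i + 2) v) *
      (diagCoeff (content i v) (content (i + 2) v) * ψ (swapStep (i + 1) v) +
      offCoeff (content i v) (content (i + 2) v) * ψ (swapStep i (swapStep (i + 1) v))) :=
    fun v ψ => by
      by_cases hq : offCoeff (content (i + 1) v) (content (i + 2) v) = 0
      · rw [hq, zero_mul, zero_mul]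
      · rw [expand', f1, (g hq).1]
  have E3 : ∀ v ψ, offCoeff (content i v) (content (i + 1) v) *
      seminormalOp (i + 1) ψ (swapStep i v) =
      offCoeff (content i v) (content (i + 1) v) *
      (diagCoeff (content i v) (content (i + 2) v) * ψ (swapStep i v) +
      offCoeff (content i v) (content (i + 2) v) * ψ (swapStep (i + 1) (swapStep i v))) :=
    fun v ψ => by
      by_cases hq : offCoeff (content i v) (content (i + 1) v) = 0
      · rw [hq, zero_mul, zero_mul]
      · rw [expand, f0, (g' hq).2]
  have E1 : offCoeff (content i w) (content (i + 1) w) *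
      seminormalOp (i + 1) (seminormalOp i φ) (swapStep i w) =
      offCoeff (content i w) (content (i + 1) w) *
      (diagCoeff (content i w) (content (i + 2) w) *
        (diagCoeff (content (i + 1) w) (content i w) * φ (swapStep i w) +
        offCoeff (content (i + 1) w) (content i w) * φ w) +
      offCoeff (content i w) (content (i + 2) w) *
        (diagCoeff (content (i + 1) w) (content (i + 2) w) * φ (swapStep (i + 1) (swapStep i w)) +
        offCoeff (content (i + 1) w) (content (i + 2) w) *
          φ (swapStep i (swapStep (i + 1) (swapStep i w))))) := by
    by_cases hq : offCoeff (content i w) (content (i + 1) w) = 0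
    · rw [hq, zero_mul, zero_mul]
    · have hE := E2 (swapStep i w) φ
      rw [f0, (g' hq).1, (g' hq).2] at hE
      rw [expand, f0, (g' hq).2, hE, expand', (g' hq).1, (g' hq).2, swapStep_swapStep]
  have E4 : offCoeff (content (i + 1) w) (content (i + 2) w) *
      seminormalOp i (seminormalOp (i + 1) φ) (swapStep (i + 1) w) =
      offCoeff (content (i + 1) w) (content (i + 2) w) *
      (diagCoeff (content i w) (content (i + 2) w) *
        (diagCoeff (content (i + 2) w) (content (i + 1) w) * φ (swapStep (i + 1) w) +
        offCoeff (content (i + 2) w) (content (i + 1) w) * φ w) +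
      offCoeff (content i w) (content (i + 2) w) *
        (diagCoeff (content i w) (content (i + 1) w) * φ (swapStep i (swapStep (i + 1) w)) +
        offCoeff (content i w) (content (i + 1) w) *
          φ (swapStep i (swapStep (i + 1) (swapStep i w))))) := by
    by_cases hq : offCoeff (content (i + 1) w) (content (i + 2) w) = 0
    · rw [hq, zero_mul, zero_mul]
    · have hE := E3 (swapStep (i + 1) w) φ
      rw [f1, (g hq).1, (g hq).2] at hE
      rw [expand', f1, (g hq).1, hE, expand, (g hq).1, (g hq).2, swapStep_swapStep,
        swapStep_braid]
  rw [expand' _ w, expand _ w, E1, E2, expand _ w, expand' (seminormalOp (i + 1) φ) w, E3, E4,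
    expand' _ w, expand _ w]
  have r := diagCoeff_mul h1 h2 h3
  have q1 := offCoeff_mul (content i w) (content (i + 1) w)
  have q2 := offCoeff_mul (content (i + 1) w) (content (i + 2) w)
  rw [diagCoeff_swap (content i w) (content (i + 1) w),
    diagCoeff_swap (content (i + 1) w) (content (i + 2) w)]
  set rab := diagCoeff (content i w) (content (i + 1) w)
  set rbc := diagCoeff (content (i + 1) w) (content (i + 2) w)
  set rac := diagCoeff (content i w) (content (i + 2) w)
  set qab := offCoeff (content i w) (content (i + 1) w)
  set qbc := offCoeff (content (i + 1) w) (content (i + 2) w)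
  linear_combination (φ w * rac) * q1 - (φ w * rac) * q2 +
    (φ w * (rab - rbc) + qab * φ (swapStep i w) - qbc * φ (swapStep (i + 1) w)) * r

/-- An interchange that leaves the set of paths has coefficient zero, so extending functions by zero
is harmless. -/
theorem seminormalOp_congr {N i : ℕ} (hi : i + 1 < N) {φ ψ : (ℕ → ℕ) → ℂ}
    (h : ∀ w ∈ paths N, φ w = ψ w) {w : ℕ → ℕ} (hw : w ∈ paths N) :
    seminormalOp i φ w = seminormalOp i ψ w := by
  rw [seminormalOp, seminormalOp, h w hw]
  by_cases hq : offCoeff (content i w) (content (i + 1) w) = 0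
  · rw [hq, zero_mul, zero_mul]
  · rw [h _ (swapStep_mem_paths hw hi hq)]

/-- The space of functions on the paths of length `N`. -/
abbrev PathSpace (N : ℕ) : Type := paths N → ℂ

open Classical in
/-- Extension by zero of a function on the paths of length `N`. -/
noncomputable def extendPath {N : ℕ} (φ : PathSpace N) (w : ℕ → ℕ) : ℂ :=
  if h : w ∈ paths N then φ ⟨w, h⟩ else 0

theorem extendPath_coe {N : ℕ} (φ : PathSpace N) (w : paths N) : extendPath φ w = φ w := by
  rw [extendPath, dif_pos w.2]

/-- The action of the transposition `(i, i + 1)` on functions on the paths of length `N`. -/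
noncomputable def seminormalGen (N i : ℕ) : Module.End ℂ (PathSpace N) where
  toFun φ w := seminormalOp i (extendPath φ) w
  map_add' φ ψ := by
    ext w
    simp only [seminormalOp, extendPath, Pi.add_apply]
    split_ifs <;> ring
  map_smul' c φ := by
    ext w
    simp only [seminormalOp, extendPath, Pi.smul_apply, smul_eq_mul, RingHom.id_apply]
    split_ifs <;> ring

theorem seminormalGen_apply {N i : ℕ} (φ : PathSpace N) (w : paths N) :
    seminormalGen N i φ w = seminormalOp i (extendPath φ) w := rfl

theorem extendPath_seminormalGen {N i : ℕ} (φ : PathSpace N) {w : ℕ → ℕ} (hw : w ∈ paths N) :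
    extendPath (seminormalGen N i φ) w = seminormalOp i (extendPath φ) w :=
  extendPath_coe _ ⟨w, hw⟩

theorem coxeterRel_seminormalGen (N : ℕ) : CoxeterRel N (seminormalGen N) := by
  have two : ∀ {i j}, i + 1 < N → j + 1 < N → ∀ (φ : PathSpace N), ∀ w ∈ paths N,
      extendPath (seminormalGen N i (seminormalGen N j φ)) w =
      seminormalOp i (seminormalOp j (extendPath φ)) w := fun hi hj φ w hw => by
    rw [extendPath_seminormalGen _ hw,
      seminormalOp_congr hi (fun v hv => extendPath_seminormalGen φ hv) hw]
  refine ⟨fun i hi => ?_, fun i hi => ?_, fun i j hij hj => ?_⟩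
  · ext1 φ; ext1 w
    change seminormalGen N i (seminormalGen N i φ) w = φ w
    rw [← extendPath_coe (seminormalGen N i _) w, two hi hi _ _ w.2, seminormalOp_sq, extendPath_coe]
  · apply LinearMap.ext; intro φ; ext1 w
    change seminormalGen N i (seminormalGen N (i + 1) (seminormalGen N i φ)) w =
      seminormalGen N (i + 1) (seminormalGen N i (seminormalGen N (i + 1) φ)) w
    rw [seminormalGen_apply, seminormalGen_apply,
      seminormalOp_congr (by omega) (two (by omega) (by omega) φ) w.2,
      seminormalOp_congr (by omega) (two (by omega) (by omega) φ) w.2,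
      seminormalOp_braid _ (content_ne_succ w.2 (by omega)) (content_ne_succ w.2 (by omega))
        (content_ne_add_two w.2 (by omega))]
  · apply LinearMap.ext; intro φ; ext1 w
    change seminormalGen N i (seminormalGen N j φ) w = seminormalGen N j (seminormalGen N i φ) w
    rw [← extendPath_coe (seminormalGen N i _) w, ← extendPath_coe (seminormalGen N j _) w,
      two (by omega) hj _ _ w.2,
      two hj (by omega) _ _ w.2, seminormalOp_comm hij]

/-- Young's seminormal form, on functions on all paths of length `N`. -/
noncomputable def seminormal (N : ℕ) : Perm (Fin N) →* Module.End ℂ (PathSpace N) :=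
  (coxeterRel_seminormalGen N).exists_hom.choose

theorem seminormal_swap {N i : ℕ} (hi : i + 1 < N) :
    seminormal N (swap ⟨i, by omega⟩ ⟨i + 1, hi⟩) = seminormalGen N i :=
  (coxeterRel_seminormalGen N).exists_hom.choose_spec i hi

/-- Multiplication by a function of the path. -/
def mulPath {N : ℕ} (g : (ℕ → ℕ) → ℂ) : Module.End ℂ (PathSpace N) where
  toFun φ w := g w * φ w
  map_add' φ ψ := by ext w; simp [mul_add]
  map_smul' c φ := by ext w; simp; ring

theorem mulPath_apply {N : ℕ} (g : (ℕ → ℕ) → ℂ) (φ : PathSpace N) (w : paths N) :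
    mulPath g φ w = g w * φ w := rfl

theorem extendPath_mulPath {N : ℕ} (g : (ℕ → ℕ) → ℂ) (φ : PathSpace N) (w : ℕ → ℕ) :
    extendPath (mulPath g φ) w = g w * extendPath φ w := by
  rw [extendPath, extendPath]; split_ifs <;> simp [mulPath_apply]

theorem mulPath_content_succ {N i : ℕ} (hi : i + 1 < N) :
    (mulPath fun w => (content (i + 1) w : ℂ)) = seminormalGen N i *
      (mulPath fun w => (content i w : ℂ)) * seminormalGen N i + seminormalGen N i := by
  apply LinearMap.ext; intro φ; ext1 w
  rw [mulPath_apply, ← extendPath_coe φ w, content_mul_eq _ (content_ne_succ w.2 hi)]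
  change _ = seminormalOp i (extendPath (mulPath _ (seminormalGen N i φ))) w + _
  congr 1
  refine seminormalOp_congr hi (fun v hv => ?_) w.2
  rw [extendPath_mulPath, extendPath_seminormalGen _ hv]

/-- The image of the Jucys–Murphy element is multiplication by the content. -/
theorem sum_seminormal_swap {N : ℕ} : ∀ (m : ℕ) (hm : m < N),
    ∑ j ∈ Finset.Iio (⟨m, hm⟩ : Fin N), seminormal N (swap j ⟨m, hm⟩) =
      mulPath fun w => (content m w : ℂ)
  | 0, hm => by
    have e : Finset.Iio (⟨0, hm⟩ : Fin N) = ∅ := by ext j; simp [Fin.lt_def]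
    rw [e, Finset.sum_empty]
    apply LinearMap.ext; intro φ; ext1 w
    have := path_apply_le w.2 hm
    simp only [Nat.le_zero] at this
    simp [mulPath_apply, content, shapeAt_zero, this]
  | m + 1, hm => by
    rw [mulPath_content_succ hm, ← sum_seminormal_swap m (by omega), ← seminormal_swap hm]
    have e : Finset.Iio (⟨m + 1, hm⟩ : Fin N) =
        insert ⟨m, by omega⟩ (Finset.Iio (⟨m, by omega⟩ : Fin N)) := by
      ext j; simp only [Finset.mem_Iio, Finset.mem_insert, Fin.lt_def, Fin.ext_iff]; omega
    -- For j < m, conjugation by (m, m + 1) carries (j, m) to (j, m + 1); the remaining term j = m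
    -- is the generator itself.
    rw [e, Finset.sum_insert (by simp), add_comm, Finset.mul_sum, Finset.sum_mul]
    congr 1
    refine Finset.sum_congr rfl fun j hj => ?_
    rw [← map_mul, ← map_mul]
    congr 1
    have hj : (j : ℕ) < m := by simpa [Fin.lt_def] using hj
    have h1 : (⟨m, by omega⟩ : Fin N) ≠ j := by simp [Fin.ext_iff]; omega
    have h2 : (⟨m + 1, by omega⟩ : Fin N) ≠ j := by simp [Fin.ext_iff]; omega
    rw [Equiv.mul_swap_eq_swap_mul _ j, swap_apply_left, swap_apply_of_ne_of_ne h1.symm h2.symm,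
      mul_assoc, swap_mul_self, mul_one]

end Seminormal

end PieriGrowth

namespace PieriGrowth

/-! ### Class functions vanishing off the identity -/

section ClassFunction

open Equiv

variable {α : Type*} [DecidableEq α]

/-- Multiplying by (σ⁻¹p, p) cuts p out of its cycle; the rest of the cycle is traversed in the same
order. -/
theorem swap_remove_pow_apply {σ : Perm α} {p : α} {L : ℕ}
    (hmin : ∀ i, 0 < i → i < L + 2 → (σ ^ i) p ≠ p) :
    ∀ i ≤ L, ((σ * swap (σ⁻¹ p) p) ^ i) (σ p) = (σ ^ (i + 1)) p
  | 0, _ => by simp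
  | i + 1, hi => by
    rw [pow_succ', Perm.mul_apply, swap_remove_pow_apply hmin i (by omega), Perm.mul_apply,
      swap_apply_of_ne_of_ne, ← Perm.mul_apply, ← pow_succ']
    · intro h
      refine hmin (i + 2) (by omega) (by omega) ?_
      rw [pow_succ', Perm.mul_apply, h]
      simp
    · exact hmin (i + 1) (by omega) (by omega)

/-- A class function on a symmetric group that is annihilated by all (conjugates of)
Jucys–Murphy elements vanishes off the identity. -/
theorem classFunction_eq_zero [Fintype α] (χ : Perm α → ℂ) (hconj : ∀ σ τ, χ (τ * σ * τ⁻¹) = χ σ)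
    (hsum : ∀ (S : Finset α) (p : α), p ∉ S → ∀ π : Perm α, (∀ x ∉ S, π x = x) →
      ∑ j ∈ S, χ (π * swap j p) = 0) : ∀ σ, σ ≠ 1 → χ σ = 0 := by
  suffices H : ∀ s, ∀ σ : Perm α, σ.support.card ≤ s → σ ≠ 1 → χ σ = 0 from
    fun σ hσ => H _ σ le_rfl hσ
  intro s
  induction s with
  | zero =>
    intro σ hs hσ
    exact absurd (Perm.card_support_eq_zero.1 (Nat.le_zero.1 hs)) hσ
  | succ s ihs =>
    -- Two nested inductions: on the size of the support, and on the length L of the cycle through a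
    -- chosen moved point p.
    suffices H : ∀ L, ∀ (σ : Perm α) (p : α), σ.support.card ≤ s + 1 → σ p ≠ p → 0 < L →
        (σ ^ L) p = p → (∀ i, 0 < i → i < L → (σ ^ i) p ≠ p) → χ σ = 0 by
      intro σ hs hσ
      obtain ⟨p, hp⟩ : ∃ p, σ p ≠ p := by
        by_contra! h
        exact hσ (Perm.ext h)
      have hex : ∃ i, 0 < i ∧ (σ ^ i) p = p := ⟨orderOf σ, orderOf_pos σ, by simp [pow_orderOf_eq_one]⟩
      classical
      exact H (Nat.find hex) σ p hs hp (Nat.find_spec hex).1 (Nat.find_spec hex).2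
        fun i hi hlt h => Nat.find_min hex hlt ⟨hi, h⟩
    intro L
    induction L using Nat.strong_induction_on with
    | _ L ih =>
    intro σ p hs hp hL hper hmin
    obtain ⟨L, rfl⟩ : ∃ K, L = K + 2 := ⟨L - 2, by
      have : L ≠ 1 := by rintro rfl; exact hp (by simpa using hper)
      omega⟩
    have hj0 : σ (σ⁻¹ p) = p := by simp
    have hj0p : σ⁻¹ p ≠ p := fun h => hp (by rw [h] at hj0; exact hj0)
    set π := σ * swap (σ⁻¹ p) p with hπ
    have hσπ : σ = π * swap (σ⁻¹ p) p := by rw [hπ, mul_assoc, swap_mul_self, mul_one]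
    have hπp : π p = p := by rw [hπ, Perm.mul_apply, swap_apply_right, hj0]
    have hπj : π (σ⁻¹ p) = σ p := by rw [hπ, Perm.mul_apply, swap_apply_left]
    have hπS : ∀ x ∉ σ.support.erase p, π x = x := by
      intro x hx
      rw [Finset.mem_erase, not_and, Perm.notMem_support] at hx
      by_cases hxp : x = p
      · rw [hxp, hπp]
      · have hx' := hx hxp
        rw [hπ, Perm.mul_apply, swap_apply_of_ne_of_ne ?_ hxp, hx']
        rintro rfl
        exact hxp (hx'.symm.trans hj0)
    have hπper : (π ^ (L + 1)) (σ p) = σ p := by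
      have e := swap_remove_pow_apply hmin L le_rfl
      rw [← hπ] at e
      rw [pow_succ', Perm.mul_apply, e, ← hπj]
      congr 1
      rw [Perm.eq_inv_iff_eq, ← Perm.mul_apply, ← pow_succ', hper]
    have hsum := hsum (σ.support.erase p) p (by simp) π hπS
    -- Multiplying π by (j, p) puts p back next to j. If j is in the old cycle, the result is
    -- conjugate to σ by a power of π. Otherwise p joins another cycle and the cycle through σ p has
    -- become shorter, so induction gives 0. The hypothesis thus says that a positive multiple of χ
    -- σ is zero.
    have hterm : ∀ j ∈ σ.support.erase p,
        χ (π * swap j p) = if π.SameCycle (σ⁻¹ p) j then χ σ else 0 := by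
      intro j hj
      have hjp : j ≠ p := Finset.ne_of_mem_erase hj
      split_ifs with hc
      · obtain ⟨a, rfl⟩ := hc
        have h1 : (π ^ a) p = p := Perm.zpow_apply_eq_self_of_apply_eq_self hπp a
        have e : π ^ a * swap (σ⁻¹ p) p * (π ^ a)⁻¹ = swap ((π ^ a) (σ⁻¹ p)) p := by
          rw [Equiv.mul_swap_eq_swap_mul, h1, mul_inv_cancel_right]
        have e' : π ^ a * σ * (π ^ a)⁻¹ = π * swap ((π ^ a) (σ⁻¹ p)) p := by
          rw [← e, ← mul_assoc, ← mul_assoc, ← ((Commute.refl π).zpow_left a).eq,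
            mul_assoc (π ^ a) π, ← hσπ]
        rw [← e', hconj]
      · set σ' := π * swap j p with hσ'
        have hsupp : ∀ x, σ' x ≠ x → σ x ≠ x := by
          intro x hx
          by_contra hx'
          have hxp : x ≠ p := by rintro rfl; exact hp hx'
          have hxj : x ≠ j := by
            rintro rfl
            exact (Perm.mem_support.1 (Finset.mem_of_mem_erase hj)) hx'
          apply hx
          rw [hσ', Perm.mul_apply, swap_apply_of_ne_of_ne hxj hxp]
          exact hπS x (by simp [hx'])
        have hsub : σ'.support ⊆ σ.support := fun x hx => by
          rw [Perm.mem_support] at hx ⊢; exact hsupp x hx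
        have hiter : ∀ i, (σ' ^ i) (σ p) = (π ^ i) (σ p) := by
          intro i
          induction i with
          | zero => rfl
          | succ i ihi =>
            rw [pow_succ', Perm.mul_apply, ihi, pow_succ' π]
            change π (swap j p _) = _
            rw [swap_apply_of_ne_of_ne]
            · rfl
            · rintro rfl
              refine hc ⟨(i + 1 : ℕ), ?_⟩
              rw [zpow_natCast, pow_succ, Perm.mul_apply, hπj]
            · intro h
              have : (π ^ i) p = p := Perm.pow_apply_eq_self_of_apply_eq_self hπp i
              exact hp ((π ^ i).injective (h.trans this.symm))
        -- If the shortened cycle is a fixed point, the support has shrunk; otherwise it has not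
        -- grown and the cycle length has dropped.
        by_cases hfix : σ' (σ p) = σ p
        · refine ihs σ' ?_ ?_
          · have : σ'.support ⊂ σ.support := by
              refine (Finset.ssubset_iff_of_subset hsub).2 ⟨σ p, ?_, ?_⟩
              · rw [Perm.apply_mem_support, Perm.mem_support]; exact hp
              · rw [Perm.notMem_support]; exact hfix
            have := Finset.card_lt_card this
            omega
          · intro h1
            have : σ' p = p := by rw [h1]; rfl
            rw [hσ', Perm.mul_apply, swap_apply_right] at this
            exact hjp (π.injective (this.trans hπp.symm))
        · have hex : ∃ i, 0 < i ∧ (σ' ^ i) (σ p) = σ p :=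
            ⟨L + 1, by omega, by rw [hiter, hπper]⟩
          classical
          refine ih (Nat.find hex) ?_ σ' (σ p) ((Finset.card_le_card hsub).trans hs) hfix
            (Nat.find_spec hex).1 (Nat.find_spec hex).2
            fun i hi hlt h => Nat.find_min hex hlt ⟨hi, h⟩
          have := Nat.find_min' hex ⟨Nat.succ_pos L, by rw [hiter, hπper]⟩
          omega
    rw [Finset.sum_congr rfl hterm, ← Finset.sum_filter, Finset.sum_const, nsmul_eq_mul,
      mul_eq_zero, Nat.cast_eq_zero, Finset.card_eq_zero] at hsum
    refine hsum.resolve_left (Finset.Nonempty.ne_empty ⟨σ⁻¹ p, ?_⟩)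
    rw [Finset.mem_filter, Finset.mem_erase, Perm.mem_support, hj0]
    exact ⟨⟨hj0p, hj0p.symm⟩, Perm.SameCycle.refl _ _⟩

end ClassFunction

end PieriGrowth

namespace PieriGrowth

/-! ### The trace formula -/

section Trace

open Equiv

theorem commute_mulPath_seminormalGen {N i : ℕ} {g : (ℕ → ℕ) → ℂ}
    (hg : ∀ w, g (swapStep i w) = g w) : Commute (mulPath g) (seminormalGen N i) := by
  apply LinearMap.ext; intro φ; ext1 w
  change g w * seminormalOp i (extendPath φ) w = seminormalOp i (extendPath (mulPath g φ)) w
  rw [seminormalOp, seminormalOp, extendPath_mulPath, extendPath_mulPath, hg]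
  ring

/-- Multiplication by the dimension of the final shape. -/
noncomputable def dimOp (N : ℕ) : Module.End ℂ (PathSpace N) :=
  mulPath fun w => (numPaths N (shapeAt N w) : ℂ)

theorem commute_dimOp (N : ℕ) (σ : Perm (Fin N)) : Commute (dimOp N) (seminormal N σ) := by
  induction σ using perm_fin_induction with
  | one => rw [map_one]; exact Commute.one_right _
  | mul i hi σ ih =>
    rw [map_mul, seminormal_swap]
    refine Commute.mul_right (commute_mulPath_seminormalGen fun w => ?_) ih
    rw [shapeAt_swapStep_of_gt hi]

/-- The trace weighted by the dimension of the final shape. -/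
noncomputable def dimTrace {N : ℕ} (A : Module.End ℂ (PathSpace N)) : ℂ :=
  LinearMap.trace ℂ (PathSpace N) (dimOp N * A)

theorem dimTrace_conj {N : ℕ} (σ τ : Perm (Fin N)) :
    dimTrace (seminormal N (τ * σ * τ⁻¹)) = dimTrace (seminormal N σ) := by
  have h : dimOp N * seminormal N (τ * σ * τ⁻¹) =
      seminormal N τ * (dimOp N * seminormal N σ * seminormal N τ⁻¹) := by
    rw [map_mul (seminormal N), map_mul (seminormal N), ← mul_assoc, ← mul_assoc,
      (commute_dimOp N τ).eq]
    simp only [mul_assoc]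
  rw [dimTrace, h, LinearMap.trace_mul_comm, mul_assoc, ← map_mul (seminormal N), inv_mul_cancel,
    map_one, mul_one, dimTrace]

open Classical in
theorem trace_mulPath_mul {N : ℕ} (g : (ℕ → ℕ) → ℂ) (A : Module.End ℂ (PathSpace N)) :
    LinearMap.trace ℂ (PathSpace N) (mulPath g * A) =
      ∑ w : paths N, g w * A (Pi.single w 1) w := by
  rw [← Matrix.toLin'_toMatrix' (mulPath g * A), Matrix.trace_toLin'_eq, Matrix.trace]
  refine Finset.sum_congr rfl fun w _ => ?_
  rw [Matrix.diag_apply, LinearMap.toMatrix'_apply]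
  rfl

open Classical in
theorem trace_mul_mulPath {N : ℕ} (g : (ℕ → ℕ) → ℂ) (A : Module.End ℂ (PathSpace N)) :
    LinearMap.trace ℂ (PathSpace N) (A * mulPath g) =
      ∑ w : paths N, g w * A (Pi.single w 1) w := by
  rw [LinearMap.trace_mul_comm, trace_mulPath_mul]

theorem mulPath_mul_mulPath {N : ℕ} (g h : (ℕ → ℕ) → ℂ) :
    (mulPath g * mulPath h : Module.End ℂ (PathSpace N)) = mulPath fun w => g w * h w := by
  apply LinearMap.ext; intro φ; ext1 w
  exact (mul_assoc _ _ _).symm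

/-- The sum over the paths of length `N` weighted by the dimension of the final shape. -/
noncomputable def dimSum (N : ℕ) (G : (ℕ → ℕ) → ℂ) : ℂ :=
  ∑ w ∈ paths N, (numPaths N (shapeAt N w) : ℂ) * G w

theorem shapeAt_succ_update (m x : ℕ) (w : ℕ → ℕ) :
    shapeAt (m + 1) (Function.update w m x) = addBox (shapeAt m w) x := by
  rw [shapeAt_succ, Function.update_self, shapeAt_congr (v := w)
    fun i hi => Function.update_of_ne hi.ne _ _]

/-- The last step is summed out by `sum_numPaths_addBox`. -/
theorem dimSum_succ {N : ℕ} {G : (ℕ → ℕ) → ℂ} (hG : ∀ w x, G (Function.update w N x) = G w) :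
    dimSum (N + 1) G = (N + 1) * dimSum N G := by
  rw [dimSum, sum_paths_succ, dimSum, Finset.mul_sum]
  refine Finset.sum_congr rfl fun w hw => ?_
  have h := sum_numPaths_addBox N N le_rfl (antitone_shapeAt hw le_rfl)
    (shapeAt_eq_zero hw le_rfl le_rfl)
  rw [← mul_assoc, ← Nat.cast_add_one, ← Nat.cast_mul, ← h, Nat.cast_sum, Finset.sum_mul]
  refine Finset.sum_congr rfl fun x _ => ?_
  rw [shapeAt_succ_update, hG]
  split_ifs <;> simp

theorem dimSum_eq_zero_of_le {M N : ℕ} (h : M ≤ N) {G : (ℕ → ℕ) → ℂ}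
    (hG : ∀ w m x, M ≤ m → G (Function.update w m x) = G w) (h0 : dimSum M G = 0) :
    dimSum N G = 0 := by
  induction N, h using Nat.le_induction with
  | base => exact h0
  | succ N hN ih => rw [dimSum_succ fun w x => hG w N x hN, ih, mul_zero]

/-- For fixed earlier steps, the weighted sum of the content of the last box is zero, the transition
measure being centred. -/
theorem dimSum_content_mul {m : ℕ} {d : (ℕ → ℕ) → ℂ}
    (hd : ∀ w x, d (Function.update w m x) = d w) :
    dimSum (m + 1) (fun w => content m w * d w) = 0 := by
  rw [dimSum, sum_paths_succ]
  refine Finset.sum_eq_zero fun w hw => ?_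
  have h := sum_content_mul_numPaths_addBox m m le_rfl (antitone_shapeAt hw le_rfl)
    (shapeAt_eq_zero hw le_rfl le_rfl)
  have h' := congrArg (fun z : ℤ => (z : ℂ) * d w) h
  simp only [Int.cast_sum, Finset.sum_mul, Int.cast_zero, zero_mul] at h'
  refine Eq.trans ?_ h'
  refine Finset.sum_congr rfl fun x _ => ?_
  have e : content m (Function.update w m x) = (shapeAt m w x : ℤ) - x := by
    rw [content, Function.update_self, shapeAt_congr (v := w)
      fun i hi => Function.update_of_ne hi.ne _ _]
  rw [shapeAt_succ_update, hd, e]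
  split_ifs <;> push_cast <;> ring

-- Grouped by final shape, this is the identity ∑ (dim λ)² = N!.
open Classical in
theorem dimSum_one (N : ℕ) : dimSum N (fun _ => 1) = N.factorial := by
  induction N with
  | zero =>
    have h : numPaths 0 (shapeAt 0 0) = 1 := by
      rw [numPaths, paths, Finset.filter_true_of_mem (by simp [shapeAt_zero])]; rfl
    simp [dimSum, paths, h]
  | succ N ih => rw [dimSum_succ fun _ _ => rfl, ih, Nat.factorial_succ]; push_cast; rfl

/-- The operator only involves the first `m` steps of the paths. -/
def IsLocal {N : ℕ} (m : ℕ) (A : Module.End ℂ (PathSpace N)) : Prop :=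
  ∀ (w w' : paths N) (φ φ' : PathSpace N), (∀ i < m, w.1 i = w'.1 i) →
    (∀ v v' : paths N, (∀ i, m ≤ i → v.1 i = w.1 i) → (∀ i, m ≤ i → v'.1 i = w'.1 i) →
      (∀ i < m, v.1 i = v'.1 i) → φ v = φ' v') → A φ w = A φ' w'

theorem isLocal_one {N m : ℕ} : IsLocal m (1 : Module.End ℂ (PathSpace N)) :=
  fun w w' _ _ h hφ => hφ w w' (fun _ _ => rfl) (fun _ _ => rfl) h

theorem IsLocal.mul {N m : ℕ} {A B : Module.End ℂ (PathSpace N)} (hA : IsLocal m A)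
    (hB : IsLocal m B) : IsLocal m (A * B) := fun w w' φ φ' h hφ =>
  hA w w' (B φ) (B φ') h fun v v' hv hv' hvv => hB v v' φ φ' hvv fun u u' hu hu' huu =>
    hφ u u' (fun i hi => (hu i hi).trans (hv i hi)) (fun i hi => (hu' i hi).trans (hv' i hi)) huu

theorem content_congr {i : ℕ} {w v : ℕ → ℕ} (h : ∀ j ≤ i, w j = v j) :
    content i w = content i v := by
  rw [content, content, shapeAt_congr fun j hj => h j hj.le, h i le_rfl]

/-- Both contents are functions of the first m steps, and the interchange leaves the later steps in
place. -/
theorem isLocal_seminormalGen {N m i : ℕ} (hm : m ≤ N) (hi : i + 1 < m) :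
    IsLocal m (seminormalGen N i) := fun w w' φ φ' h hφ => by
  rw [seminormalGen_apply, seminormalGen_apply, seminormalOp, seminormalOp, extendPath_coe,
    extendPath_coe, hφ w w' (fun _ _ => rfl) (fun _ _ => rfl) h,
    content_congr (i := i) fun j hj => h j (by omega),
    content_congr (i := i + 1) fun j hj => h j (by omega)]
  congr 1
  by_cases hq : offCoeff (content i w'.1) (content (i + 1) w'.1) = 0
  · rw [hq, zero_mul, zero_mul]
  · have hq' : offCoeff (content i w.1) (content (i + 1) w.1) ≠ 0 := by
      rwa [content_congr (i := i) fun j hj => h j (by omega),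
        content_congr (i := i + 1) fun j hj => h j (by omega)]
    have h1 := swapStep_mem_paths w.2 (by omega) hq'
    have h2 := swapStep_mem_paths w'.2 (by omega) hq
    congr 1
    refine (extendPath_coe φ ⟨_, h1⟩).trans ((hφ ⟨_, h1⟩ ⟨_, h2⟩ (fun j hj => ?_) (fun j hj => ?_)
      fun j hj => ?_).trans (extendPath_coe φ' ⟨_, h2⟩).symm)
    · exact swapStep_of_ne (by omega) (by omega) _
    · exact swapStep_of_ne (by omega) (by omega) _
    · simp only [swapStep, Function.comp_apply]
      apply h
      rw [swap_apply_def]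
      split_ifs <;> omega

/-- A permutation fixing all points from m on comes from `Perm (Fin m)`, which is generated by its
adjacent transpositions. -/
theorem perm_fix_induction {N m : ℕ} (hm : m ≤ N) {p : Perm (Fin N) → Prop} (one : p 1)
    (mul : ∀ i (hi : i + 1 < m) σ, p σ →
      p (swap ⟨i, by omega⟩ ⟨i + 1, by omega⟩ * σ))
    (π : Perm (Fin N)) (hπ : ∀ x : Fin N, m ≤ x → π x = x) : p π := by
  have key : ∀ σ : Perm (Fin m), p (σ.extendDomain (Fin.castLEquiv hm)) := by
    intro σ
    induction σ using perm_fin_induction with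
    | one => rw [Perm.extendDomain_one]; exact one
    | mul i hi σ ih =>
      rw [← Perm.extendDomain_mul, extendDomain_swap]
      exact mul i hi _ ih
  have hmem : ∀ x : Fin N, (x : ℕ) < m ↔ (π x : ℕ) < m := by
    intro x
    constructor
    · intro hx
      by_contra h
      have := hπ (π x) (by omega)
      rw [π.injective this] at h
      exact h hx
    · intro hx
      by_contra h
      rw [hπ x (by omega)] at hx
      exact h hx
  have e : π = ((Fin.castLEquiv hm).symm.permCongr
      (π.subtypePerm (p := fun x : Fin N => (x : ℕ) < m) (fun x => (hmem x).symm))).extendDomain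
        (Fin.castLEquiv hm) := by
    ext x
    by_cases hx : (x : ℕ) < m
    · rw [Perm.extendDomain_apply_subtype _ (Fin.castLEquiv hm) hx]
      simp [Equiv.permCongr_apply]
    · rw [Perm.extendDomain_apply_not_subtype _ (Fin.castLEquiv hm) hx, hπ x (by omega)]
  rw [e]
  exact key _

theorem isLocal_seminormal {N m : ℕ} (hm : m ≤ N) (π : Perm (Fin N))
    (hπ : ∀ x : Fin N, m ≤ x → π x = x) : IsLocal m (seminormal N π) := by
  refine perm_fix_induction hm (p := fun π => IsLocal m (seminormal N π)) ?_ ?_ π hπ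
  · rw [map_one]; exact isLocal_one
  · intro i hi σ hσ
    rw [map_mul, seminormal_swap]
    exact (isLocal_seminormalGen hm hi).mul hσ

-- The diagonal entries of a local operator depend only on the first m steps. Steps after m can be
-- summed out by `dimSum_succ`, and then the content of step m averages to zero.
open Classical in
theorem IsLocal.dimTrace_mul_content {N m : ℕ} (hm : m < N) {A : Module.End ℂ (PathSpace N)}
    (hA : IsLocal m A) : dimTrace (A * mulPath fun w => (content m w : ℂ)) = 0 := by
  have hdiag : ∀ w w' : paths N, (∀ i < m, w.1 i = w'.1 i) →
      A (Pi.single w 1) w = A (Pi.single w' 1) w' := fun w w' h => by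
    refine hA w w' _ _ h fun v v' hv hv' hvv => ?_
    have : v = w ↔ v' = w' := by
      constructor
      · rintro rfl
        refine Subtype.ext (funext fun i => ?_)
        rcases Nat.lt_or_ge i m with hi | hi
        · rw [← hvv i hi, h i hi]
        · exact hv' i hi
      · rintro rfl
        refine Subtype.ext (funext fun i => ?_)
        rcases Nat.lt_or_ge i m with hi | hi
        · rw [hvv i hi, h i hi]
        · exact hv i hi
    simp only [Pi.single_apply, this]
  -- The diagonal entry as a function of arbitrary sequences that ignores all steps from m on; it is
  -- 0 on sequences whose first m steps begin no path.
  let d : (ℕ → ℕ) → ℂ := fun u => if h : ∃ w : paths N, ∀ i < m, w.1 i = u i then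
    A (Pi.single h.choose 1) h.choose else 0
  have hd : ∀ w : paths N, A (Pi.single w 1) w = d w := fun w => by
    have h : ∃ v : paths N, ∀ i < m, v.1 i = w.1 i := ⟨w, fun _ _ => rfl⟩
    simp only [d]
    rw [dif_pos h]
    exact (hdiag _ _ h.choose_spec).symm
  have hd' : ∀ u k x, m ≤ k → d (Function.update u k x) = d u := fun u k x hk => by
    have : ∀ w : paths N, (∀ i < m, w.1 i = Function.update u k x i) ↔ ∀ i < m, w.1 i = u i :=
      fun w => forall₂_congr fun i hi => by rw [Function.update_of_ne (by omega)]
    simp only [d, this]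
  have h0 : dimSum N (fun w => content m w * d w) = 0 := by
    refine dimSum_eq_zero_of_le (M := m + 1) hm (fun w k x hk => ?_)
      (dimSum_content_mul fun w x => hd' w m x le_rfl)
    rw [hd' w k x (by omega), content_congr (v := w)
      fun j hj => Function.update_of_ne (by omega) _ _]
  rw [dimTrace, ← mul_assoc, trace_mul_mulPath, ← h0, dimSum, ← Finset.sum_coe_sort (paths N)]
  refine Finset.sum_congr rfl fun w _ => ?_
  change (content m w.1 : ℂ) * (_ * A (Pi.single w 1) w) = _
  rw [hd]
  ring

theorem dimTrace_sum {N : ℕ} {ι : Type*} (s : Finset ι) (A : ι → Module.End ℂ (PathSpace N)) :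
    dimTrace (∑ i ∈ s, A i) = ∑ i ∈ s, dimTrace (A i) := by
  simp only [dimTrace, Finset.mul_sum, map_sum]

/-- By conjugation invariance one may relabel so that S is the set of the first m points and p is
the point m. The sum is then the weighted trace of a local operator times a Jucys–Murphy element. -/
theorem sum_dimTrace_swap {N : ℕ} (S : Finset (Fin N)) (p : Fin N) (hp : p ∉ S)
    (π : Perm (Fin N)) (hπ : ∀ x ∉ S, π x = x) :
    ∑ j ∈ S, dimTrace (seminormal N (π * swap j p)) = 0 := by
  set m := S.card with hm
  have hmN : m < N := by
    have := Finset.card_lt_univ_of_notMem hp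
    simpa using this
  obtain ⟨τ, hτ, hτp⟩ : ∃ τ : Perm (Fin N), (∀ j, j ∈ S ↔ ((τ j : Fin N) : ℕ) < m) ∧
      ((τ p : Fin N) : ℕ) = m := by
    -- An enumeration of S followed by p; multiple transitivity of the symmetric group supplies the
    -- relabelling τ.
    let x : Fin (m + 1) ↪ Fin N :=
      ⟨Fin.snoc (fun i => S.equivFin.symm i) p, by
        rw [Fin.snoc_injective_iff]
        refine ⟨fun i j h => by simpa using h, ?_⟩
        rintro ⟨i, hi⟩
        exact hp (hi ▸ (S.equivFin.symm i).2)⟩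
    have := Equiv.Perm.isMultiplyPretransitive (Fin N) (m + 1)
    obtain ⟨τ, hτ⟩ := MulAction.exists_smul_eq (Perm (Fin N)) x (Fin.castLEEmb hmN)
    have hx : ∀ i, ((τ (x i) : Fin N) : ℕ) = i := fun i => by
      have := congrArg (fun e : Fin (m + 1) ↪ Fin N => ((e i : Fin N) : ℕ)) hτ
      simpa using this
    have hlast : ((τ p : Fin N) : ℕ) = m := by
      have := hx (Fin.last m)
      simpa [x] using this
    have hS : ∀ j ∈ S, ((τ j : Fin N) : ℕ) < m := fun j hj => by
      have := hx (Fin.castSucc (S.equivFin ⟨j, hj⟩))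
      simp only [x, Function.Embedding.coeFn_mk, Fin.snoc_castSucc, symm_apply_apply] at this
      rw [this]
      simp
    refine ⟨τ, fun j => ⟨hS j, fun hj => ?_⟩, hlast⟩
    have := hx ⟨(τ j : Fin N), by omega⟩
    have h2 := τ.injective (Fin.ext this)
    have h3 : (⟨(τ j : Fin N), by omega⟩ : Fin (m + 1)) = Fin.castSucc ⟨(τ j : Fin N), hj⟩ := rfl
    rw [h3] at h2
    simp only [x, Function.Embedding.coeFn_mk, Fin.snoc_castSucc] at h2
    rw [← h2]
    exact (S.equivFin.symm _).2
  have hloc := (isLocal_seminormal hmN.le (τ * π * τ⁻¹) fun y hy => by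
    obtain ⟨x, rfl⟩ := τ.surjective y
    have hx : x ∉ S := fun h => by have := (hτ x).1 h; omega
    simp [hπ x hx]).dimTrace_mul_content hmN
  rw [← sum_seminormal_swap m hmN, Finset.mul_sum, dimTrace_sum] at hloc
  rw [← hloc]
  refine Finset.sum_equiv τ (fun j => ?_) fun j _ => ?_
  · rw [hτ, Finset.mem_Iio, Fin.lt_def]
  · rw [← map_mul, ← dimTrace_conj _ τ]
    congr 2
    have e : (⟨m, hmN⟩ : Fin N) = τ p := Fin.ext hτp.symm
    rw [e]
    have e2 : τ * swap j p = swap (τ j) (τ p) * τ := Equiv.mul_swap_eq_swap_mul _ _ _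
    rw [eq_comm, ← eq_mul_inv_iff_mul_eq] at e2
    rw [e2]
    group

/-- The decomposition of the character of the regular representation. -/
theorem dimTrace_seminormal {N : ℕ} (σ : Perm (Fin N)) :
    dimTrace (seminormal N σ) = if σ = 1 then (N.factorial : ℂ) else 0 := by
  split_ifs with h
  · rw [h, map_one, dimTrace, dimOp, trace_mulPath_mul, ← dimSum_one, dimSum,
      ← Finset.sum_coe_sort (paths N)]
    simp only [Module.End.one_apply, Pi.single_eq_same]
  · exact classFunction_eq_zero (fun σ => dimTrace (seminormal N σ)) dimTrace_conj
      sum_dimTrace_swap σ h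

end Trace

end PieriGrowth

namespace PieriGrowth

/-! ### The recording path of Robinson–Schensted insertion -/

section Recording

variable {α : Type*} [LinearOrder α]

/-- The length of a row of a tableau. -/
def rowLen (T : List (List α)) (j : ℕ) : ℕ := (T.getD j []).length

/-- The row in which the insertion of `x` into a tableau creates a new box. -/
def insertRow : List (List α) → α → ℕ
  | [], _ => 0
  | r :: T, x =>
    match (rowInsert x r).2 with
    | none => 0
    | some y => insertRow T y + 1

theorem insertRow_of_none {x : α} {r : List α} (T : List (List α))
    (h : (rowInsert x r).2 = none) : insertRow (r :: T) x = 0 := by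
  rw [insertRow, h]

theorem insertRow_of_some {x y : α} {r : List α} (T : List (List α))
    (h : (rowInsert x r).2 = some y) : insertRow (r :: T) x = insertRow T y + 1 := by
  rw [insertRow, h]

theorem tableauInsert_of_none {x : α} {r : List α} (T : List (List α))
    (h : (rowInsert x r).2 = none) : tableauInsert (r :: T) x = (rowInsert x r).1 :: T := by
  rw [tableauInsert, h]

theorem tableauInsert_of_some {x y : α} {r : List α} (T : List (List α))
    (h : (rowInsert x r).2 = some y) :
    tableauInsert (r :: T) x = (rowInsert x r).1 :: tableauInsert T y := by
  rw [tableauInsert, h]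

theorem rowInsert_of_none (x : α) : ∀ (r : List α), (rowInsert x r).2 = none →
    (rowInsert x r).1 = r ++ [x]
  | [], _ => rfl
  | a :: r, h => by
    by_cases hx : x < a
    · simp [rowInsert, hx] at h
    · simp only [rowInsert, hx, if_false] at h ⊢
      rw [rowInsert_of_none x r h, List.cons_append]

theorem mem_rowInsert_self (x : α) : ∀ r : List α, x ∈ (rowInsert x r).1
  | [] => by simp [rowInsert]
  | a :: r => by
    by_cases hx : x < a
    · simp [rowInsert, hx]
    · simp only [rowInsert, hx, if_false]
      exact List.mem_cons_of_mem _ (mem_rowInsert_self x r)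

theorem bumped_mem (x : α) : ∀ (r : List α) {y : α}, (rowInsert x r).2 = some y → y ∈ r
  | [], y, h => by simp [rowInsert] at h
  | a :: r, y, h => by
    by_cases hx : x < a
    · simp only [rowInsert, hx, if_true, Option.some.injEq] at h
      simp [h]
    · simp only [rowInsert, hx, if_false] at h
      exact List.mem_cons_of_mem _ (bumped_mem x r h)

theorem rowInsert_perm (x : α) : ∀ r : List α,
    ((rowInsert x r).1 ++ (rowInsert x r).2.toList).Perm (x :: r)
  | [] => by simp [rowInsert]
  | a :: r => by
    by_cases hx : x < a
    · simp only [rowInsert, hx, if_true, Option.toList_some, List.cons_append]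
      exact List.Perm.cons _ (List.perm_append_singleton a r)
    · simp only [rowInsert, hx, if_false, List.cons_append]
      exact ((rowInsert_perm x r).cons a).trans (List.Perm.swap x a r)

theorem pairwise_rowInsert (x : α) : ∀ r : List α, r.Pairwise (· ≤ ·) →
    (rowInsert x r).1.Pairwise (· ≤ ·)
  | [], _ => by simp [rowInsert]
  | a :: r, h => by
    rw [List.pairwise_cons] at h
    by_cases hx : x < a
    · simp only [rowInsert, hx, if_true, List.pairwise_cons]
      exact ⟨fun b hb => hx.le.trans (h.1 b hb), h.2⟩
    · simp only [rowInsert, hx, if_false, List.pairwise_cons]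
      refine ⟨fun b hb => ?_, pairwise_rowInsert x r h.2⟩
      have := (rowInsert_perm x r).subset (List.mem_append_left _ hb)
      rcases List.mem_cons.1 this with rfl | hb'
      · exact not_lt.1 hx
      · exact h.1 b hb'

/-- Reverse bumping: in a sorted row the bumped entry can be put back in only one place. -/
theorem rowInsert_injective {x x' y : α} : ∀ {r r' : List α}, r.Pairwise (· ≤ ·) →
    r'.Pairwise (· ≤ ·) → (rowInsert x r).1 = (rowInsert x' r').1 →
    (rowInsert x r).2 = some y → (rowInsert x' r').2 = some y → r = r' ∧ x = x'
  | [], _, _, _, _, h, _ => by simp [rowInsert] at h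
  | _ :: _, [], _, _, _, _, h => by simp [rowInsert] at h
  | a :: r, b :: r', h, h', he, h1, h2 => by
    have hxy := rowInsert_bumped_gt x _ h1
    have hxy' := rowInsert_bumped_gt x' _ h2
    rw [List.pairwise_cons] at h h'
    by_cases hx : x < a <;> by_cases hx' : x' < b <;>
      simp only [rowInsert, hx, hx', if_true, if_false, Option.some.injEq, List.cons.injEq] at he h1 h2
    · exact ⟨by rw [h1, h2, he.2], he.1⟩
    · have := h.1 x' (he.2 ▸ mem_rowInsert_self x' r')
      exact absurd (h1 ▸ hxy') (not_lt.2 this)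
    · have := h'.1 x (he.2 ▸ mem_rowInsert_self x r)
      exact absurd (h2 ▸ hxy) (not_lt.2 this)
    · obtain ⟨e1, e2⟩ := rowInsert_injective h.2 h'.2 he.2 h1 h2
      exact ⟨by rw [e1, he.1], e2⟩

theorem rowInsert_none_of_le {x x' : α} (hx : x ≤ x') : ∀ (r : List α),
    (rowInsert x r).2 = none → (rowInsert x' (rowInsert x r).1).2 = none
  | [], _ => by simp [rowInsert, not_lt.2 hx]
  | a :: r, h => by
    by_cases ha : x < a
    · simp [rowInsert, ha] at h
    · have ha' : ¬ x' < a := not_lt.2 ((not_lt.1 ha).trans hx)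
      simp only [rowInsert, ha, ha', if_false] at h ⊢
      exact rowInsert_none_of_le hx r h

/-- Row bumping lemma: once x is in place, a letter x' ≥ x can bump only entries to the right of it.
-/
theorem bumped_le_of_le {x x' y y' : α} (hx : x ≤ x') : ∀ (r : List α), r.Pairwise (· ≤ ·) →
    (rowInsert x r).2 = some y → (rowInsert x' (rowInsert x r).1).2 = some y' → y ≤ y'
  | [], _, h, _ => by simp [rowInsert] at h
  | a :: r, hr, h, h' => by
    rw [List.pairwise_cons] at hr
    by_cases ha : x < a
    · simp only [rowInsert, ha, not_lt.2 hx, if_true, if_false, Option.some.injEq] at h h'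
      rw [← h]
      exact hr.1 _ (bumped_mem x' r h')
    · have ha' : ¬ x' < a := not_lt.2 ((not_lt.1 ha).trans hx)
      simp only [rowInsert, ha, ha', if_false] at h h'
      exact bumped_le_of_le hx r hr.2 h h'

/-- The rows of the tableau are weakly increasing and not empty. -/
def SortedRows (T : List (List α)) : Prop := ∀ r ∈ T, r.Pairwise (· ≤ ·) ∧ r ≠ []

theorem sortedRows_tableauInsert : ∀ (T : List (List α)) (x : α), SortedRows T →
    SortedRows (tableauInsert T x)
  | [], x, _ => by simp [tableauInsert, SortedRows]
  | r :: T, x, h => by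
    have hr := h r (by simp)
    have hT : SortedRows T := fun s hs => h s (List.mem_cons_of_mem _ hs)
    have h1 : (rowInsert x r).1.Pairwise (· ≤ ·) ∧ (rowInsert x r).1 ≠ [] :=
      ⟨pairwise_rowInsert x r hr.1, List.ne_nil_of_mem (mem_rowInsert_self x r)⟩
    unfold tableauInsert
    split <;> intro s hs <;> rcases List.mem_cons.1 hs with rfl | hs
    · exact h1
    · exact hT s hs
    · exact h1
    · exact sortedRows_tableauInsert T _ hT s hs

theorem insertionTableau_append_singleton (l : List α) (x : α) :
    insertionTableau (l ++ [x]) = tableauInsert (insertionTableau l) x := by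
  simp [insertionTableau]

theorem sortedRows_insertionTableau (l : List α) : SortedRows (insertionTableau l) := by
  induction l using List.reverseRecOn with
  | nil => simp [insertionTableau, SortedRows]
  | append_singleton l x ih =>
    rw [insertionTableau_append_singleton]
    exact sortedRows_tableauInsert _ x ih

theorem flatten_tableauInsert_perm : ∀ (T : List (List α)) (x : α),
    (tableauInsert T x).flatten.Perm (x :: T.flatten)
  | [], x => by simp [tableauInsert]
  | r :: T, x => by
    have h := rowInsert_perm x r
    unfold tableauInsert
    split <;> rename_i hy <;> rw [hy] at h
    · simpa using h.append_right T.flatten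
    · rename_i y
      rw [List.flatten_cons, List.flatten_cons]
      refine ((flatten_tableauInsert_perm T y).append_left _).trans ?_
      simpa using h.append_right T.flatten

theorem flatten_insertionTableau_perm (l : List α) : (insertionTableau l).flatten.Perm l := by
  induction l using List.reverseRecOn with
  | nil => simp [insertionTableau]
  | append_singleton l x ih =>
    rw [insertionTableau_append_singleton]
    exact (flatten_tableauInsert_perm _ x).trans
      ((ih.cons x).trans (List.perm_append_singleton x l).symm)

theorem rowLen_tableauInsert : ∀ (T : List (List α)) (x : α),
    rowLen (tableauInsert T x) = addBox (rowLen T) (insertRow T x)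
  | [], x => by
    ext j
    rw [addBox_apply]
    rcases j with _ | j <;> simp [tableauInsert, insertRow, rowLen]
  | r :: T, x => by
    have h := rowInsert_length x r
    ext j
    rw [addBox_apply]
    cases hy : (rowInsert x r).2 with
    | none =>
      rw [hy] at h
      rw [tableauInsert_of_none T hy, insertRow_of_none T hy]
      rcases j with _ | j
      · simpa [rowLen] using h
      · simp [rowLen]
    | some y =>
      rw [hy] at h
      rw [tableauInsert_of_some T hy, insertRow_of_some T hy]
      rcases j with _ | j
      · simpa [rowLen] using h
      · have ih := congrFun (rowLen_tableauInsert T y) j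
        rw [addBox_apply] at ih
        simpa [rowLen] using ih

/-- Reverse insertion: the row of the new box tells in which row the bumping ended, and from there
it is undone row by row upwards. -/
theorem tableauInsert_injective : ∀ {T T' : List (List α)} {x x' : α}, SortedRows T →
    SortedRows T' → tableauInsert T x = tableauInsert T' x' → insertRow T x = insertRow T' x' →
    T = T' ∧ x = x'
  | [], [], x, x', _, _, h, _ => by simpa [tableauInsert] using h
  | [], r :: T, x, x', _, h', h, hr => by
    have hne := (h' r (by simp)).2
    unfold tableauInsert insertRow at *
    split at hr <;> rename_i hy
    · simp only [hy] at h
      rw [rowInsert_of_none _ _ hy] at h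
      have := congrArg (fun t => (t.headD []).length) h
      simp at this
      exact absurd this hne
    · omega
  | r :: T, [], x, x', h', _, h, hr => by
    have hne := (h' r (by simp)).2
    unfold tableauInsert insertRow at *
    split at hr <;> rename_i hy
    · simp only [hy] at h
      rw [rowInsert_of_none _ _ hy] at h
      have := congrArg (fun t => (t.headD []).length) h
      simp at this
      exact absurd this hne
    · omega
  | r :: T, r' :: T', x, x', hs, hs', h, hr => by
    have h1 := hs r (by simp)
    have h1' := hs' r' (by simp)
    have hT : SortedRows T := fun s hs1 => hs s (List.mem_cons_of_mem _ hs1)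
    have hT' : SortedRows T' := fun s hs1 => hs' s (List.mem_cons_of_mem _ hs1)
    unfold tableauInsert insertRow at *
    split at hr <;> rename_i hy <;> split at hr <;> rename_i hy'
    · simp only [hy, hy', List.cons.injEq] at h
      rw [rowInsert_of_none _ _ hy, rowInsert_of_none _ _ hy'] at h
      have := List.append_inj' h.1 rfl
      simp only [List.cons.injEq, and_true] at this
      exact ⟨by rw [this.1, h.2], this.2⟩
    · omega
    · omega
    · rename_i y _ y'
      simp only [hy, hy', List.cons.injEq] at h
      obtain ⟨e1, rfl⟩ := tableauInsert_injective hT hT' h.2 (by omega)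
      obtain ⟨e2, e3⟩ := rowInsert_injective h1.1 h1'.1 h.1 hy hy'
      exact ⟨by rw [e1, e2], e3⟩

/-- The second bumping route stays to the right of the first, hence ends weakly higher. This is why
increasing letters create a horizontal strip. -/
theorem insertRow_le_of_le : ∀ (T : List (List α)) {x x' : α}, SortedRows T → x ≤ x' →
    insertRow (tableauInsert T x) x' ≤ insertRow T x
  | [], x, x', _, h => by simp [tableauInsert, insertRow, rowInsert, not_lt.2 h]
  | r :: T, x, x', hs, h => by
    have hT : SortedRows T := fun s hs1 => hs s (List.mem_cons_of_mem _ hs1)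
    cases hy : (rowInsert x r).2 with
    | none =>
      rw [tableauInsert_of_none T hy, insertRow_of_none T hy,
        insertRow_of_none T (rowInsert_none_of_le h r hy)]
    | some y =>
      rw [tableauInsert_of_some T hy, insertRow_of_some T hy]
      cases hy' : (rowInsert x' (rowInsert x r).1).2 with
      | none => rw [insertRow_of_none _ hy']; omega
      | some y' =>
        rw [insertRow_of_some _ hy']
        have := insertRow_le_of_le T hT (bumped_le_of_le h r (hs r (by simp)).1 hy hy')
        omega

/-- The recording path: the `i`-th step is the row of the box created by the `i`-th letter. -/
def recWord (l : List α) (i : ℕ) : ℕ :=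
  if h : i < l.length then insertRow (insertionTableau (l.take i)) l[i] else 0

theorem insertionTableau_take_succ {l : List α} {i : ℕ} (h : i < l.length) :
    insertionTableau (l.take (i + 1)) = tableauInsert (insertionTableau (l.take i)) l[i] := by
  rw [← insertionTableau_append_singleton, List.take_succ_eq_append_getElem h]

theorem shapeAt_recWord (l : List α) {m : ℕ} (hm : m ≤ l.length) :
    shapeAt m (recWord l) = rowLen (insertionTableau (l.take m)) := by
  induction m with
  | zero => rw [shapeAt_zero]; ext j; simp [rowLen, insertionTableau]
  | succ m ih =>
    rw [shapeAt_succ, insertionTableau_take_succ hm, rowLen_tableauInsert, ih (by omega), recWord,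
      dif_pos (by omega)]

theorem dominates_getD {T : List (List α)} (h : T.IsChain Dominates) (j : ℕ) :
    Dominates (T.getD j []) (T.getD (j + 1) []) := by
  by_cases hj : j + 1 < T.length
  · rw [List.getD_eq_getElem _ _ hj, List.getD_eq_getElem _ _ (by omega)]
    exact List.isChain_iff_getElem.1 h j hj
  · rw [List.getD_eq_default T (n := j + 1) _ (by omega)]
    unfold Dominates
    trivial

theorem antitone_rowLen (l : List α) : Antitone (rowLen (insertionTableau l)) :=
  antitone_nat_of_succ_le fun j => (dominates_getD (isChain_insertionTableau l) j).length_le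

theorem recWord_mem_paths (l : List α) : recWord l ∈ paths l.length := by
  refine mem_paths.2 ⟨fun m hm => ?_, fun i hi => ?_⟩
  · rw [shapeAt_recWord l hm]; exact antitone_rowLen _
  · rw [recWord, dif_neg (by omega)]

theorem recWord_succ_le {l : List α} {i : ℕ} (hi : i + 1 < l.length) (h : l[i] ≤ l[i + 1]) :
    recWord l (i + 1) ≤ recWord l i := by
  rw [recWord, recWord, dif_pos hi, dif_pos (by omega), insertionTableau_take_succ (by omega)]
  exact insertRow_le_of_le _ (sortedRows_insertionTableau _) h

/-- Injectivity of Robinson–Schensted: the recording path says which box to remove at each stage, so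
the letters are recovered from the last to the first. -/
theorem insertionTableau_injective {l l' : List α} (hlen : l.length = l'.length)
    (hT : insertionTableau l = insertionTableau l') (hw : recWord l = recWord l') : l = l' := by
  suffices H : ∀ m, m ≤ l.length →
      insertionTableau (l.take m) = insertionTableau (l'.take m) → l.take m = l'.take m by
    have := H l.length le_rfl (by rw [List.take_length, hlen, List.take_length]; exact hT)
    rwa [List.take_length, hlen, List.take_length] at this
  intro m
  induction m with
  | zero => simp
  | succ m ih =>
    intro hm h
    rw [insertionTableau_take_succ hm, insertionTableau_take_succ (by omega)] at h
    have hwm := congrFun hw m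
    rw [recWord, recWord, dif_pos (by omega), dif_pos (by omega)] at hwm
    obtain ⟨h1, h2⟩ := tableauInsert_injective (sortedRows_insertionTableau _)
      (sortedRows_insertionTableau _) h hwm
    rw [List.take_succ_eq_append_getElem hm, List.take_succ_eq_append_getElem (by omega), h2,
      ih (by omega) h1]

theorem mem_rskShape {l : List α} {c : ℕ × ℕ} :
    c ∈ (rskShape l).cells ↔ c.2 < rowLen (insertionTableau l) c.1 := by
  rw [YoungDiagram.mem_cells, rskShape, YoungDiagram.mem_ofRowLens]
  constructor
  · rintro ⟨h, h'⟩
    rw [List.length_map] at h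
    rw [rowLen, List.getD_eq_getElem _ _ h]
    simpa using h'
  · intro h
    have hc : c.1 < (insertionTableau l).length := by
      by_contra hc
      rw [rowLen, List.getD_eq_default _ _ (by omega)] at h
      simp at h
    rw [rowLen, List.getD_eq_getElem _ _ hc] at h
    exact ⟨by simpa using hc, by simpa using h⟩

/-! ### Invariance of insertion under strictly increasing relabelling. -/

variable {β : Type*} [LinearOrder β] {f : α → β}

theorem rowInsert_map (hf : StrictMono f) (x : α) : ∀ r : List α,
    rowInsert (f x) (r.map f) = ((rowInsert x r).1.map f, (rowInsert x r).2.map f)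
  | [] => rfl
  | a :: r => by
    by_cases hx : x < a
    · simp [rowInsert, hx, hf.lt_iff_lt]
    · simp [rowInsert, hx, hf.lt_iff_lt, rowInsert_map hf x r]

theorem tableauInsert_map (hf : StrictMono f) : ∀ (T : List (List α)) (x : α),
    tableauInsert (T.map (List.map f)) (f x) = (tableauInsert T x).map (List.map f)
  | [], x => rfl
  | r :: T, x => by
    rw [List.map_cons, tableauInsert, tableauInsert, rowInsert_map hf]
    cases h : (rowInsert x r).2 with
    | none => simp
    | some y => simp [tableauInsert_map hf T y]

theorem insertionTableau_map (hf : StrictMono f) (l : List α) :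
    insertionTableau (l.map f) = (insertionTableau l).map (List.map f) := by
  induction l using List.reverseRecOn with
  | nil => rfl
  | append_singleton l x ih =>
    rw [List.map_append, List.map_singleton, insertionTableau_append_singleton,
      insertionTableau_append_singleton, ih, tableauInsert_map hf]

/-- The shape only depends on the relative order of the letters. -/
theorem rskShape_map (hf : StrictMono f) (l : List α) : rskShape (l.map f) = rskShape l := by
  have h : ((insertionTableau (l.map f)).map List.length) = (insertionTableau l).map List.length := by
    rw [insertionTableau_map hf, List.map_map]
    congr 1
    ext r
    simp
  unfold rskShape
  congr 1

end Recording

end PieriGrowth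

namespace PieriGrowth

/-! ### Standard tableaux as paths -/

section TableauPath

/-- An entry below m has an entry below m above it in its column. Hence the entries below m of a
tableau form a diagram. -/
theorem Dominates.countP_le (m : ℕ) : ∀ {r s : List ℕ}, Dominates r s →
    s.countP (· < m) ≤ r.countP (· < m)
  | _, [], _ => by simp
  | [], _ :: _, h => h.elim
  | a :: r, b :: s, h => by
    have ih := h.2.countP_le m
    have hab := h.1
    rw [List.countP_cons, List.countP_cons]
    by_cases hb : b < m
    · simp only [hb, hab.trans hb, decide_true, if_true]; omega
    · simp only [hb, decide_false, Bool.false_eq_true, if_false]; omega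

/-- The path associated to a standard tableau: the `a`-th step is the row of the entry `a`. -/
def rowOf (T : List (List ℕ)) (a : ℕ) : ℕ :=
  if a ∈ T.flatten then T.findIdx (fun r => a ∈ r) else 0

theorem rowOf_eq_iff {T : List (List ℕ)} (hT : T.flatten.Nodup) {a j : ℕ} (ha : a ∈ T.flatten) :
    rowOf T a = j ↔ a ∈ T.getD j [] := by
  have hex : ∃ r ∈ T, a ∈ r := by simpa using ha
  have hlt : T.findIdx (fun r => a ∈ r) < T.length :=
    List.findIdx_lt_length_of_exists (by simpa using hex)
  have hmem : a ∈ T[T.findIdx (fun r => a ∈ r)] := by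
    simpa using List.findIdx_getElem (w := hlt)
  rw [rowOf, if_pos ha]
  constructor
  · rintro rfl
    rwa [List.getD_eq_getElem _ _ hlt]
  · intro h
    have hj : j < T.length := by
      by_contra hj
      rw [List.getD_eq_default _ _ (by omega)] at h
      simp at h
    rw [List.getD_eq_getElem _ _ hj] at h
    have hp := (List.nodup_flatten.1 hT).2
    rw [List.pairwise_iff_getElem] at hp
    rcases lt_trichotomy (T.findIdx fun r => a ∈ r) j with hlt' | heq | hgt
    · exact absurd h (List.disjoint_left.1 (hp _ _ hlt hj hlt') hmem)
    · exact heq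
    · exact absurd hmem (List.disjoint_left.1 (hp _ _ hj hlt hgt) h)

variable {N : ℕ} {T : List (List ℕ)}

theorem nodup_getD (hT : T.flatten.Nodup) (j : ℕ) : (T.getD j []).Nodup := by
  by_cases hj : j < T.length
  · rw [List.getD_eq_getElem _ _ hj]
    exact (List.nodup_flatten.1 hT).1 _ (List.getElem_mem hj)
  · rw [List.getD_eq_default _ _ (by omega)]; exact List.nodup_nil

theorem mem_flatten_of_mem_getD {a j : ℕ} (h : a ∈ T.getD j []) : a ∈ T.flatten := by
  by_cases hj : j < T.length
  · rw [List.getD_eq_getElem _ _ hj] at h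
    exact List.mem_flatten.2 ⟨_, List.getElem_mem hj, h⟩
  · rw [List.getD_eq_default _ _ (by omega)] at h; simp at h

theorem shapeAt_rowOf (hT : T.flatten.Perm (List.range N)) {m : ℕ} (hm : m ≤ N) (j : ℕ) :
    shapeAt m (rowOf T) j = (T.getD j []).countP (· < m) := by
  have hnd : T.flatten.Nodup := hT.nodup_iff.2 List.nodup_range
  rw [shapeAt, Nat.count_eq_card_filter_range, List.countP_eq_length_filter,
    ← List.toFinset_card_of_nodup ((nodup_getD hnd j).filter _)]
  congr 1
  ext a
  simp only [Finset.mem_filter, Finset.mem_range, List.mem_toFinset, List.mem_filter,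
    decide_eq_true_eq]
  constructor
  · rintro ⟨h1, h2⟩
    exact ⟨(rowOf_eq_iff hnd (hT.mem_iff.2 (by simp; omega))).1 h2, h1⟩
  · rintro ⟨h1, h2⟩
    exact ⟨h2, (rowOf_eq_iff hnd (mem_flatten_of_mem_getD h1)).2 h1⟩

theorem rowOf_mem_paths (hT : T.flatten.Perm (List.range N)) (hc : T.IsChain Dominates) :
    rowOf T ∈ paths N := by
  refine mem_paths.2 ⟨fun m hm => antitone_nat_of_succ_le fun j => ?_, fun i hi => ?_⟩
  · rw [shapeAt_rowOf hT hm, shapeAt_rowOf hT hm]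
    exact (dominates_getD hc j).countP_le m
  · rw [rowOf, if_neg]
    rw [hT.mem_iff]
    simpa using hi

theorem shapeAt_rowOf_self (hT : T.flatten.Perm (List.range N)) :
    shapeAt N (rowOf T) = rowLen T := by
  ext j
  rw [shapeAt_rowOf hT le_rfl, rowLen, List.countP_eq_length]
  intro a ha
  have := hT.mem_iff.1 (mem_flatten_of_mem_getD ha)
  simpa using this

/-- Rows are nonempty, so the default value `[]` marks the end of the tableau. -/
theorem eq_of_getD_eq {T' : List (List ℕ)} (h : SortedRows T) (h' : SortedRows T')
    (he : ∀ j, T.getD j [] = T'.getD j []) : T = T' := by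
  have key : ∀ {T T' : List (List ℕ)}, SortedRows T → (∀ j, T.getD j [] = T'.getD j []) →
      T.length ≤ T'.length := by
    intro T T' h he
    by_contra! hlt
    have := he T'.length
    rw [List.getD_eq_getElem _ _ hlt, List.getD_eq_default _ _ le_rfl] at this
    exact (h _ (List.getElem_mem hlt)).2 this
  refine List.ext_getElem (le_antisymm (key h he) (key h' fun j => (he j).symm)) fun j h1 h2 => ?_
  rw [← List.getD_eq_getElem _ [] h1, ← List.getD_eq_getElem _ [] h2, he]

/-- The path gives the set of entries of each row, and a sorted row without repetitions is
determined by its set of entries. -/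
theorem rowOf_injective {T' : List (List ℕ)} (hT : T.flatten.Perm (List.range N))
    (hT' : T'.flatten.Perm (List.range N)) (h : SortedRows T) (h' : SortedRows T')
    (he : rowOf T = rowOf T') : T = T' := by
  have hnd : T.flatten.Nodup := hT.nodup_iff.2 List.nodup_range
  have hnd' : T'.flatten.Nodup := hT'.nodup_iff.2 List.nodup_range
  have sorted : ∀ {T : List (List ℕ)}, SortedRows T → ∀ j, (T.getD j []).Pairwise (· ≤ ·) := by
    intro T h j
    by_cases hj : j < T.length
    · rw [List.getD_eq_getElem _ _ hj]; exact (h _ (List.getElem_mem hj)).1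
    · rw [List.getD_eq_default _ _ (by omega)]; exact List.Pairwise.nil
  refine eq_of_getD_eq h h' fun j => ?_
  refine List.Perm.eq_of_pairwise (le := (· ≤ ·)) (fun a b _ _ h1 h2 => le_antisymm h1 h2)
    (sorted h j) (sorted h' j) ?_
  rw [List.perm_ext_iff_of_nodup (nodup_getD hnd j) (nodup_getD hnd' j)]
  have key : ∀ {T T' : List (List ℕ)}, T.flatten.Perm (List.range N) →
      T'.flatten.Perm (List.range N) → rowOf T = rowOf T' → ∀ a, a ∈ T.getD j [] →
      a ∈ T'.getD j [] := by
    intro T T' hT hT' he a ha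
    have h1 := (rowOf_eq_iff (hT.nodup_iff.2 List.nodup_range) (mem_flatten_of_mem_getD ha)).2 ha
    rw [he] at h1
    refine (rowOf_eq_iff (hT'.nodup_iff.2 List.nodup_range) ?_).1 h1
    exact hT'.mem_iff.2 (hT.mem_iff.1 (mem_flatten_of_mem_getD ha))
  exact fun a => ⟨key hT hT' he a, key hT' hT he.symm a⟩

end TableauPath

/-! ### Horizontal strips and skew boxes -/

section Strip

theorem shapeAt_eq_of_ne {n N x : ℕ} (hn : n ≤ N) {w : ℕ → ℕ} (h : ∀ i, n ≤ i → i < N → w i ≠ x) :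
    shapeAt N w x = shapeAt n w x := by
  induction N, hn using Nat.le_induction with
  | base => rfl
  | succ N hN ih =>
    rw [shapeAt_succ, addBox_apply, if_neg (h N hN (by omega)).symm,
      ih fun i hi hi' => h i hi (by omega)]

/-- With weakly decreasing rows, a skew shape is filled in only one order. If at a first difference
w goes to a higher row than v, then w never returns to the row v i, which ends up too short. -/
theorem path_eq_of_antitoneOn {n N : ℕ} {w v : ℕ → ℕ} (h0 : ∀ i < n, w i = v i)
    (hw : AntitoneOn w (Set.Ico n N)) (hv : AntitoneOn v (Set.Ico n N))
    (hN : shapeAt N w = shapeAt N v) : ∀ i < N, w i = v i := by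
  have key : ∀ {w v : ℕ → ℕ}, AntitoneOn w (Set.Ico n N) → shapeAt N w = shapeAt N v → ∀ i < N,
      n ≤ i → (∀ j < i, w j = v j) → v i ≤ w i := by
    intro w v hw hN i hi hni ih
    by_contra! hlt
    have h1 : shapeAt N w (v i) = shapeAt i w (v i) := by
      refine shapeAt_eq_of_ne hi.le fun j hj hj' he => ?_
      have := hw ⟨hni, hi⟩ ⟨hni.trans hj, hj'⟩ hj
      omega
    have h2 : shapeAt (i + 1) v (v i) ≤ shapeAt N v (v i) := shapeAt_mono hi v _
    rw [shapeAt_succ, addBox_apply, if_pos rfl, ← hN, h1, shapeAt_congr ih] at h2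
    omega
  intro i
  induction i using Nat.strong_induction_on with
  | _ i ih =>
    intro hi
    rcases Nat.lt_or_ge i n with h | h
    · exact h0 i h
    · exact le_antisymm (key hv hN.symm i hi h fun j hj => (ih j hj (by omega)).symm)
        (key hw hN i hi h fun j hj => ih j hj (by omega))

/-- The skew shape between `l` and `l'` is a horizontal strip. -/
def IsStrip (l l' : ℕ → ℕ) : Prop := ∀ j, l' (j + 1) ≤ l j

/-- When a box enters row j + 1, row j has not been touched since step n, as later rows are never
lower ones. -/
theorem isStrip_of_antitoneOn {n N : ℕ} (hn : n ≤ N) {w : ℕ → ℕ} (hw : w ∈ paths N)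
    (hanti : AntitoneOn w (Set.Ico n N)) : IsStrip (shapeAt n w) (shapeAt N w) := by
  intro j
  suffices H : ∀ M, n ≤ M → M ≤ N → shapeAt M w (j + 1) ≤ shapeAt n w j from H N hn le_rfl
  intro M hM
  induction M, hM using Nat.le_induction with
  | base => exact fun h => antitone_shapeAt hw h (Nat.le_succ j)
  | succ M hM ih =>
    intro hMN
    by_cases hc : w M = j + 1
    · refine (antitone_shapeAt hw hMN (Nat.le_succ j)).trans (shapeAt_eq_of_ne (by omega) ?_).le
      intro i hi hi'
      have := hanti (show i ∈ Set.Ico n N from ⟨hi, by omega⟩)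
        (show M ∈ Set.Ico n N from ⟨hM, by omega⟩) (by omega)
      omega
    · rw [shapeAt_succ, addBox_apply, if_neg (Ne.symm hc)]
      exact ih (by omega)

/-- Equality would put box i + 1 directly below box i, hence two new boxes in one column. -/
theorem IsStrip.content_ne {n N i : ℕ} {w : ℕ → ℕ} (hw : w ∈ paths N)
    (hs : IsStrip (shapeAt n w) (shapeAt N w)) (hn : n ≤ i) (hi : i + 1 < N) :
    content i w ≠ content (i + 1) w + 1 := by
  intro hc
  have hne : w i ≠ w (i + 1) := fun h => by rw [content_succ_of_eq h] at hc; omega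
  rw [content, content, shapeAt_succ, addBox_apply, if_neg hne.symm] at hc
  have h0 := antitone_shapeAt hw (m := i) (by omega)
  rcases Nat.lt_or_ge (w i) (w (i + 1)) with hlt | hge
  · have h1 := h0 hlt.le
    have hx : w (i + 1) = w i + 1 := by omega
    have h2 := hs (w i)
    have h3 : shapeAt n w (w i) ≤ shapeAt i w (w i) := shapeAt_mono hn w _
    have h4 : shapeAt (i + 2) w (w (i + 1)) ≤ shapeAt N w (w (i + 1)) := shapeAt_mono hi w _
    rw [shapeAt_succ, addBox_apply, if_pos rfl, shapeAt_succ, addBox_apply, if_neg hne.symm] at h4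
    rw [← hx] at h2
    omega
  · have h1 := h0 hge
    omega

/-- The box added at step `i`. -/
def stepBox (w : ℕ → ℕ) (i : ℕ) : ℕ × ℕ := (w i, shapeAt i w (w i))

theorem stepBox_injective (w : ℕ → ℕ) : Function.Injective (stepBox w) := by
  have key : ∀ i j, i < j → stepBox w i ≠ stepBox w j := by
    intro i j hij h
    simp only [stepBox, Prod.mk.injEq] at h
    have h1 : shapeAt (i + 1) w (w i) ≤ shapeAt j w (w i) := shapeAt_mono hij w _
    rw [shapeAt_succ, addBox_apply, if_pos rfl, h.2, h.1] at h1
    omega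
  intro i j h
  rcases lt_trichotomy i j with hl | he | hg
  · exact absurd h (key i j hl)
  · exact he
  · exact absurd h.symm (key j i hg)

theorem range_stepBox (n k : ℕ) (w : ℕ → ℕ) :
    Set.range (fun i : Fin k => stepBox w (n + i)) =
      {c | shapeAt n w c.1 ≤ c.2 ∧ c.2 < shapeAt (n + k) w c.1} := by
  ext ⟨x, y⟩
  simp only [Set.mem_range, Set.mem_ofPred_eq]
  constructor
  · rintro ⟨i, h⟩
    simp only [stepBox, Prod.mk.injEq] at h
    obtain ⟨rfl, rfl⟩ := h
    refine ⟨shapeAt_mono (by omega) _ _, ?_⟩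
    have h1 : shapeAt (n + i + 1) w (w (n + i)) ≤ shapeAt (n + k) w (w (n + i)) :=
      shapeAt_mono (by omega) _ _
    rw [shapeAt_succ, addBox_apply, if_pos rfl] at h1
    omega
  · rintro ⟨h1, h2⟩
    induction k with
    | zero => simp at h2; omega
    | succ k ih =>
      by_cases hc : y < shapeAt (n + k) w x
      · obtain ⟨i, hi⟩ := ih hc
        exact ⟨i.castSucc, hi⟩
      · refine ⟨Fin.last k, ?_⟩
        rw [← add_assoc, shapeAt_succ, addBox_apply] at h2
        split_ifs at h2 with hx
        · simp only [stepBox, Fin.val_last, hx, Prod.mk.injEq, true_and]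
          rw [hx] at hc
          omega
        · omega

theorem coe_skewBoxes {α : Type*} [LinearOrder α] (l l' : List α) :
    (skewBoxes (rskShape l) (rskShape (l ++ l')) : Set (ℕ × ℕ)) =
      {c | shapeAt l.length (recWord (l ++ l')) c.1 ≤ c.2 ∧
        c.2 < shapeAt (l.length + l'.length) (recWord (l ++ l')) c.1} := by
  have h1 := shapeAt_recWord (l ++ l') (m := l.length) (by simp)
  have h2 := shapeAt_recWord (l ++ l') (m := l.length + l'.length) (by simp)
  rw [List.take_left' rfl] at h1
  rw [List.take_of_length_le (by simp)] at h2
  ext c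
  rw [h1, h2, skewBoxes, Finset.mem_coe, Finset.mem_sdiff, mem_rskShape, mem_rskShape]
  simp only [Set.mem_ofPred_eq]
  omega

/-- Two injective enumerations of the same set differ by a permutation of the indices, which a
symmetric polynomial does not see. -/
theorem eval_eq_of_range_eq {k : ℕ} {β : Type*} {P : MvPolynomial (Fin k) ℂ} (hP : P.IsSymmetric)
    {f f' : Fin k → β} (hf : Function.Injective f) (hf' : Function.Injective f')
    (h : Set.range f = Set.range f') (g : β → ℂ) :
    MvPolynomial.eval (fun i => g (f i)) P = MvPolynomial.eval (fun i => g (f' i)) P := by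
  let e : Equiv.Perm (Fin k) :=
    (Equiv.ofInjective f hf).trans ((Equiv.setCongr h).trans (Equiv.ofInjective f' hf').symm)
  have he : ∀ i, f' (e i) = f i := fun i => by
    have := Equiv.apply_ofInjective_symm hf' (Equiv.setCongr h (Equiv.ofInjective f hf i))
    exact this
  conv_rhs => rw [← hP e, MvPolynomial.eval_rename]
  have : (fun i => g (f' i)) ∘ e = fun i => g (f i) := funext fun i => congrArg g (he i)
  rw [this]

end Strip

end PieriGrowth

namespace PieriGrowth

/-! ### The Pieri rule and the joint law of the shapes -/

section Pieri

open Equiv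

variable (n k : ℕ)

/-- The permutations of the last `k` points. -/
def tailPerm : Perm (Fin k) →* Perm (Fin (n + k)) where
  toFun h := youngEmbedding n k (1, h)
  map_one' := by
    ext x
    simp only [youngEmbedding, Equiv.permCongr_apply]
    rw [show ((1, 1) : Perm (Fin n) × Perm (Fin k)) = 1 from rfl, map_one]
    simp
  map_mul' g h := by
    have e : ((1, g * h) : Perm (Fin n) × Perm (Fin k)) = (1, g) * (1, h) := by simp
    ext x
    simp only [youngEmbedding, Equiv.permCongr_apply, e, map_mul, Perm.mul_apply, symm_apply_apply]

variable {n k}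

theorem tailPerm_castAdd (h : Perm (Fin k)) (i : Fin n) :
    tailPerm n k h (Fin.castAdd k i) = Fin.castAdd k i := by
  change youngEmbedding n k (1, h) _ = _
  simp [youngEmbedding, Equiv.permCongr_apply]

theorem tailPerm_natAdd (h : Perm (Fin k)) (i : Fin k) :
    tailPerm n k h (Fin.natAdd n i) = Fin.natAdd n (h i) := by
  change youngEmbedding n k (1, h) _ = _
  simp [youngEmbedding, Equiv.permCongr_apply]

theorem tailPerm_swap (a b : Fin k) :
    tailPerm n k (swap a b) = swap (Fin.natAdd n a) (Fin.natAdd n b) := by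
  refine Perm.ext fun x => ?_
  induction x using Fin.addCases with
  | left i =>
    rw [tailPerm_castAdd, swap_apply_of_ne_of_ne] <;>
      simp only [ne_eq, Fin.ext_iff, Fin.val_castAdd, Fin.val_natAdd] <;> omega
  | right i =>
    rw [tailPerm_natAdd, swap_apply_def, swap_apply_def]
    simp only [Fin.natAdd_inj]
    split_ifs <;> rfl

theorem seminormal_tailPerm_swap {i : ℕ} (hi : i + 1 < k) :
    seminormal (n + k) (tailPerm n k (swap ⟨i, by omega⟩ ⟨i + 1, hi⟩)) =
      seminormalGen (n + k) (n + i) := by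
  rw [tailPerm_swap, ← seminormal_swap (N := n + k) (i := n + i) (by omega)]
  rfl

variable (n k) in
/-- The projection onto the vectors invariant under the permutations of the last `k` points. -/
noncomputable def symOp : Module.End ℂ (PathSpace (n + k)) :=
  (k.factorial : ℂ)⁻¹ • ∑ h : Perm (Fin k), seminormal (n + k) (tailPerm n k h)

theorem seminormal_mul_symOp (g : Perm (Fin k)) :
    seminormal (n + k) (tailPerm n k g) * symOp n k = symOp n k := by
  rw [symOp, mul_smul_comm, Finset.mul_sum]
  congr 1
  refine Fintype.sum_equiv (Equiv.mulLeft g) _ _ fun h => ?_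
  rw [← map_mul, ← map_mul]
  rfl

theorem sum_smul_factorial {M : Type*} [AddCommGroup M] [Module ℂ M] (x : M) :
    (k.factorial : ℂ)⁻¹ • ∑ _h : Perm (Fin k), x = x := by
  have h0 : (k.factorial : ℂ) ≠ 0 := by exact_mod_cast k.factorial_ne_zero
  rw [Finset.sum_const, Finset.card_univ, Fintype.card_perm, Fintype.card_fin,
    ← Nat.cast_smul_eq_nsmul ℂ, smul_smul, inv_mul_cancel₀ h0, one_smul]

theorem isIdempotentElem_symOp : IsIdempotentElem (symOp n k) := by
  have h : symOp n k * symOp n k = (k.factorial : ℂ)⁻¹ •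
      ∑ h : Perm (Fin k), seminormal (n + k) (tailPerm n k h) * symOp n k := by
    conv_lhs => enter [1]; rw [symOp]
    rw [smul_mul_assoc, Finset.sum_mul]
  rw [IsIdempotentElem, h]
  simp only [seminormal_mul_symOp]
  exact sum_smul_factorial _

theorem commute_mulPath_symOp {g : (ℕ → ℕ) → ℂ}
    (hg : ∀ i w, n ≤ i → i + 1 < n + k → g (swapStep i w) = g w) :
    Commute (mulPath g) (symOp n k) := by
  suffices H : ∀ h, Commute (mulPath g) (seminormal (n + k) (tailPerm n k h)) from
    Commute.smul_right (Commute.sum_right _ _ _ fun h _ => H h) _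
  intro h
  induction h using perm_fin_induction with
  | one => rw [map_one, map_one]; exact Commute.one_right _
  | mul i hi σ ih =>
    rw [map_mul, map_mul, seminormal_tailPerm_swap hi]
    exact Commute.mul_right (commute_mulPath_seminormalGen fun w => hg _ w (by omega) (by omega)) ih

variable (n k) in
/-- The first `n` steps of a path together with its final shape. -/
def pathKey (w : ℕ → ℕ) : (ℕ → ℕ) × (ℕ → ℕ) :=
  (fun i => if i < n then w i else 0, shapeAt (n + k) w)

theorem pathKey_eq_iff {w v : ℕ → ℕ} : pathKey n k w = pathKey n k v ↔
    (∀ i < n, w i = v i) ∧ shapeAt (n + k) w = shapeAt (n + k) v := by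
  simp only [pathKey, Prod.mk.injEq]
  refine and_congr_left fun _ => ⟨fun h i hi => ?_, fun h => funext fun i => ?_⟩
  · simpa [hi] using congrFun h i
  · split_ifs with hi
    · exact h i hi
    · rfl

theorem pathKey_swapStep {i : ℕ} (hi : n ≤ i) (hi' : i + 1 < n + k) (w : ℕ → ℕ) :
    pathKey n k (swapStep i w) = pathKey n k w :=
  pathKey_eq_iff.2 ⟨fun _ _ => swapStep_of_ne (by omega) (by omega) w,
    shapeAt_swapStep_of_gt hi' w⟩

open Classical in
/-- The indicator function of the paths with a given key. -/
noncomputable def keyInd (n k : ℕ) (κ : (ℕ → ℕ) × (ℕ → ℕ)) (w : ℕ → ℕ) : ℂ :=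
  if pathKey n k w = κ then 1 else 0

theorem keyInd_swapStep {κ : (ℕ → ℕ) × (ℕ → ℕ)} {i : ℕ} (hi : n ≤ i) (hi' : i + 1 < n + k)
    (w : ℕ → ℕ) : keyInd n k κ (swapStep i w) = keyInd n k κ w := by
  rw [keyInd, keyInd, pathKey_swapStep hi hi']

/-- The multiplicity of the invariant vectors in the block of a key. -/
noncomputable def keyRank (n k : ℕ) (κ : (ℕ → ℕ) × (ℕ → ℕ)) : ℕ :=
  Module.finrank ℂ (symOp n k * mulPath (keyInd n k κ)).range

theorem isIdempotentElem_symOp_mul (κ : (ℕ → ℕ) × (ℕ → ℕ)) :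
    IsIdempotentElem (symOp n k * mulPath (keyInd n k κ)) := by
  refine IsIdempotentElem.mul_of_commute (commute_mulPath_symOp fun i w hi hi' =>
    keyInd_swapStep hi hi' w).symm isIdempotentElem_symOp ?_
  rw [IsIdempotentElem, mulPath_mul_mulPath]
  congr 1
  ext w
  rw [keyInd]
  split_ifs <;> simp

/-- The trace of a projection is its rank. That it is a natural number matters: positive then means
at least 1. -/
theorem trace_symOp_mul (κ : (ℕ → ℕ) × (ℕ → ℕ)) :
    LinearMap.trace ℂ _ (symOp n k * mulPath (keyInd n k κ)) = keyRank n k κ :=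
  (LinearMap.IsIdempotentElem.isProj_range _ (isIdempotentElem_symOp_mul κ)).trace

/-- In this normalization of the seminormal form, the indicator of the whole key block is itself an
invariant vector when the skew shape is a horizontal strip. -/
theorem keyRank_pos {w : ℕ → ℕ} (hw : w ∈ paths (n + k))
    (hs : IsStrip (shapeAt n w) (shapeAt (n + k) w)) : 0 < keyRank n k (pathKey n k w) := by
  set φ : PathSpace (n + k) := fun v => keyInd n k (pathKey n k w) v with hφ
  have hgen : ∀ i, n ≤ i → i + 1 < n + k → seminormalGen (n + k) i φ = φ := by
    intro i hi hi'
    ext v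
    have hext : ∀ u ∈ paths (n + k), extendPath φ u = keyInd n k (pathKey n k w) u :=
      fun u hu => extendPath_coe φ ⟨u, hu⟩
    rw [seminormalGen_apply, seminormalOp_congr hi' hext v.2, seminormalOp,
      keyInd_swapStep hi hi']
    by_cases hv : pathKey n k v.1 = pathKey n k w
    · have hv' := pathKey_eq_iff.1 hv
      have hs' : IsStrip (shapeAt n v.1) (shapeAt (n + k) v.1) := by
        rw [hv'.2, shapeAt_congr hv'.1]; exact hs
      have hc := hs'.content_ne v.2 hi hi'
      -- The two coefficients add up to 1 except for vertically adjacent boxes, where the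
      -- off-diagonal one was set to zero and -1 remains; a strip has no such boxes.
      have h1 : diagCoeff (content i v.1) (content (i + 1) v.1) +
          offCoeff (content i v.1) (content (i + 1) v.1) = 1 := by
        rw [offCoeff]
        split_ifs with h
        · rw [h.resolve_right hc, diagCoeff]; simp
        · ring
      rw [← add_mul, h1, one_mul]
    · simp [hφ, keyInd, hv]
  have hinv : ∀ h : Perm (Fin k), seminormal (n + k) (tailPerm n k h) φ = φ := by
    intro h
    induction h using perm_fin_induction with
    | one => simp
    | mul i hi σ ih =>
      rw [map_mul, map_mul, seminormal_tailPerm_swap hi, Module.End.mul_apply, ih]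
      exact hgen _ (by omega) (by omega)
  have hsym : symOp n k φ = φ := by
    rw [symOp, LinearMap.smul_apply, LinearMap.sum_apply]
    simp only [hinv]
    exact sum_smul_factorial φ
  have hmul : mulPath (keyInd n k (pathKey n k w)) φ = φ := by
    ext v
    rw [mulPath_apply, hφ]
    simp only [keyInd]
    split_ifs <;> simp
  have hne : φ ≠ 0 := fun h => by
    have := congrFun h ⟨w, hw⟩
    simp [hφ, keyInd] at this
  rw [keyRank, Module.finrank_pos_iff_exists_ne_zero]
  refine ⟨⟨φ, φ, ?_⟩, fun h => hne (congrArg Subtype.val h)⟩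
  rw [Module.End.mul_apply, hmul, hsym]

/-- The word of a permutation. -/
def permWord {N : ℕ} (σ : Perm (Fin N)) : List ℕ := List.ofFn fun i => (σ i : ℕ)

theorem length_permWord {N : ℕ} (σ : Perm (Fin N)) : (permWord σ).length = N := by simp [permWord]

theorem permWord_injective {N : ℕ} : Function.Injective (permWord (N := N)) := fun σ τ h => by
  have := List.ofFn_injective h
  exact Perm.ext fun i => Fin.ext (congrFun this i)

theorem permWord_perm {N : ℕ} (σ : Perm (Fin N)) : (permWord σ).Perm (List.range N) := by
  have h : (permWord σ).Nodup := List.nodup_ofFn.2 fun i j h => σ.injective (Fin.ext h)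
  rw [List.perm_ext_iff_of_nodup h List.nodup_range]
  intro a
  simp only [permWord, List.mem_ofFn, List.mem_range]
  constructor
  · rintro ⟨i, rfl⟩; exact (σ i).2
  · intro ha
    exact ⟨σ⁻¹ ⟨a, ha⟩, by simp⟩

/-- The recording path of a permutation. -/
def recPath {N : ℕ} (σ : Perm (Fin N)) : ℕ → ℕ := recWord (permWord σ)

theorem recPath_mem_paths {N : ℕ} (σ : Perm (Fin N)) : recPath σ ∈ paths N := by
  have := recWord_mem_paths (permWord σ)
  rwa [length_permWord] at this

/-- The permutations that are increasing on the last `k` points. -/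
abbrev TailIncreasing (n k : ℕ) (σ : Perm (Fin (n + k))) : Prop :=
  StrictMono fun i : Fin k => σ (Fin.natAdd n i)

theorem TailIncreasing.antitoneOn_recPath {σ : Perm (Fin (n + k))} (hσ : TailIncreasing n k σ) :
    AntitoneOn (recPath σ) (Set.Ico n (n + k)) := by
  have hstep : ∀ i, n ≤ i → i + 1 < n + k → recPath σ (i + 1) ≤ recPath σ i := by
    intro i hi hi'
    refine recWord_succ_le (by rw [length_permWord]; exact hi') ?_
    simp only [permWord, List.getElem_ofFn]
    have := hσ (show (⟨i - n, by omega⟩ : Fin k) < ⟨i + 1 - n, by omega⟩ by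
      simp only [Fin.mk_lt_mk]; omega)
    have e1 : Fin.natAdd n (⟨i - n, by omega⟩ : Fin k) = ⟨i, by omega⟩ := Fin.ext (by simp; omega)
    have e2 : Fin.natAdd n (⟨i + 1 - n, by omega⟩ : Fin k) = ⟨i + 1, by omega⟩ :=
      Fin.ext (by simp; omega)
    simp only [e1, e2] at this
    exact this.le
  intro i hi j hj hij
  have hj' : j < n + k := hj.2
  induction j, hij using Nat.le_induction with
  | base => exact le_rfl
  | succ j hij ih =>
    have hni : n ≤ i := hi.1
    exact (hstep j (by omega) hj').trans (ih ⟨by omega, by omega⟩ (by omega))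

open Classical in
/-- The number of tail increasing permutations whose recording path has a given key. -/
noncomputable def keyCount (n k : ℕ) (κ : (ℕ → ℕ) × (ℕ → ℕ)) : ℕ :=
  (Finset.univ.filter fun σ : Perm (Fin (n + k)) =>
    TailIncreasing n k σ ∧ pathKey n k (recPath σ) = κ).card

-- σ is sent to the path of its insertion tableau. Given the key, the recording path is forced by
-- `path_eq_of_antitoneOn`, so injectivity of Robinson–Schensted makes this map injective.
open Classical in
theorem keyCount_le_numPaths (κ : (ℕ → ℕ) × (ℕ → ℕ)) :
    keyCount n k κ ≤ numPaths (n + k) κ.2 := by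
  have hflat : ∀ σ : Perm (Fin (n + k)),
      (insertionTableau (permWord σ)).flatten.Perm (List.range (n + k)) := fun σ =>
    (flatten_insertionTableau_perm _).trans (permWord_perm σ)
  refine Finset.card_le_card_of_injOn (fun σ => rowOf (insertionTableau (permWord σ))) ?_ ?_
  · intro σ hσ
    simp only [Finset.coe_filter, Finset.mem_univ, true_and, Set.mem_ofPred_eq] at hσ ⊢
    refine ⟨rowOf_mem_paths (hflat σ) (isChain_insertionTableau _), ?_⟩
    rw [shapeAt_rowOf_self (hflat σ), ← hσ.2]
    have := shapeAt_recWord (permWord σ) le_rfl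
    rw [List.take_length, length_permWord] at this
    exact this.symm
  · intro σ hσ τ hτ h
    simp only [Finset.coe_filter, Finset.mem_univ, true_and, Set.mem_ofPred_eq] at hσ hτ
    have hT := rowOf_injective (hflat σ) (hflat τ) (sortedRows_insertionTableau _)
      (sortedRows_insertionTableau _) h
    have hkey := pathKey_eq_iff.1 (hσ.2.trans hτ.2.symm)
    have hw := path_eq_of_antitoneOn hkey.1 hσ.1.antitoneOn_recPath hτ.1.antitoneOn_recPath hkey.2
    refine permWord_injective (insertionTableau_injective (by simp [length_permWord]) hT ?_)
    ext i
    rcases Nat.lt_or_ge i (n + k) with hi | hi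
    · exact hw i hi
    · rw [(mem_paths.1 (recPath_mem_paths σ)).2 i hi |> (show recWord (permWord σ) i = 0 from ·),
        (mem_paths.1 (recPath_mem_paths τ)).2 i hi |> (show recWord (permWord τ) i = 0 from ·)]

/-- A key that is attained at all comes from a horizontal strip, so its rank is at least 1. -/
theorem keyCount_le (κ : (ℕ → ℕ) × (ℕ → ℕ)) :
    keyCount n k κ ≤ numPaths (n + k) κ.2 * keyRank n k κ := by
  rcases Nat.eq_zero_or_pos (keyCount n k κ) with h | h
  · omega
  · obtain ⟨σ, hσ⟩ := Finset.card_pos.1 h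
    simp only [Finset.mem_filter, Finset.mem_univ, true_and] at hσ
    have := keyRank_pos (recPath_mem_paths σ)
      (isStrip_of_antitoneOn (by omega) (recPath_mem_paths σ) hσ.1.antitoneOn_recPath)
    rw [hσ.2] at this
    exact (keyCount_le_numPaths κ).trans (Nat.le_mul_of_pos_right _ this)

theorem dimTrace_smul {N : ℕ} (c : ℂ) (A : Module.End ℂ (PathSpace N)) :
    dimTrace (c • A) = c * dimTrace A := by
  rw [dimTrace, mul_smul_comm, map_smul, smul_eq_mul, dimTrace]

theorem tailPerm_injective : Function.Injective (tailPerm n k) := fun g h e => by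
  ext i
  have := congrArg (fun f => f (Fin.natAdd n i)) e
  simp only [tailPerm_natAdd, Fin.natAdd_inj] at this
  exact congrArg Fin.val this

/-- Among the permutations averaged in the projection, only the identity has nonzero weighted trace.
-/
theorem dimTrace_symOp : (k.factorial : ℂ) * dimTrace (symOp n k) = (n + k).factorial := by
  have h0 : (k.factorial : ℂ) ≠ 0 := by exact_mod_cast k.factorial_ne_zero
  rw [symOp, dimTrace_smul, mul_inv_cancel_left₀ h0, dimTrace_sum]
  simp only [dimTrace_seminormal]
  rw [Finset.sum_eq_single 1]
  · simp
  · intro h _ hne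
    rw [if_neg]
    rw [← map_one (tailPerm n k)]
    exact fun e => hne (tailPerm_injective e)
  · simp

open Classical in
variable (n k) in
/-- The keys of all paths. -/
noncomputable def pathKeys : Finset ((ℕ → ℕ) × (ℕ → ℕ)) := (paths (n + k)).image (pathKey n k)

open Classical in
theorem dimTrace_symOp_mul (Γ : (ℕ → ℕ) × (ℕ → ℕ) → ℂ) :
    dimTrace (symOp n k * mulPath fun w => Γ (pathKey n k w)) =
      ∑ κ ∈ pathKeys n k, ((numPaths (n + k) κ.2 * keyRank n k κ : ℕ) : ℂ) * Γ κ := by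
  have h1 : ∀ κ, ((numPaths (n + k) κ.2 * keyRank n k κ : ℕ) : ℂ) * Γ κ =
      ∑ w : paths (n + k), if pathKey n k w.1 = κ then
        (numPaths (n + k) (shapeAt (n + k) w.1) : ℂ) * Γ (pathKey n k w.1) *
          symOp n k (Pi.single w 1) w else 0 := fun κ => by
    rw [Nat.cast_mul, ← trace_symOp_mul, trace_mul_mulPath, Finset.mul_sum, Finset.sum_mul]
    refine Finset.sum_congr rfl fun w _ => ?_
    rw [keyInd]
    split_ifs with h
    · rw [← h]
      change (numPaths (n + k) (shapeAt (n + k) w.1) : ℂ) * _ * _ = _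
      ring
    · simp
  rw [Finset.sum_congr rfl fun κ _ => h1 κ, Finset.sum_comm, dimTrace, ← mul_assoc,
    trace_mul_mulPath]
  refine Finset.sum_congr rfl fun w _ => ?_
  rw [Finset.sum_ite_eq,
    if_pos (show pathKey n k w.1 ∈ pathKeys n k from Finset.mem_image_of_mem _ w.2)]
  change Γ (pathKey n k w.1) * (_ * symOp n k (Pi.single w 1) w) = _
  ring

-- Sorting the last k values writes every permutation as a tail-increasing one times a permutation
-- of the tail. This inequality suffices; equality follows later from the count by keys.
open Classical in
theorem factorial_le_mul_card : (n + k).factorial ≤ k.factorial *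
    (Finset.univ.filter fun σ : Perm (Fin (n + k)) => TailIncreasing n k σ).card := by
  have hsurj : Function.Surjective fun p : Perm (Fin k) ×
      {σ : Perm (Fin (n + k)) // TailIncreasing n k σ} => p.2.1 * tailPerm n k p.1 := by
    intro σ
    set f : Fin k → Fin (n + k) := fun i => σ (Fin.natAdd n i) with hf
    have hinj : Function.Injective f := fun i j h => by
      have := σ.injective h
      simpa using this
    refine ⟨((Tuple.sort f)⁻¹, ⟨σ * tailPerm n k (Tuple.sort f), ?_⟩), ?_⟩
    · have h1 : StrictMono (f ∘ Tuple.sort f) :=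
        (Tuple.monotone_sort f).strictMono_of_injective (hinj.comp (Tuple.sort f).injective)
      intro i j hij
      have := h1 hij
      simpa [hf, tailPerm_natAdd] using this
    · simp only [map_inv, mul_inv_cancel_right]
  have := Fintype.card_le_of_surjective _ hsurj
  rw [Fintype.card_prod, Fintype.card_perm, Fintype.card_perm, Fintype.card_fin, Fintype.card_fin,
    Fintype.card_subtype] at this
  exact this

theorem sum_keyCount : ∑ κ ∈ pathKeys n k, keyCount n k κ =
    (Finset.univ.filter fun σ : Perm (Fin (n + k)) => TailIncreasing n k σ).card := by
  classical
  rw [Finset.card_eq_sum_card_fiberwise (t := pathKeys n k) (f := fun σ => pathKey n k (recPath σ))]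
  · refine Finset.sum_congr rfl fun κ _ => ?_
    rw [keyCount, Finset.filter_filter]
  · intro σ _
    exact Finset.mem_image_of_mem _ (recPath_mem_paths σ)

theorem factorial_mul_sum_keyRank :
    k.factorial * ∑ κ ∈ pathKeys n k, numPaths (n + k) κ.2 * keyRank n k κ =
      (n + k).factorial := by
  have h := dimTrace_symOp_mul (n := n) (k := k) fun _ => 1
  have e : (mulPath fun _ => 1 : Module.End ℂ (PathSpace (n + k))) = 1 := by
    apply LinearMap.ext; intro φ; ext1 w
    rw [mulPath_apply, one_mul]; rfl
  rw [e, mul_one] at h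
  have h2 := dimTrace_symOp (n := n) (k := k)
  rw [h] at h2
  simp only [mul_one] at h2
  exact_mod_cast h2

/-- The joint law of the growth pair. -/
theorem keyCount_eq {κ : (ℕ → ℕ) × (ℕ → ℕ)} (hκ : κ ∈ pathKeys n k) :
    keyCount n k κ = numPaths (n + k) κ.2 * keyRank n k κ := by
  have h1 := factorial_le_mul_card (n := n) (k := k)
  have h2 := factorial_mul_sum_keyRank (n := n) (k := k)
  have h3 : ∑ κ ∈ pathKeys n k, keyCount n k κ ≤
      ∑ κ ∈ pathKeys n k, numPaths (n + k) κ.2 * keyRank n k κ :=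
    Finset.sum_le_sum fun κ _ => keyCount_le κ
  have h4 : ∑ κ ∈ pathKeys n k, numPaths (n + k) κ.2 * keyRank n k κ ≤
      ∑ κ ∈ pathKeys n k, keyCount n k κ := by
    refine le_of_mul_le_mul_left (a := k.factorial) ?_ k.factorial_pos
    rw [h2, sum_keyCount]
    convert h1
  -- Termwise inequalities whose totals coincide are equalities.
  exact (Finset.sum_eq_sum_iff_of_le fun κ _ => keyCount_le κ).1 (le_antisymm h3 h4) κ hκ

open Classical in
theorem factorial_mul_card_tailIncreasing : k.factorial *
    (Finset.univ.filter fun σ : Perm (Fin (n + k)) => TailIncreasing n k σ).card =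
      (n + k).factorial := by
  rw [← factorial_mul_sum_keyRank, ← Finset.sum_congr rfl fun κ hκ => keyCount_eq hκ, sum_keyCount]

open Classical in
theorem sum_tailIncreasing (Γ : (ℕ → ℕ) × (ℕ → ℕ) → ℂ) :
    ∑ σ : Perm (Fin (n + k)) with TailIncreasing n k σ, Γ (pathKey n k (recPath σ)) =
      dimTrace (symOp n k * mulPath fun w => Γ (pathKey n k w)) := by
  rw [dimTrace_symOp_mul, ← Finset.sum_fiberwise_of_maps_to (t := pathKeys n k)
    (g := fun σ => pathKey n k (recPath σ))
    fun σ _ => Finset.mem_image_of_mem _ (recPath_mem_paths σ)]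
  refine Finset.sum_congr rfl fun κ hκ => ?_
  rw [← keyCount_eq hκ, keyCount, ← nsmul_eq_mul, ← Finset.sum_const, Finset.filter_filter]
  refine Finset.sum_congr rfl fun σ hσ => ?_
  rw [(Finset.mem_filter.1 hσ).2.2]

end Pieri

end PieriGrowth

namespace PieriGrowth

/-! ### Characters of the Jucys–Murphy elements -/

section Characters

open Equiv

theorem chiReg_apply {G : Type*} [Group G] [Fintype G] [DecidableEq G] (g : G) :
    chiReg G g = if g = 1 then 1 else 0 := by
  have hfin : Module.finrank ℂ (MonoidAlgebra ℂ G) = Fintype.card G :=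
    Module.finrank_eq_card_basis (MonoidAlgebra.basis G ℂ)
  have hchar : (Representation.leftRegular ℂ G).character g =
      if g = 1 then (Fintype.card G : ℂ) else 0 := by
    rw [Representation.character, LinearMap.trace_eq_matrix_trace ℂ (MonoidAlgebra.basis G ℂ),
      Matrix.trace]
    have h : ∀ x : G, (LinearMap.toMatrix (MonoidAlgebra.basis G ℂ) (MonoidAlgebra.basis G ℂ)
        (Representation.leftRegular ℂ G g)).diag x = if g = 1 then 1 else 0 := fun x => by
      rw [Matrix.diag_apply, LinearMap.toMatrix_apply, MonoidAlgebra.basis_apply,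
        Representation.ofMulAction_single]
      change (MonoidAlgebra.single (g • x) (1 : ℂ)).coeff x = _
      rw [MonoidAlgebra.coeff_single, Finsupp.single_apply]
      simp
    rw [Finset.sum_congr rfl fun x _ => h x, Finset.sum_const, Finset.card_univ]
    split_ifs <;> simp
  have h0 : (Fintype.card G : ℂ) ≠ 0 := by exact_mod_cast Fintype.card_ne_zero
  rw [chiReg, normalizedCharacter, hchar, hfin]
  split_ifs
  · exact div_self h0
  · exact zero_div _

theorem chiTriv_apply {G : Type*} [Group G] (g : G) : chiTriv G g = 1 := by
  have : Representation.trivial ℂ G ℂ g = (1 : Module.End ℂ ℂ) := rfl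
  rw [chiTriv, normalizedCharacter, Representation.character, this, LinearMap.trace_one]
  simp

variable {n k : ℕ}

/-- The regular character forces the first factor to be the identity, and the trivial character is
1; no 1/k! appears, since the linear extension is an unnormalized sum. -/
theorem charApply_restrictYoung (F : MonoidAlgebra ℂ (Perm (Fin (n + k)))) :
    charApply (tensorChar (chiReg (Perm (Fin n))) (chiTriv (Perm (Fin k)))) (restrictYoung F) =
      ∑ h : Perm (Fin k), F.coeff (tailPerm n k h) := by
  rw [charApply, Fintype.sum_prod_type, Finset.sum_eq_single 1]
  · refine Finset.sum_congr rfl fun h _ => ?_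
    rw [tensorChar, chiReg_apply, chiTriv_apply, if_pos rfl, mul_one, mul_one]
    rfl
  · intro g _ hg
    refine Finset.sum_eq_zero fun h _ => ?_
    rw [tensorChar, chiReg_apply, if_neg hg, zero_mul, mul_zero]
  · simp

/-- The action of the group algebra on functions on paths. -/
noncomputable def seminormalAlg (N : ℕ) :
    MonoidAlgebra ℂ (Perm (Fin N)) →ₐ[ℂ] Module.End ℂ (PathSpace N) :=
  MonoidAlgebra.lift ℂ _ _ (seminormal N)

theorem seminormalAlg_jucysMurphy {N : ℕ} (i : Fin N) :
    seminormalAlg N (jucysMurphy i) = mulPath fun w => (content i w : ℂ) := by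
  rw [jucysMurphy, map_sum, ← sum_seminormal_swap i i.2]
  refine Finset.sum_congr rfl fun j _ => ?_
  rw [seminormalAlg, MonoidAlgebra.lift_of]

variable (N : ℕ) in
/-- Multiplication operators form a commutative algebra. -/
def mulPathHom : ((ℕ → ℕ) → ℂ) →+* Module.End ℂ (PathSpace N) where
  toFun := mulPath
  map_one' := by apply LinearMap.ext; intro φ; ext1 w; simp [mulPath_apply]
  map_mul' g h := (mulPath_mul_mulPath g h).symm
  map_zero' := by apply LinearMap.ext; intro φ; ext1 w; simp [mulPath_apply]
  map_add' g h := by apply LinearMap.ext; intro φ; ext1 w; simp [mulPath_apply, add_mul]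

theorem mulPathHom_apply {N : ℕ} (g : (ℕ → ℕ) → ℂ) : mulPathHom N g = mulPath g := rfl

theorem mulPathHom_smul {N : ℕ} (c : ℂ) (g : (ℕ → ℕ) → ℂ) :
    mulPathHom N (c • g) = c • mulPathHom N g := by
  apply LinearMap.ext; intro φ; ext1 w
  simp [mulPathHom_apply, mulPath_apply, mul_assoc]

/-- The contents commute pointwise, so the noncommutative products are computed in the ring of
functions and carried over by `mulPathHom`. -/
theorem seminormalAlg_evalJucysMurphy (P : MvPolynomial (Fin k) ℂ) :
    seminormalAlg (n + k) (evalJucysMurphy n P) =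
      mulPath fun w => MvPolynomial.eval (fun i : Fin k => (content (n + i) w : ℂ)) P := by
  have key : ∀ (m : Fin k →₀ ℕ) (hc : ((Finset.univ : Finset (Fin k)) : Set (Fin k)).Pairwise
      (Function.onFun Commute fun i => jucysMurphy (Fin.natAdd n i) ^ m i)),
      seminormalAlg (n + k) (Finset.univ.noncommProd
        (fun i : Fin k => jucysMurphy (Fin.natAdd n i) ^ m i) hc) =
      mulPathHom (n + k) (∏ i : Fin k, (fun w => (content (n + i) w : ℂ)) ^ m i) := fun m hc => by
    rw [← Finset.noncommProd_eq_prod]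
    refine (Finset.map_noncommProd _ _ hc (seminormalAlg (n + k))).trans
      ((Finset.noncommProd_congr rfl (fun i _ => ?_) _).trans
        (Finset.map_noncommProd _ _ _ (mulPathHom (n + k))).symm)
    rw [map_pow, map_pow, seminormalAlg_jucysMurphy]
    rfl
  rw [evalJucysMurphy, evalCommuting, map_sum]
  refine (Finset.sum_congr rfl fun m _ => (map_smul (seminormalAlg (n + k)) _ _).trans
    ((congrArg _ (key m _)).trans (mulPathHom_smul _ _).symm)).trans ?_
  rw [← map_sum, mulPathHom_apply]
  congr 1
  ext w
  rw [MvPolynomial.eval_eq']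
  simp [Finset.prod_apply]

/-- Fourier inversion: the weighted trace extracts the coefficient of the identity, up to the factor
N!. -/
theorem dimTrace_seminormalAlg {N : ℕ} (σ : Perm (Fin N)) (F : MonoidAlgebra ℂ (Perm (Fin N))) :
    dimTrace (seminormal N σ * seminormalAlg N F) = N.factorial * F.coeff σ⁻¹ := by
  rw [seminormalAlg, MonoidAlgebra.lift_apply,
    Finsupp.sum_fintype _ (fun τ b => b • seminormal N τ) (fun _ => zero_smul ℂ _), Finset.mul_sum, dimTrace_sum,
    Finset.sum_eq_single σ⁻¹]
  · rw [mul_smul_comm, dimTrace_smul, ← map_mul, dimTrace_seminormal, if_pos (mul_inv_cancel σ),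
      mul_comm]
  · intro τ _ hτ
    rw [mul_smul_comm, dimTrace_smul, ← map_mul, dimTrace_seminormal, if_neg, mul_zero]
    exact fun h => hτ (eq_inv_of_mul_eq_one_right h)
  · simp

theorem dimTrace_symOp_mul_seminormalAlg (F : MonoidAlgebra ℂ (Perm (Fin (n + k)))) :
    k.factorial * dimTrace (symOp n k * seminormalAlg (n + k) F) =
      (n + k).factorial * ∑ h : Perm (Fin k), F.coeff (tailPerm n k h) := by
  have h0 : (k.factorial : ℂ) ≠ 0 := by exact_mod_cast k.factorial_ne_zero
  rw [symOp, smul_mul_assoc, dimTrace_smul, mul_inv_cancel_left₀ h0, Finset.sum_mul, dimTrace_sum,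
    Finset.mul_sum]
  -- The trace against h gives the coefficient at h⁻¹, hence the reindexing by inversion.
  refine Fintype.sum_equiv (Equiv.inv _) _ _ fun h => ?_
  rw [dimTrace_seminormalAlg, Equiv.inv_apply, map_inv (tailPerm n k)]

open Classical in
/-- The character formula for the average over the tail increasing permutations. -/
theorem sum_tailIncreasing_eval {P : MvPolynomial (Fin k) ℂ} (hP : P.IsSymmetric) :
    ∑ σ : Perm (Fin (n + k)) with TailIncreasing n k σ,
      MvPolynomial.eval (fun i : Fin k => (content (n + i) (recPath σ) : ℂ)) P =
    (Finset.univ.filter fun σ : Perm (Fin (n + k)) => TailIncreasing n k σ).card *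
      charApply (tensorChar (chiReg (Perm (Fin n))) (chiTriv (Perm (Fin k))))
        (restrictYoung (evalJucysMurphy n P)) := by
  let G : (ℕ → ℕ) → ℂ := fun w => MvPolynomial.eval (fun i : Fin k => (content (n + i) w : ℂ)) P
  -- The key determines the set of the last k boxes, and P is symmetric in their contents.
  have hG : ∀ w v, pathKey n k w = pathKey n k v → G w = G v := fun w v h => by
    rw [pathKey_eq_iff] at h
    refine eval_eq_of_range_eq hP (f := fun i : Fin k => stepBox w (n + i))
      (f' := fun i : Fin k => stepBox v (n + i)) (fun i j hij => ?_) (fun i j hij => ?_) ?_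
      (fun c => (uCoord c : ℂ))
    · have := stepBox_injective w hij
      exact Fin.ext (by omega)
    · have := stepBox_injective v hij
      exact Fin.ext (by omega)
    · rw [range_stepBox, range_stepBox, h.2, shapeAt_congr h.1]
  let Γ : (ℕ → ℕ) × (ℕ → ℕ) → ℂ := fun κ => if h : ∃ w, pathKey n k w = κ then G h.choose else 0
  have hΓ : ∀ w, Γ (pathKey n k w) = G w := fun w => by
    have h : ∃ v, pathKey n k v = pathKey n k w := ⟨w, rfl⟩
    simp only [Γ]
    rw [dif_pos h]
    exact hG _ _ h.choose_spec
  have h1 := sum_tailIncreasing (n := n) (k := k) Γ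
  simp only [hΓ] at h1
  have h2 := dimTrace_symOp_mul_seminormalAlg (evalJucysMurphy n P)
  rw [seminormalAlg_evalJucysMurphy, ← charApply_restrictYoung] at h2
  have h3 := factorial_mul_card_tailIncreasing (n := n) (k := k)
  have h0 : (k.factorial : ℂ) ≠ 0 := by exact_mod_cast k.factorial_ne_zero
  refine mul_left_cancel₀ h0 ?_
  rw [h1, ← mul_assoc, ← Nat.cast_mul, h3]
  exact h2

end Characters

end PieriGrowth

namespace PieriGrowth

/-! ### The relative order of the sample -/

section Probability

open Equiv

variable {n k N : ℕ}

/-- The points of the cube whose coordinates are ordered as the values of `σ`. -/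
def orderCell (σ : Perm (Fin N)) : Set (Fin N → ℝ) :=
  {z | (∀ i, z i ∈ Set.Icc (0 : ℝ) 1) ∧ StrictMono (z ∘ (σ⁻¹ : Perm (Fin N)))}

theorem measurableSet_strictMono : MeasurableSet {z : Fin N → ℝ | StrictMono z} := by
  have : {z : Fin N → ℝ | StrictMono z} = ⋂ i, ⋂ j, ⋂ (_ : i < j), {z | z i < z j} := by
    ext z
    simp [StrictMono]
  rw [this]
  exact MeasurableSet.iInter fun i => MeasurableSet.iInter fun j => MeasurableSet.iInter fun _ =>
    measurableSet_lt (measurable_pi_apply i) (measurable_pi_apply j)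

theorem setOf_cube_eq : {z : Fin N → ℝ | ∀ i, z i ∈ Set.Icc (0 : ℝ) 1} =
    Set.pi Set.univ fun _ => Set.Icc (0 : ℝ) 1 := by
  ext z
  simp only [Set.mem_ofPred_eq, Set.mem_pi, Set.mem_univ, true_imp_iff]

theorem measurableSet_cube : MeasurableSet {z : Fin N → ℝ | ∀ i, z i ∈ Set.Icc (0 : ℝ) 1} := by
  rw [setOf_cube_eq]
  exact MeasurableSet.univ_pi fun _ => measurableSet_Icc

theorem measurePreserving_comp_perm (σ : Perm (Fin N)) :
    MeasurePreserving (fun z : Fin N → ℝ => z ∘ σ) volume volume := by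
  have h := volume_measurePreserving_piCongrLeft (fun _ : Fin N => ℝ) σ⁻¹
  convert h using 1
  ext z i
  have := MeasurableEquiv.piCongrLeft_apply_apply (β := fun _ : Fin N => ℝ) (σ⁻¹) z (σ i)
  simpa using this.symm

theorem orderCell_eq_preimage (σ : Perm (Fin N)) :
    orderCell σ = (fun z : Fin N → ℝ => z ∘ (σ⁻¹ : Perm (Fin N))) ⁻¹' orderCell 1 := by
  ext z
  simp only [orderCell, Set.mem_preimage, Set.mem_ofPred_eq, inv_one, Perm.coe_one,
    Function.comp_id]
  refine and_congr_left fun _ => ⟨fun h i => h _, fun h i => ?_⟩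
  simpa using h (σ i)

theorem measurableSet_orderCell (σ : Perm (Fin N)) : MeasurableSet (orderCell σ) := by
  have h1 : MeasurableSet (orderCell (1 : Perm (Fin N))) := by
    have := (measurableSet_cube (N := N)).inter measurableSet_strictMono
    convert this using 1
    ext z
    simp only [orderCell, Set.mem_ofPred_eq, Set.mem_inter_iff, inv_one, Perm.coe_one,
      Function.comp_id]
  rw [orderCell_eq_preimage]
  exact (measurePreserving_comp_perm _).measurable h1

theorem volume_orderCell (σ : Perm (Fin N)) :
    volume (orderCell σ) = volume (orderCell (1 : Perm (Fin N))) := by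
  rw [orderCell_eq_preimage,
    (measurePreserving_comp_perm _).measure_preimage (measurableSet_orderCell 1).nullMeasurableSet]

/-- Two orders of the same point differ by a strictly increasing permutation of `Fin N`, which is
the identity. -/
theorem eq_of_mem_orderCell {σ τ : Perm (Fin N)} {z : Fin N → ℝ} (hσ : z ∈ orderCell σ)
    (hτ : z ∈ orderCell τ) : σ = τ := by
  have key : ∀ {σ : Perm (Fin N)}, z ∈ orderCell σ → ∀ i j, z i < z j ↔ σ i < σ j := by
    intro σ h i j
    have := h.2.lt_iff_lt (a := σ i) (b := σ j)
    simpa using this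
  have hmono : StrictMono (τ * σ⁻¹ : Perm (Fin N)) := fun i j hij => by
    rw [Perm.mul_apply, Perm.mul_apply, ← key hτ, key hσ]
    simpa using hij
  have h1 : (τ * σ⁻¹ : Perm (Fin N)) = 1 := by
    have h2 : ∀ i, (hmono.orderIsoOfSurjective _ (τ * σ⁻¹).surjective) i = i := fun i => by
      rw [Subsingleton.elim (hmono.orderIsoOfSurjective _ (τ * σ⁻¹).surjective) (OrderIso.refl _)]
      rfl
    exact Perm.ext h2
  exact (mul_inv_eq_one.1 h1).symm

theorem exists_mem_orderCell {z : Fin N → ℝ} (hz : ∀ i, z i ∈ Set.Icc (0 : ℝ) 1)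
    (hinj : Function.Injective z) : ∃ σ : Perm (Fin N), z ∈ orderCell σ := by
  refine ⟨(Tuple.sort z)⁻¹, hz, ?_⟩
  rw [inv_inv]
  exact (Tuple.monotone_sort z).strictMono_of_injective (hinj.comp (Tuple.sort z).injective)

/-- Each coincidence of two coordinates is a proper subspace, hence null. -/
theorem ae_injective : ∀ᵐ z : Fin N → ℝ, Function.Injective z := by
  have h : ∀ i j : Fin N, i ≠ j → ∀ᵐ z : Fin N → ℝ, z i ≠ z j := by
    intro i j hij
    let L : (Fin N → ℝ) →ₗ[ℝ] ℝ :=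
      LinearMap.proj (R := ℝ) (φ := fun _ : Fin N => ℝ) i - LinearMap.proj j
    have hL : LinearMap.ker L ≠ ⊤ := by
      intro h
      have : (Pi.single i 1 : Fin N → ℝ) ∈ LinearMap.ker L := h ▸ Submodule.mem_top
      rw [LinearMap.mem_ker] at this
      simp [L, hij.symm] at this
    have := Measure.addHaar_submodule (volume : Measure (Fin N → ℝ)) _ hL
    rw [ae_iff]
    convert this using 2
    ext z
    simp [L, sub_eq_zero]
  have h' : ∀ᵐ z : Fin N → ℝ, ∀ i j, i ≠ j → z i ≠ z j := by
    rw [ae_all_iff]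
    intro i
    rw [ae_all_iff]
    intro j
    by_cases hij : i = j
    · exact Filter.Eventually.of_forall fun z h => absurd hij h
    · filter_upwards [h i j hij] with z hz _ using hz
  filter_upwards [h'] with z hz i j hij
  by_contra hne
  exact hz i j hne hij

/-- The points of the cube whose last `k` coordinates are increasing. -/
def tailCube (n k : ℕ) : Set (Fin (n + k) → ℝ) :=
  {z | (∀ i, z i ∈ Set.Icc (0 : ℝ) 1) ∧ Monotone fun i : Fin k => z (Fin.natAdd n i)}

theorem measurableSet_tailCube : MeasurableSet (tailCube n k) := by
  have : tailCube n k = {z | ∀ i, z i ∈ Set.Icc (0 : ℝ) 1} ∩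
      ⋂ i : Fin k, ⋂ j : Fin k, ⋂ (_ : i ≤ j), {z | z (Fin.natAdd n i) ≤ z (Fin.natAdd n j)} := by
    ext z
    simp [tailCube, Monotone]
  rw [this]
  exact measurableSet_cube.inter <| MeasurableSet.iInter fun i => MeasurableSet.iInter fun j =>
    MeasurableSet.iInter fun _ => measurableSet_le (measurable_pi_apply _) (measurable_pi_apply _)

theorem orderCell_subset_tailCube {σ : Perm (Fin (n + k))} (hσ : TailIncreasing n k σ) :
    orderCell σ ⊆ tailCube n k := by
  refine fun z hz => ⟨hz.1, fun i j hij => ?_⟩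
  have := hz.2.monotone (hσ.monotone hij)
  simpa using this

theorem tailIncreasing_of_mem {σ : Perm (Fin (n + k))} {z : Fin (n + k) → ℝ}
    (hz : z ∈ orderCell σ) (hz' : z ∈ tailCube n k) : TailIncreasing n k σ := by
  intro i j hij
  by_contra h
  have hne : σ (Fin.natAdd n j) ≠ σ (Fin.natAdd n i) := fun h => hij.ne' (by simpa using h)
  have h1 := hz.2 (lt_of_le_of_ne (not_lt.1 h) hne)
  simp only [Function.comp_apply, Perm.coe_inv, Equiv.symm_apply_apply] at h1
  exact absurd (hz'.2 hij.le) (not_le.2 h1)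

theorem volume_cube : volume {z : Fin N → ℝ | ∀ i, z i ∈ Set.Icc (0 : ℝ) 1} = 1 := by
  rw [setOf_cube_eq, volume_pi_pi]
  simp

/-- The cells cover the cube up to a null set and have equal volumes, so they cannot all be null. -/
theorem volume_orderCell_one_ne_zero : volume (orderCell (1 : Perm (Fin N))) ≠ 0 := by
  intro h
  have h1 : volume (⋃ σ : Perm (Fin N), orderCell σ) = 0 := by
    rw [measure_iUnion_null_iff]
    intro σ
    rw [volume_orderCell, h]
  have h2 : volume {z : Fin N → ℝ | ∀ i, z i ∈ Set.Icc (0 : ℝ) 1} ≤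
      volume (⋃ σ : Perm (Fin N), orderCell σ) := by
    refine measure_mono_ae ?_
    filter_upwards [ae_injective] with z hz hc
    exact Set.mem_iUnion.2 (exists_mem_orderCell hc hz)
  rw [h1, volume_cube] at h2
  exact absurd h2 (by simp)

/-- Together with finiteness, this lets the uniform law of B entail that B is measurable; on a set
of volume zero the conditional measure would be zero. -/
theorem volume_orderedCube_ne_zero : volume (orderedCube k) ≠ 0 := by
  have h : orderCell (1 : Perm (Fin k)) ⊆ orderedCube k := fun z hz => ⟨hz.1, by
    simpa using hz.2.monotone⟩
  exact fun h0 => volume_orderCell_one_ne_zero (measure_mono_null h h0)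

theorem volume_orderedCube_ne_top : volume (orderedCube k) ≠ ⊤ := by
  have h : orderedCube k ⊆ {z | ∀ i, z i ∈ Set.Icc (0 : ℝ) 1} := fun z hz => hz.1
  exact ne_top_of_le_ne_top (by rw [volume_cube]; simp) (measure_mono h)

theorem measurePreserving_append :
    MeasurePreserving (fun p : (Fin n → ℝ) × (Fin k → ℝ) => (Fin.append p.1 p.2 : Fin (n + k) → ℝ))
      volume volume := by
  have h := (volume_measurePreserving_piCongrLeft (fun _ : Fin (n + k) => ℝ)
    (finSumFinEquiv (m := n) (n := k))).comp
    (volume_measurePreserving_sumPiEquivProdPi_symm (fun _ : Fin n ⊕ Fin k => ℝ))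
  convert h using 1
  ext p i
  obtain ⟨j, rfl⟩ := finSumFinEquiv.surjective i
  rw [Function.comp_apply, MeasurableEquiv.piCongrLeft_apply_apply]
  cases j <;> simp [MeasurableEquiv.sumPiEquivProdPi, Equiv.sumPiEquivProdPi]

theorem append_preimage_tailCube :
    (fun p : (Fin n → ℝ) × (Fin k → ℝ) => (Fin.append p.1 p.2 : Fin (n + k) → ℝ)) ⁻¹'
      tailCube n k = {z | ∀ i, z i ∈ Set.Icc (0 : ℝ) 1} ×ˢ orderedCube k := by
  ext p
  simp only [tailCube, orderedCube, Set.mem_preimage, Set.mem_ofPred_eq, Set.mem_prod,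
    Fin.forall_fin_add, Fin.append_left, Fin.append_right, and_assoc]

variable {Ω : Type*} [MeasurableSpace Ω] {μ : Measure Ω}
  {A : Fin n → Ω → ℝ} {B : Fin k → Ω → ℝ}

theorem aemeasurable_of_isUniform_Icc (hA : ∀ i, pdf.IsUniform (A i) (Set.Icc (0 : ℝ) 1) μ volume)
    (i : Fin n) : AEMeasurable (A i) μ :=
  (hA i).aemeasurable (by simp) (by simp)

theorem map_eq_restrict_cube [IsProbabilityMeasure μ]
    (hA : ∀ i, pdf.IsUniform (A i) (Set.Icc (0 : ℝ) 1) μ volume)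
    (hA_indep : iIndepFun A μ) :
    μ.map (fun ω i => A i ω) = volume.restrict {z | ∀ i, z i ∈ Set.Icc (0 : ℝ) 1} := by
  rw [(iIndepFun_iff_map_fun_eq_pi_map (aemeasurable_of_isUniform_Icc hA)).1 hA_indep,
    setOf_cube_eq, volume_pi, Measure.restrict_pi_pi]
  congr 1
  ext1 i
  rw [hA i, ProbabilityTheory.cond]
  simp

theorem map_append_eq [IsProbabilityMeasure μ]
    (hA : ∀ i, pdf.IsUniform (A i) (Set.Icc (0 : ℝ) 1) μ volume)
    (hA_indep : iIndepFun A μ)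
    (hB : pdf.IsUniform (fun ω i => B i ω) (orderedCube k) μ volume)
    (hAB : IndepFun (fun ω i => A i ω) (fun ω i => B i ω) μ) :
    μ.map (fun ω => (Fin.append (fun i => A i ω) (fun i => B i ω) : Fin (n + k) → ℝ)) =
      (volume (orderedCube k))⁻¹ • volume.restrict (tailCube n k) := by
  have hA' : AEMeasurable (fun ω i => A i ω) μ :=
    aemeasurable_pi_lambda _ (aemeasurable_of_isUniform_Icc hA)
  have hB' : AEMeasurable (fun ω i => B i ω) μ :=
    hB.aemeasurable volume_orderedCube_ne_zero volume_orderedCube_ne_top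
  have h1 := (indepFun_iff_map_prod_eq_prod_map_map hA' hB').1 hAB
  have h2 := (measurePreserving_append (n := n) (k := k)).restrict_preimage
    measurableSet_tailCube
  rw [append_preimage_tailCube] at h2
  rw [map_eq_restrict_cube hA hA_indep, hB, ProbabilityTheory.cond, Measure.prod_smul_right,
    Measure.prod_restrict, ← Measure.volume_eq_prod] at h1
  rw [← h2.map_eq, ← Measure.map_smul, ← h1,
    AEMeasurable.map_map_of_aemeasurable measurePreserving_append.measurable.aemeasurable
      (hA'.prodMk hB')]
  rfl

end Probability

end PieriGrowth

namespace PieriGrowth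

/-! ### From the sample to the average over permutations. -/

section Moments

open Equiv

variable {n k : ℕ}

/-- On the cell of σ the sample is the word of σ relabelled by a strictly increasing map, so both
have the same shapes. The boxes are the same set, and their enumeration is irrelevant to a symmetric
polynomial. -/
theorem eval_box_eq_of_mem_orderCell {P : MvPolynomial (Fin k) ℂ} (hP : P.IsSymmetric)
    {a : Fin n → ℝ} {b : Fin k → ℝ} {σ : Perm (Fin (n + k))} (h : Fin.append a b ∈ orderCell σ)
    (box : Fin k ≃ skewBoxes (rskShape (List.ofFn a)) (rskShape (List.ofFn a ++ List.ofFn b))) :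
    MvPolynomial.eval (fun i => (uCoord (box i) : ℂ)) P =
      MvPolynomial.eval (fun i : Fin k => (content (n + i) (recPath σ) : ℂ)) P := by
  -- The letters of σ are kept in `Fin (n + k)`, from which strictly increasing maps lead both to
  -- the sample in ℝ and to the word in ℕ.
  let s : List (Fin (n + k)) := List.ofFn fun i : Fin n => σ (Fin.castAdd k i)
  let t : List (Fin (n + k)) := List.ofFn fun i : Fin k => σ (Fin.natAdd n i)
  have ha : List.ofFn a = s.map (Fin.append a b ∘ (σ⁻¹ : Perm (Fin (n + k)))) := by
    simp only [s, List.map_ofFn]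
    congr 1
    ext i
    simp
  have hb : List.ofFn b = t.map (Fin.append a b ∘ (σ⁻¹ : Perm (Fin (n + k)))) := by
    simp only [t, List.map_ofFn]
    congr 1
    ext i
    simp
  have hw : permWord σ = s.map Fin.val ++ t.map Fin.val := by
    simp only [s, t, List.map_ofFn, permWord]
    rw [← List.ofFn_fin_append]
    congr 1
    ext i
    refine Fin.addCases (fun j => ?_) (fun j => ?_) i <;> simp
  have hs : rskShape (List.ofFn a) = rskShape (s.map Fin.val) := by
    rw [ha, rskShape_map h.2, rskShape_map Fin.val_strictMono]
  have hst : rskShape (List.ofFn a ++ List.ofFn b) = rskShape (s.map Fin.val ++ t.map Fin.val) := by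
    rw [ha, hb, ← List.map_append, ← List.map_append, rskShape_map h.2,
      rskShape_map Fin.val_strictMono]
  refine eval_eq_of_range_eq hP (f := fun i => (box i : ℕ × ℕ))
    (f' := fun i : Fin k => stepBox (recPath σ) (n + i))
    (Subtype.val_injective.comp box.injective)
    (fun i j hij => Fin.ext (Nat.add_left_cancel (stepBox_injective _ hij))) ?_
    (fun c => (uCoord c : ℂ))
  have h1 : Set.range (fun i => (box i : ℕ × ℕ)) =
      (skewBoxes (rskShape (List.ofFn a)) (rskShape (List.ofFn a ++ List.ofFn b)) :
        Set (ℕ × ℕ)) := by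
    have := box.surjective.range_comp (Subtype.val : _ → ℕ × ℕ)
    exact this.trans Subtype.range_coe
  rw [h1, range_stepBox, hs, hst, coe_skewBoxes, ← hw]
  simp [s, t, recPath]

-- The admissible cells have equal mass and exhaust the law of the sample, so the integral is a
-- plain average. The arbitrary enumeration of boxes needs no measurability: `F` is almost
-- everywhere a finite sum of cell indicators composed with `Z`.
open Classical in
theorem integral_eq_average {Ω : Type*} [MeasurableSpace Ω] {μ : Measure Ω}
    [IsProbabilityMeasure μ] {Z : Ω → Fin (n + k) → ℝ} (hZ : AEMeasurable Z μ) {c : ENNReal}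
    (hc : μ.map Z = c • volume.restrict (tailCube n k)) {F : Ω → ℂ}
    {G : Perm (Fin (n + k)) → ℂ} (hF : ∀ ω σ, Z ω ∈ orderCell σ → F ω = G σ) :
    Integrable F μ ∧
      ((Finset.univ.filter fun σ => TailIncreasing n k σ).card : ℂ) * ∫ ω, F ω ∂μ =
        ∑ σ : Perm (Fin (n + k)) with TailIncreasing n k σ, G σ := by
  have hcell : ∀ᵐ ω ∂μ, ∃ σ, TailIncreasing n k σ ∧ Z ω ∈ orderCell σ := by
    refine ae_of_ae_map (p := fun z => ∃ σ, TailIncreasing n k σ ∧ z ∈ orderCell σ) hZ ?_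
    rw [hc]
    refine Measure.ae_smul_measure ?_ c
    filter_upwards [ae_restrict_mem measurableSet_tailCube, ae_restrict_of_ae ae_injective]
      with z hz hinj
    obtain ⟨σ, hσ⟩ := exists_mem_orderCell hz.1 hinj
    exact ⟨σ, tailIncreasing_of_mem hσ hz, hσ⟩
  have hprob : IsProbabilityMeasure (μ.map Z) := Measure.isProbabilityMeasure_map hZ
  have hmass : ∀ σ, TailIncreasing n k σ → (μ.map Z).real (orderCell σ) =
      (c * volume (orderCell (1 : Perm (Fin (n + k))))).toReal := fun σ hσ => by
    rw [Measure.real, hc, Measure.smul_apply, Measure.restrict_apply (measurableSet_orderCell σ),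
      Set.inter_eq_left.2 (orderCell_subset_tailCube hσ), volume_orderCell, smul_eq_mul]
  set p := (c * volume (orderCell (1 : Perm (Fin (n + k))))).toReal with hp
  have main : ∀ {F : Ω → ℂ} {G : Perm (Fin (n + k)) → ℂ},
      (∀ ω σ, Z ω ∈ orderCell σ → F ω = G σ) → Integrable F μ ∧
        ∫ ω, F ω ∂μ = p * ∑ σ : Perm (Fin (n + k)) with TailIncreasing n k σ, G σ := by
    intro F G hF
    let H : (Fin (n + k) → ℝ) → ℂ := fun z =>
      ∑ σ : Perm (Fin (n + k)) with TailIncreasing n k σ, (orderCell σ).indicator (fun _ => G σ) z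
    have hint : ∀ σ : Perm (Fin (n + k)),
        Integrable ((orderCell σ).indicator fun _ => G σ) (μ.map Z) := fun σ =>
      (integrable_const _).indicator (measurableSet_orderCell σ)
    have hH : Integrable H (μ.map Z) := integrable_finsetSum _ fun σ _ => hint σ
    have hFH : F =ᵐ[μ] fun ω => H (Z ω) := by
      filter_upwards [hcell] with ω hω
      obtain ⟨σ, hσ, hZσ⟩ := hω
      have : H (Z ω) = (orderCell σ).indicator (fun _ => G σ) (Z ω) := by
        refine Finset.sum_eq_single_of_mem σ (by simpa using hσ) fun τ _ hτ => ?_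
        exact Set.indicator_of_notMem (fun h => hτ (eq_of_mem_orderCell h hZσ)) _
      rw [this, Set.indicator_of_mem hZσ, hF ω σ hZσ]
    refine ⟨(hH.comp_aemeasurable hZ).congr hFH.symm, ?_⟩
    rw [integral_congr_ae hFH, ← integral_map hZ hH.aestronglyMeasurable,
      integral_finsetSum _ fun σ _ => hint σ, Finset.mul_sum]
    refine Finset.sum_congr rfl fun σ hσ => ?_
    rw [integral_indicator_const _ (measurableSet_orderCell σ),
      hmass σ (Finset.mem_filter.1 hσ).2, Complex.real_smul]
  -- The common mass p of the cells is never computed; the constant function 1 shows that p times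
  -- the number of cells is 1.
  have hone := (main (F := fun _ => 1) (G := fun _ => 1) fun _ _ _ => rfl).2
  obtain ⟨h1, h2⟩ := main hF
  refine ⟨h1, ?_⟩
  rw [h2, ← mul_assoc]
  simp only [integral_const, probReal_univ, one_smul, Finset.sum_const, nsmul_eq_mul,
    mul_one] at hone
  rw [mul_comm _ (p : ℂ), ← hone, one_mul]

end Moments

end PieriGrowth

theorem mainTheorem10 (n k : ℕ) (hn : 1 ≤ n) (hk : 1 ≤ k)
    {Ω : Type*} [MeasurableSpace Ω] (μ : Measure Ω) [IsProbabilityMeasure μ]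
    -- `A₁, …, A_n` are i.i.d. `U(0,1)`, and `B` is independent of them and uniformly distributed
    -- on the set of increasing sequences
    (A : Fin n → Ω → ℝ) (B : Fin k → Ω → ℝ)
    (hA_unif : ∀ i, pdf.IsUniform (A i) (Set.Icc (0 : ℝ) 1) μ volume)
    (hA_indep : iIndepFun A μ)
    (hB_unif : pdf.IsUniform (fun ω i => B i ω) (orderedCube k) μ volume)
    (hAB_indep : IndepFun (fun ω i => A i ω) (fun ω i => B i ω) μ)
    -- the Pieri growth pair
    (Lam Gam : Ω → YoungDiagram)
    (hLam : ∀ ω, Lam ω = rskShape (List.ofFn fun i => A i ω))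
    (hGam : ∀ ω, Gam ω =
      rskShape ((List.ofFn fun i => A i ω) ++ (List.ofFn fun i => B i ω)))
    -- an arbitrary enumeration of the `k` boxes of `Gam ∖ Lam`
    (box : ∀ ω, Fin k ≃ skewBoxes (Lam ω) (Gam ω))
    (P : MvPolynomial (Fin k) ℂ) (hP : P.IsSymmetric) :
    Integrable (fun ω => MvPolynomial.eval (fun i => (uCoord (box ω i) : ℂ)) P) μ ∧
    ∫ ω, MvPolynomial.eval (fun i => (uCoord (box ω i) : ℂ)) P ∂μ =
      charApply (tensorChar (chiReg (Equiv.Perm (Fin n))) (chiTriv (Equiv.Perm (Fin k))))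
        (restrictYoung (evalJucysMurphy n P)) := by
  have hZ : AEMeasurable
      (fun ω => (Fin.append (fun i => A i ω) (fun i => B i ω) : Fin (n + k) → ℝ)) μ :=
    measurePreserving_append.measurable.comp_aemeasurable
      ((aemeasurable_pi_lambda _ (aemeasurable_of_isUniform_Icc hA_unif)).prodMk
        (hB_unif.aemeasurable volume_orderedCube_ne_zero volume_orderedCube_ne_top))
  obtain rfl : Lam = _ := funext hLam
  obtain rfl : Gam = _ := funext hGam
  obtain ⟨h1, h2⟩ := integral_eq_average hZ
    (map_append_eq hA_unif hA_indep hB_unif hAB_indep)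
    fun ω σ hσ => eval_box_eq_of_mem_orderCell hP hσ (box ω)
  refine ⟨h1, ?_⟩
  rw [sum_tailIncreasing_eval hP] at h2
  -- Both sides carry the number of tail-increasing permutations, which is nonzero because k! times
  -- it is (n + k)!.
  refine mul_left_cancel₀ ?_ h2
  have := factorial_mul_card_tailIncreasing (n := n) (k := k)
  intro h0
  rw [Nat.cast_eq_zero] at h0
  rw [h0, mul_zero] at this
  exact (Nat.factorial_ne_zero _ this.symm)
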